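/- **Setting.** An instance $(\gamma,d)=(V_1,V_2,\gamma,d)$ of the two-class partition adjacency matrix model consists of a node set $V=\{1,\dots,n\}$ partitioned into two classes $V_1,V_2$, an integer $\gamma$ with $1\le\gamma\le|V_1||V_2|-1$, and a sequence $d=(d_1,\dots,d_n)$ of non-negative integers. $\mathcal G(\gamma,d)$ is the set of simple graphs on $V$ in which every node $i$ has degree $d_i$ and exactly $\gamma$ edges join $V_1$ to $V_2$; the instance is graphical if $\mathcal G(\gamma,d)\neq\emptyset$. $\mathcal G'(\gamma,d)$ is the set of simple graphs on $V$ whose degree sequence $d'$ and number $\gamma'$ of edges between $V_1$ and $V_2$ satisfy $\sum_i(d_i-d_i')=0$, $\sum_i|d_i-d_i'|\in\{0,2,4\}$ and $\gamma'\in\{\gamma-1,\gamma,\gamma+1\}$. The hinge flip chain $\mathcal M(\gamma,d)$ on $\mathcal G'(\gamma,d)$ does nothing with probability $1/2$; otherwise it selects an ordered triple $(i,j,k)\in V^3$ uniformly at random and, if $\{i,j\}\in E(G)$, $j\ne k$, $\{j,k\}\notin E(G)$ and $G-\{i,j\}+\{j,k\}\in\mathcal G'(\gamma,d)$, moves from the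 current state $G$ to $G-\{i,j\}+\{j,k\}$. Let $P$ be its transition matrix and $\pi$ the uniform distribution on $\mathcal G'(\gamma,d)$. The state space graph has an arc $(G,H)$ whenever $G\neq H$ and $P(G,H)>0$. A family $\mathcal D$ of graphical instances is strongly stable with respect to the constant $k$ if, for every $(\gamma,d)\in\mathcal D$, every state in $\mathcal G'(\gamma,d)$ has distance at most $k$ from $\mathcal G(\gamma,d)$ in the state space graph. A multicommodity flow $f$ assigns a weight $f(p)\ge0$ to every simple directed path $p$ between distinct states so that, for all $G\neq H$, the paths from $G$ to $H$ have total weight $\pi(G)\pi(H)$; $f(e)$ is the total weight of the paths through the arc $e$, and $\ell(f)$ is the maximum length of a path of positive weight. The mixing time is $\tau(\epsilon)=\max_G\min\{t:\tfrac12\sum_H|P^{t'}(G,H)-\pi(H)|\le\epsilon\text{ for all }t'\ge t\}$. **Theorem.** Let $\mathcal D$ be a family of graphical instances $(\gamma,d)$ that is strongly stable with respect to some constant $k$. Then there are polynomials $p,r,s$ such that for every $(\gamma,d)\in\mathcal D$, with $d=(d_1,\dots,d_n)$, there is an efficient multicommodity flow $f$ for $\mathcal M(\gamma,d)$ on $\mathcal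 G'(\gamma,d)$, that is, one satisfying $$\max_e f(e)\le\frac{p(n)}{|\mathcal G'(\gamma,d)|}\qquad\text{and}\qquad \ell(f)\le r(n),$$ and $1/P(G,H)\le s(n)$ for every arc $(G,H)$ of the state space graph. Consequently the chain is rapidly mixing: there is a polynomial $q$ such that for all $(\gamma,d)\in\mathcal D$ and all $0<\epsilon<1$ $$\tau(\epsilon)\le q(n)\,\ln\!\big(|\mathcal G'(\gamma,d)|/\epsilon\big).$$ -/

import Mathlib

/-! ## Finite Markov chains: mixing time and multicommodity flows

A chain on a finite state space `Ω` is given by its transition matrix `P : Matrix Ω Ω ℝ`, together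
with the distribution `π : Ω → ℝ` it is compared with. -/

namespace MarkovChain

variable {Ω : Type*}

/-- `(x, y)` is an arc of the state space graph: `x ≠ y` and `P x y > 0`. -/
def Arc (P : Matrix Ω Ω ℝ) (x y : Ω) : Prop := x ≠ y ∧ 0 < P x y

/-- There is a directed path (a sequence of vertices, consecutive ones joined by arcs) with at most
`r` arcs from `x` to `y` in the state space graph. -/
def WithinDist (P : Matrix Ω Ω ℝ) (r : ℕ) (x y : Ω) : Prop :=
  ∃ l : List Ω, l.head? = some x ∧ l.getLast? = some y ∧ l.IsChain (Arc P) ∧ l.length ≤ r + 1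

/-- Total variation distance `½ ∑_y |P^t(x,y) - π(y)|` at time `t` from the initial state `x`. -/
noncomputable def tvDist [Fintype Ω] (P : Matrix Ω Ω ℝ) (π : Ω → ℝ) (x : Ω) (t : ℕ) : ℝ :=
  open Classical in (1 / 2) * ∑ y, |(P ^ t) x y - π y|

/-- The mixing time `τ(ε) = max_x min {t : Δ_x(t') ≤ ε for all t' ≥ t}`; it is `⊤` if for some `x`
there is no such `t`. -/
noncomputable def mixingTime [Fintype Ω] (P : Matrix Ω Ω ℝ) (π : Ω → ℝ) (ε : ℝ) : ℕ∞ :=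
  ⨆ x : Ω, ⨅ (t : ℕ) (_ : ∀ t' : ℕ, t ≤ t' → tvDist P π x t' ≤ ε), (t : ℕ∞)

/-- A simple directed path between two distinct states in the state space graph. -/
structure SimplePath (P : Matrix Ω Ω ℝ) where
  /-- the states visited, in order -/
  verts : List Ω
  two_le : 2 ≤ verts.length
  nodup : verts.Nodup
  isChain : verts.IsChain (Arc P)

namespace SimplePath

variable {P : Matrix Ω Ω ℝ}

instance [Finite Ω] : Finite (SimplePath P) := by
  classical
  have := Fintype.ofFinite Ω
  refine Finite.of_injective
    (fun p : SimplePath P => (⟨p.verts, p.nodup⟩ : {l : List Ω // l.Nodup})) ?_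
  rintro ⟨a, _, _, _⟩ ⟨b, _, _, _⟩ h
  simp only [Subtype.mk.injEq] at h
  subst h
  rfl

noncomputable instance [Finite Ω] : Fintype (SimplePath P) := Fintype.ofFinite _

/-- The path starts in `x` and ends in `y`. -/
def Joins (p : SimplePath P) (x y : Ω) : Prop :=
  p.verts.head? = some x ∧ p.verts.getLast? = some y

/-- The path traverses the arc `(x, y)`: `x` and `y` are consecutive on it, in this order. -/
def Uses (p : SimplePath P) (x y : Ω) : Prop := [x, y] <:+: p.verts

/-- The number of arcs of the path. -/
def length (p : SimplePath P) : ℕ := p.verts.length - 1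

end SimplePath

/-- A multicommodity flow: a nonnegative weight on the simple paths of the state space graph that
routes `π(x) π(y)` units from `x` to `y`, for all distinct states `x`, `y`. -/
structure Flow [Fintype Ω] (P : Matrix Ω Ω ℝ) (π : Ω → ℝ) where
  /-- the amount of flow carried by a path -/
  amount : SimplePath P → ℝ
  nonneg : ∀ p, 0 ≤ amount p
  routes : ∀ x y : Ω, x ≠ y →
    (open Classical in ∑ p with SimplePath.Joins p x y, amount p) = π x * π y

namespace Flow

variable [Fintype Ω] {P : Matrix Ω Ω ℝ} {π : Ω → ℝ}

/-- The total flow `f(e)` through the arc `e = (x, y)`. -/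
noncomputable def onArc (f : Flow P π) (x y : Ω) : ℝ :=
  open Classical in ∑ p with SimplePath.Uses p x y, f.amount p

/-- The length `ℓ(f)` of a longest flow carrying path. -/
noncomputable def maxLength (f : Flow P π) : ℕ :=
  open Classical in (Finset.univ.filter fun p => 0 < f.amount p).sup SimplePath.length

end Flow

end MarkovChain

/-! ## The partition adjacency matrix model with two classes -/

/-- An instance `(V₁, V₂, γ, d)` of the partition adjacency matrix model with two classes: the node
set is `Fin n`, the classes are `V₁` and its complement `V₂`, `γ = c₁₂` is the prescribed number of
edges between the classes, and `d` is the prescribed degree sequence. (The other entries of the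
partition adjacency matrix are determined by `γ` and `d`.) -/
structure TwoClassPAM where
  n : ℕ
  V₁ : Finset (Fin n)
  γ : ℕ
  d : Fin n → ℕ
  one_le_γ : 1 ≤ γ
  γ_lt : γ < V₁.card * V₁ᶜ.card

namespace TwoClassPAM

variable (I : TwoClassPAM)

/-- The degree of a node. -/
noncomputable def deg (G : SimpleGraph (Fin I.n)) (v : Fin I.n) : ℕ :=
  open Classical in G.degree v

/-- The number of edges with one endpoint in each class. -/
noncomputable def cut (G : SimpleGraph (Fin I.n)) : ℕ :=
  open Classical in (G.interedges I.V₁ I.V₁ᶜ).card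

/-- `G ∈ 𝒢(γ,d)`: `G` is a graphical realization of the instance. -/
def IsRealization (G : SimpleGraph (Fin I.n)) : Prop :=
  (∀ v, I.deg G v = I.d v) ∧ I.cut G = I.γ

/-- The instance is graphical, i.e. `𝒢(γ,d) ≠ ∅`. -/
def IsGraphical : Prop := ∃ G, I.IsRealization G

/-- `G ∈ 𝒢'(γ,d)`: the degree sequence `d'` and the number `c₁₂'` of cut edges of `G` satisfy
`∑ (dᵢ - dᵢ') = 0`, `∑ |dᵢ - dᵢ'| ∈ {0,2,4}` and `c₁₂' ∈ {γ-1, γ, γ+1}`. -/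
def IsState (G : SimpleGraph (Fin I.n)) : Prop :=
  ∑ v, ((I.d v : ℤ) - I.deg G v) = 0 ∧
  ∑ v, |(I.d v : ℤ) - I.deg G v| ∈ ({0, 2, 4} : Set ℤ) ∧
  (I.cut G : ℤ) ∈ ({(I.γ : ℤ) - 1, (I.γ : ℤ), (I.γ : ℤ) + 1} : Set ℤ)

/-- The state space `𝒢'(γ,d)`. -/
abbrev State : Type := {G : SimpleGraph (Fin I.n) // I.IsState G}

noncomputable instance : Fintype I.State := Fintype.ofFinite _

/-- The graph `G - {i,j} + {j,k}`. -/
def flip (G : SimpleGraph (Fin I.n)) (i j k : Fin I.n) : SimpleGraph (Fin I.n) :=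
  G.deleteEdges {s(i, j)} ⊔ SimpleGraph.edge j k

/-- The hinge flip on the ordered triple `(i,j,k)` can be carried out in state `G`. -/
def CanFlip (G : I.State) (i j k : Fin I.n) : Prop :=
  G.1.Adj i j ∧ j ≠ k ∧ ¬ G.1.Adj j k ∧ I.IsState (I.flip G.1 i j k)

/-- The state reached from `G` when the ordered triple `(i,j,k)` has been selected. -/
noncomputable def move (G : I.State) (t : Fin I.n × Fin I.n × Fin I.n) : I.State :=
  open Classical in
  if h : I.CanFlip G t.1 t.2.1 t.2.2 then ⟨I.flip G.1 t.1 t.2.1 t.2.2, h.2.2.2⟩ else G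

/-- The transition matrix of the hinge flip chain `ℳ(γ,d)`: with probability `1/2` do nothing,
otherwise select an ordered triple of nodes uniformly at random and perform the hinge flip on it if
that is possible. -/
noncomputable def hingeFlipChain : Matrix I.State I.State ℝ := fun G H =>
  open Classical in
  (1 / 2) * (if G = H then 1 else 0) +
    (1 / 2) * (((Finset.univ.filter fun t => I.move G t = H).card : ℝ) / (I.n : ℝ) ^ 3)

/-- The uniform distribution on `𝒢'(γ,d)`. -/
noncomputable def uniform : I.State → ℝ := fun _ => 1 / (Fintype.card I.State : ℝ)

/-- The distance of a state from the set `𝒢(γ,d)` of realizations in the state space graph (`⊤` if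
no realization can be reached). -/
noncomputable def distToRealization (G : I.State) : ℕ∞ :=
  ⨅ (r : ℕ) (_ : ∃ H : I.State, I.IsRealization H.1 ∧
    MarkovChain.WithinDist I.hingeFlipChain r G H), (r : ℕ∞)

/-- The parameter `k(γ,d) = max_G dist(G,γ,d)`, the maximum being over all states `G`. -/
noncomputable def kParam : ℕ∞ := ⨆ G : I.State, I.distToRealization G

/-- A family of graphical instances is strongly stable with respect to the constant `k` if
`k(γ,d) ≤ k` for all its members. -/
def StronglyStable (𝒟 : Set TwoClassPAM) (k : ℕ) : Prop :=
  ∀ I ∈ 𝒟, I.IsGraphical ∧ I.kParam ≤ k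

end TwoClassPAM

/-! ## From flows to mixing times -/

namespace MarkovChain

section Mixing

variable {Ω : Type*}

/-- The Cauchy–Schwarz inequality along a path. -/
lemma sq_sub_le_of_nodup [Fintype Ω] (g : Ω → ℝ) :
    ∀ (l : List Ω) (x y : Ω), l.Nodup → l.head? = some x → l.getLast? = some y →
      (g x - g y) ^ 2 ≤ ((l.length - 1 : ℕ) : ℝ) *
        (open Classical in ∑ e : Ω × Ω with [e.1, e.2] <:+: l, (g e.1 - g e.2) ^ 2) := by
  classical
  intro l
  induction l with
  | nil => intro x y _ hx; simp at hx
  | cons a l ih =>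
    intro x y hnd hx hy
    simp only [List.head?_cons, Option.some.injEq] at hx
    subst hx
    cases l with
    | nil =>
      simp only [List.getLast?_singleton, Option.some.injEq] at hy
      subst hy
      simp
    | cons b l =>
      have hnd' := (List.nodup_cons.1 hnd).2
      have ha := (List.nodup_cons.1 hnd).1
      have hy' : (b :: l).getLast? = some y := by simpa [List.getLast?_cons_cons] using hy
      have h := ih b y hnd' rfl hy'
      set Y := ∑ e : Ω × Ω with [e.1, e.2] <:+: (b :: l), (g e.1 - g e.2) ^ 2 with hY
      have hsub : insert (a, b) (Finset.univ.filter fun e : Ω × Ω => [e.1, e.2] <:+: (b :: l)) ⊆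
          Finset.univ.filter fun e : Ω × Ω => [e.1, e.2] <:+: (a :: b :: l) := by
        intro e he
        simp only [Finset.mem_insert, Finset.mem_filter, Finset.mem_univ, true_and] at he ⊢
        rcases he with rfl | he
        · exact ⟨[], l, by simp⟩
        · exact he.trans (List.suffix_cons a _).isInfix
      -- Distinctness of the vertices prevents the first arc from recurring, so its term splits off
      -- the sum.
      have hnot : (a, b) ∉ (Finset.univ.filter fun e : Ω × Ω => [e.1, e.2] <:+: (b :: l)) := by
        simp only [Finset.mem_filter, Finset.mem_univ, true_and]
        intro hin
        exact ha (hin.subset (by simp))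
      have hsum : (g a - g b) ^ 2 + Y ≤
          ∑ e : Ω × Ω with [e.1, e.2] <:+: (a :: b :: l), (g e.1 - g e.2) ^ 2 := by
        refine le_trans (le_of_eq ?_)
          (Finset.sum_le_sum_of_subset_of_nonneg hsub fun _ _ _ => sq_nonneg _)
        rw [Finset.sum_insert hnot]
      have hk : (((a :: b :: l).length - 1 : ℕ) : ℝ) = (l.length : ℝ) + 1 := by simp
      have hk' : (((b :: l).length - 1 : ℕ) : ℝ) = (l.length : ℝ) := by simp
      rw [hk]
      rw [hk'] at h
      have hY0 : 0 ≤ Y := Finset.sum_nonneg fun _ _ => sq_nonneg _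
      refine le_trans ?_ (mul_le_mul_of_nonneg_left hsum (by positivity))
      rcases Nat.eq_zero_or_pos l.length with h0 | h0
      · simp only [h0, Nat.cast_zero, zero_mul] at h ⊢
        have : g b - g y = 0 := by nlinarith [sq_nonneg (g b - g y)]
        have : g a - g y = g a - g b := by linarith
        rw [this]; linarith
      · have hm : (0 : ℝ) < l.length := by exact_mod_cast h0
        set m : ℝ := (l.length : ℝ)
        have e1 : (g a - g y) = (g a - g b) + (g b - g y) := by ring
        rw [e1]
        set u := g a - g b
        set v := g b - g y
        -- AM–GM with weight m: 2uv ≤ m u² + v²/m, and v² ≤ m Y by induction.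
        have h2 : 2 * u * v ≤ m * u ^ 2 + Y := by
          have h3 : 0 ≤ (m * u - v) ^ 2 := sq_nonneg _
          have : m * (2 * u * v) ≤ m * (m * u ^ 2 + Y) := by nlinarith
          exact le_of_mul_le_mul_left this hm
        nlinarith

variable [Fintype Ω]

/-- The variance of `f` under `q` is nonnegative. -/
lemma sum_eq_one_sq_le (q f : Ω → ℝ) (hq : ∀ y, 0 ≤ q y) (h1 : ∑ y, q y = 1) :
    (∑ y, q y * f y) ^ 2 ≤ ∑ y, q y * f y ^ 2 := by
  set m := ∑ y, q y * f y with hm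
  have h : 0 ≤ ∑ y, q y * (f y - m) ^ 2 :=
    Finset.sum_nonneg fun y _ => mul_nonneg (hq y) (sq_nonneg _)
  have e : ∑ y, q y * (f y - m) ^ 2 = ∑ y, q y * f y ^ 2 - 2 * m * m + m ^ 2 * 1 := by
    have h2 : ∀ y, q y * (f y - m) ^ 2 = q y * f y ^ 2 - 2 * m * (q y * f y) + m ^ 2 * q y :=
      fun y => by ring
    simp only [h2, Finset.sum_add_distrib, Finset.sum_sub_distrib, ← Finset.mul_sum, h1, ← hm]
  nlinarith

/-- A symmetric stochastic matrix all of whose diagonal entries are at least `1 / 2`. -/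
structure LazySymm (P : Matrix Ω Ω ℝ) : Prop where
  symm : ∀ x y, P x y = P y x
  nonneg : ∀ x y, 0 ≤ P x y
  row_sum : ∀ x, ∑ y, P x y = 1
  half_le : ∀ x, 1 / 2 ≤ P x x

variable {P : Matrix Ω Ω ℝ}

/-- Laziness makes Q = 2P - 1 symmetric and stochastic, hence an ℓ² contraction; expanding ‖2Pf -
f‖² ≤ ‖f‖² gives the claim. In spectral terms the eigenvalues lie in [0, 1], so λ² ≤ λ. -/
lemma LazySymm.sum_sq_le (hP : LazySymm P) (f : Ω → ℝ) :
    ∑ x, (P.mulVec f x) ^ 2 ≤ ∑ x, f x * P.mulVec f x := by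
  classical
  let q : Ω → Ω → ℝ := fun x y => 2 * P x y - if x = y then 1 else 0
  have hq : ∀ x y, 0 ≤ q x y := by
    intro x y
    by_cases h : x = y
    · subst h
      have := hP.half_le x
      simp only [q, if_pos]; linarith
    · have := hP.nonneg x y
      simp only [q, if_neg h]; linarith
  have hq1 : ∀ x, ∑ y, q x y = 1 := by
    intro x
    simp only [q, Finset.sum_sub_distrib, ← Finset.mul_sum, hP.row_sum]
    simp; norm_num
  have hqs : ∀ x y, q x y = q y x := by
    intro x y
    simp only [q, hP.symm x y, eq_comm]
  have hqf : ∀ x, ∑ y, q x y * f y = 2 * P.mulVec f x - f x := by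
    intro x
    simp only [q, sub_mul, Finset.sum_sub_distrib, Matrix.mulVec, dotProduct, Finset.mul_sum]
    congr 1
    · exact Finset.sum_congr rfl fun y _ => by ring
    · simp
  have h1 : ∑ x, (2 * P.mulVec f x - f x) ^ 2 ≤ ∑ x, f x ^ 2 := by
    calc ∑ x, (2 * P.mulVec f x - f x) ^ 2 ≤ ∑ x, ∑ y, q x y * f y ^ 2 := by
          refine Finset.sum_le_sum fun x _ => ?_
          rw [← hqf]
          exact sum_eq_one_sq_le _ _ (hq x) (hq1 x)
      _ = ∑ y, ∑ x, q y x * f y ^ 2 := by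
          rw [Finset.sum_comm]
          exact Finset.sum_congr rfl fun y _ => Finset.sum_congr rfl fun x _ => by rw [hqs]
      _ = ∑ y, f y ^ 2 := by
          refine Finset.sum_congr rfl fun y _ => ?_
          rw [← Finset.sum_mul, hq1, one_mul]
  have h2 : ∑ x, (2 * P.mulVec f x - f x) ^ 2 =
      4 * ∑ x, (P.mulVec f x) ^ 2 - 4 * ∑ x, f x * P.mulVec f x + ∑ x, f x ^ 2 := by
    rw [Finset.mul_sum, Finset.mul_sum, ← Finset.sum_sub_distrib, ← Finset.sum_add_distrib]
    exact Finset.sum_congr rfl fun x _ => by ring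
  linarith

lemma LazySymm.dirichlet_eq (hP : LazySymm P) (f : Ω → ℝ) :
    ∑ x, ∑ y, P x y * (f x - f y) ^ 2 = 2 * ∑ x, f x ^ 2 - 2 * ∑ x, f x * P.mulVec f x := by
  have h1 : ∑ x, ∑ y, P x y * f x ^ 2 = ∑ x, f x ^ 2 :=
    Finset.sum_congr rfl fun x _ => by rw [← Finset.sum_mul, hP.row_sum, one_mul]
  have h2 : ∑ x, ∑ y, P x y * f y ^ 2 = ∑ x, f x ^ 2 := by
    rw [Finset.sum_comm]
    refine Finset.sum_congr rfl fun x _ => ?_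
    rw [← Finset.sum_mul, Finset.sum_congr rfl fun y _ => hP.symm y x, hP.row_sum, one_mul]
  have h3 : ∑ x, f x * P.mulVec f x = ∑ x, ∑ y, P x y * (f x * f y) :=
    Finset.sum_congr rfl fun x _ => by
      simp only [Matrix.mulVec, dotProduct, Finset.mul_sum]
      exact Finset.sum_congr rfl fun y _ => by ring
  rw [h3]
  have : ∀ x y, P x y * (f x - f y) ^ 2 =
      P x y * f x ^ 2 + P x y * f y ^ 2 - 2 * (P x y * (f x * f y)) := fun x y => by ring
  simp only [this, Finset.sum_sub_distrib, Finset.sum_add_distrib, ← Finset.mul_sum, h1, h2]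
  ring

/-- The Poincaré inequality provided by a flow. -/
lemma Flow.poincare {π : Ω → ℝ} (hπ : ∀ x, π x = 1 / (Fintype.card Ω : ℝ))
    (F : Flow P π) (hP : ∀ x y, 0 ≤ P x y) {p r s : ℝ} (hp : 0 ≤ p)
    (hF : ∀ x y, Arc P x y → F.onArc x y ≤ p / (Fintype.card Ω : ℝ))
    (hr : (F.maxLength : ℝ) ≤ r) (hs : ∀ x y, Arc P x y → 1 / P x y ≤ s)
    (g : Ω → ℝ) (hg : ∑ x, g x = 0) :
    2 * ∑ x, g x ^ 2 ≤ p * r * s * ∑ x, ∑ y, P x y * (g x - g y) ^ 2 := by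
  classical
  rcases isEmpty_or_nonempty Ω with hE | hE
  · simp
  have hN : (0 : ℝ) < Fintype.card Ω := by exact_mod_cast Fintype.card_pos
  set N : ℝ := ((Fintype.card Ω : ℕ) : ℝ) with hNdef
  have hr0 : 0 ≤ r := le_trans (Nat.cast_nonneg _) hr
  have e1 : ∑ x, ∑ y, (g x - g y) ^ 2 = 2 * N * ∑ x, g x ^ 2 := by
    have : ∀ x y, (g x - g y) ^ 2 = g x ^ 2 + g y ^ 2 - 2 * g x * g y := fun x y => by ring
    simp only [this, Finset.sum_sub_distrib, Finset.sum_add_distrib, ← Finset.mul_sum, hg]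
    simp only [Finset.sum_const, Finset.card_univ, nsmul_eq_mul, ← Finset.mul_sum, ← hNdef,
      mul_zero]
    ring
  -- the ends of every flow carrying path
  have key : ∀ x y, x ≠ y → π x * π y * (g x - g y) ^ 2 ≤
      ∑ q : SimplePath P with q.Joins x y, F.amount q * (r *
        ∑ e : Ω × Ω with q.Uses e.1 e.2, (g e.1 - g e.2) ^ 2) := by
    intro x y hxy
    have hroute := F.routes x y hxy
    rw [← hroute, Finset.sum_mul]
    refine Finset.sum_le_sum fun q hq => ?_
    rcases (F.nonneg q).eq_or_lt with h0 | h0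
    · rw [← h0]; simp
    refine mul_le_mul_of_nonneg_left ?_ (F.nonneg q)
    have hj := (Finset.mem_filter.1 hq).2
    refine (sq_sub_le_of_nodup g q.verts x y q.nodup hj.1 hj.2).trans ?_
    refine mul_le_mul ?_ (Finset.sum_le_sum_of_subset_of_nonneg
      (fun e he => Finset.mem_filter.2 ⟨Finset.mem_univ _, (Finset.mem_filter.1 he).2⟩)
      fun _ _ _ => sq_nonneg _) (Finset.sum_nonneg fun _ _ => sq_nonneg _) hr0
    refine le_trans ?_ hr
    have : q.length ≤ F.maxLength :=
      Finset.le_sup (f := SimplePath.length) (Finset.mem_filter.2 ⟨Finset.mem_univ _, h0⟩)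
    exact_mod_cast this
  have hnn : ∀ q : SimplePath P, 0 ≤ F.amount q * (r *
        ∑ e : Ω × Ω with q.Uses e.1 e.2, (g e.1 - g e.2) ^ 2) := fun q =>
    mul_nonneg (F.nonneg q) (mul_nonneg hr0 (Finset.sum_nonneg fun _ _ => sq_nonneg _))
  have e2 : ∑ z : Ω × Ω, π z.1 * π z.2 * (g z.1 - g z.2) ^ 2 ≤
      ∑ q : SimplePath P, F.amount q * (r *
        ∑ e : Ω × Ω with q.Uses e.1 e.2, (g e.1 - g e.2) ^ 2) := by
    calc _ ≤ ∑ z : Ω × Ω, ∑ q : SimplePath P with q.Joins z.1 z.2, F.amount q * (r *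
          ∑ e : Ω × Ω with q.Uses e.1 e.2, (g e.1 - g e.2) ^ 2) := by
          refine Finset.sum_le_sum fun z _ => ?_
          by_cases h : z.1 = z.2
          · rw [h, sub_self]
            simpa using Finset.sum_nonneg fun q _ => hnn q
          · exact key _ _ h
      _ = ∑ q : SimplePath P, ∑ z : Ω × Ω, if q.Joins z.1 z.2 then F.amount q * (r *
          ∑ e : Ω × Ω with q.Uses e.1 e.2, (g e.1 - g e.2) ^ 2) else 0 := by
          rw [Finset.sum_comm]
          exact Finset.sum_congr rfl fun z _ => Finset.sum_filter _ _
      _ ≤ _ := by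
          refine Finset.sum_le_sum fun q _ => ?_
          obtain ⟨x, hx⟩ : ∃ x, q.verts.head? = some x := by
            cases hv : q.verts with
            | nil => have := q.two_le; rw [hv] at this; simp at this
            | cons a l => exact ⟨a, rfl⟩
          obtain ⟨y, hy⟩ : ∃ y, q.verts.getLast? = some y := by
            rw [← Option.isSome_iff_exists, List.getLast?_isSome]
            intro h0; rw [h0] at hx; simp at hx
          -- A path joins only the pair formed by its first and last vertex.
          rw [Finset.sum_eq_single (x, y)]
          · split_ifs
            · exact le_rfl
            · exact hnn q
          · rintro ⟨x', y'⟩ _ hne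
            rw [if_neg]
            rintro ⟨h1, h2⟩
            simp only at h1 h2
            rw [hx] at h1; rw [hy] at h2
            exact hne (by simp_all)
          · simp
  have e3 : ∑ q : SimplePath P, F.amount q * (r *
        ∑ e : Ω × Ω with q.Uses e.1 e.2, (g e.1 - g e.2) ^ 2) =
      r * ∑ e : Ω × Ω, F.onArc e.1 e.2 * (g e.1 - g e.2) ^ 2 := by
    simp only [Flow.onArc, Finset.sum_filter, Finset.mul_sum, Finset.sum_mul]
    rw [Finset.sum_comm]
    refine Finset.sum_congr rfl fun e _ => Finset.sum_congr rfl fun q _ => ?_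
    split_ifs <;> ring
  -- On an arc, 1 ≤ s · P(e) inserts the transition probability; off the arcs the flow vanishes.
  have e4 : ∀ e : Ω × Ω, F.onArc e.1 e.2 * (g e.1 - g e.2) ^ 2 ≤
      p / N * (s * (P e.1 e.2 * (g e.1 - g e.2) ^ 2)) := by
    intro e
    by_cases h : Arc P e.1 e.2
    · have h1 := hF _ _ h
      have h2 := hs _ _ h
      have h3 := h.2
      have h4 : 1 ≤ s * P e.1 e.2 := by rwa [div_le_iff₀ h3] at h2
      have h5 := sq_nonneg (g e.1 - g e.2)
      calc _ ≤ p / N * (g e.1 - g e.2) ^ 2 := mul_le_mul_of_nonneg_right h1 h5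
        _ ≤ p / N * (s * (P e.1 e.2 * (g e.1 - g e.2) ^ 2)) := by
          refine mul_le_mul_of_nonneg_left ?_ (by positivity)
          rw [← mul_assoc]
          exact le_mul_of_one_le_left h5 h4
    · have h0 : F.onArc e.1 e.2 * (g e.1 - g e.2) ^ 2 = 0 := by
        have : F.onArc e.1 e.2 = 0 := by
          refine Finset.sum_eq_zero fun q hq => ?_
          have hu := (Finset.mem_filter.1 hq).2
          exact absurd (by simpa using q.isChain.infix hu) h
        rw [this, zero_mul]
      rw [h0]
      by_cases he : e.1 = e.2
      · rw [he, sub_self]; simp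
      · have : P e.1 e.2 = 0 := le_antisymm (not_lt.1 fun h' => h ⟨he, h'⟩) (hP _ _)
        rw [this]; simp
  have e5 : ∑ z : Ω × Ω, π z.1 * π z.2 * (g z.1 - g z.2) ^ 2 =
      (1 / N ^ 2) * (2 * N * ∑ x, g x ^ 2) := by
    rw [← e1, Fintype.sum_prod_type, Finset.mul_sum]
    refine Finset.sum_congr rfl fun x _ => ?_
    rw [Finset.mul_sum]
    refine Finset.sum_congr rfl fun y _ => ?_
    rw [hπ, hπ]; field_simp
  have e6 : (1 / N ^ 2) * (2 * N * ∑ x, g x ^ 2) ≤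
      r * (p / N * (s * ∑ x, ∑ y, P x y * (g x - g y) ^ 2)) := by
    rw [← e5]
    refine (e2.trans_eq e3).trans (mul_le_mul_of_nonneg_left ?_ hr0)
    rw [← Fintype.sum_prod_type' (f := fun x y => P x y * (g x - g y) ^ 2), Finset.mul_sum,
      Finset.mul_sum]
    exact Finset.sum_le_sum fun e _ => e4 e
  have e7 := mul_le_mul_of_nonneg_left e6 hN.le
  calc 2 * ∑ x, g x ^ 2 = N * ((1 / N ^ 2) * (2 * N * ∑ x, g x ^ 2)) := by field_simp
    _ ≤ _ := e7
    _ = _ := by field_simp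

/-- A spectral gap of 1/C without eigenvalues: ‖Pg‖² ≤ ⟨g, Pg⟩, and ⟨g, Pg⟩ is ‖g‖² minus half the
Dirichlet sum. -/
lemma LazySymm.contraction (hP : LazySymm P) {C : ℝ} (hC : 0 < C) (g : Ω → ℝ)
    (h : 2 * ∑ x, g x ^ 2 ≤ C * ∑ x, ∑ y, P x y * (g x - g y) ^ 2) :
    ∑ x, (P.mulVec g x) ^ 2 ≤ (1 - 1 / C) * ∑ x, g x ^ 2 := by
  rw [hP.dirichlet_eq] at h
  have h1 := hP.sum_sq_le g
  have h2 : (1 / C) * ∑ x, g x ^ 2 ≤ ∑ x, g x ^ 2 - ∑ x, g x * P.mulVec g x := by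
    rw [div_mul_eq_mul_div, div_le_iff₀ hC]; linarith
  linarith

/-- Total variation distance to uniform decays geometrically. -/
lemma LazySymm.tvDist_le (hP : LazySymm P) {π : Ω → ℝ}
    (hπ : ∀ x, π x = 1 / (Fintype.card Ω : ℝ)) {C : ℝ} (hC : 1 ≤ C)
    (h : ∀ g : Ω → ℝ, ∑ x, g x = 0 →
      2 * ∑ x, g x ^ 2 ≤ C * ∑ x, ∑ y, P x y * (g x - g y) ^ 2) (x : Ω) (t : ℕ) :
    (2 * tvDist P π x t) ^ 2 ≤ Fintype.card Ω * (1 - 1 / C) ^ t := by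
  classical
  have hNn : 0 < Fintype.card Ω := Fintype.card_pos_iff.2 ⟨x⟩
  have hN : (0 : ℝ) < Fintype.card Ω := by exact_mod_cast hNn
  set N : ℝ := ((Fintype.card Ω : ℕ) : ℝ) with hNdef
  have hC0 : 0 < C := by linarith
  have hC1 : 0 ≤ 1 - 1 / C := by rw [sub_nonneg, div_le_one hC0]; exact hC
  -- The error vector keeps total mass zero, so the contraction applies at every step; initially its
  -- squared norm is 1 - 1/N ≤ 1.
  have main : ∀ t : ℕ, ∑ y, ((P ^ t) x y - π y) = 0 ∧
      ∑ y, ((P ^ t) x y - π y) ^ 2 ≤ (1 - 1 / C) ^ t := by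
    intro t
    induction t with
    | zero =>
      simp only [pow_zero, Matrix.one_apply, hπ]
      constructor
      · rw [Finset.sum_sub_distrib]
        simp [← hNdef, hN.ne']
      · have : ∀ y, ((if x = y then (1 : ℝ) else 0) - 1 / N) ^ 2 =
            (if x = y then (1 - 2 / N) else 0) + 1 / N ^ 2 := by
          intro y; split_ifs <;> ring
        simp only [this, Finset.sum_add_distrib]
        simp only [Finset.sum_ite_eq, Finset.mem_univ, if_true, Finset.sum_const,
          Finset.card_univ, nsmul_eq_mul, ← hNdef]
        have : N * (1 / N ^ 2) = 1 / N := by field_simp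
        rw [this]
        have h0 : 0 ≤ 1 / N := by positivity
        have : 2 / N = 2 * (1 / N) := by ring
        linarith
    | succ t ih =>
      have e : ∀ y, (P ^ (t + 1)) x y - π y = P.mulVec (fun z => (P ^ t) x z - π z) y := by
        intro y
        simp only [pow_succ, Matrix.mul_apply, Matrix.mulVec, dotProduct, mul_sub,
          Finset.sum_sub_distrib]
        congr 1
        · exact Finset.sum_congr rfl fun z _ => by rw [hP.symm z y, mul_comm]
        · simp only [hπ]; rw [← Finset.sum_mul, hP.row_sum, one_mul]
      constructor
      · simp only [e, Matrix.mulVec, dotProduct]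
        rw [Finset.sum_comm, ← ih.1]
        refine Finset.sum_congr rfl fun z _ => ?_
        rw [← Finset.sum_mul, Finset.sum_congr rfl fun y _ => hP.symm y z, hP.row_sum, one_mul]
      · simp only [e]
        refine (hP.contraction hC0 _ (h _ ih.1)).trans ?_
        rw [pow_succ, mul_comm]
        exact mul_le_mul_of_nonneg_right ih.2 hC1
  -- Passing from ℓ² back to ℓ¹ costs the factor N.
  have hcs := sq_sum_le_card_mul_sum_sq (s := (Finset.univ : Finset Ω))
    (f := fun y => |(P ^ t) x y - π y|)
  have : 2 * tvDist P π x t = ∑ y, |(P ^ t) x y - π y| := by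
    simp only [tvDist]; ring
  rw [this]
  refine hcs.trans ?_
  simp only [sq_abs, Finset.card_univ]
  exact mul_le_mul_of_nonneg_left (main t).2 hN.le

lemma LazySymm.pow_apply_self (i : DecidableEq Ω) [Subsingleton Ω] (hP : LazySymm P) (x : Ω) (t : ℕ) :
    (P ^ t) x x = 1 := by
  have hPone : P = 1 := by
    ext a b
    obtain rfl : a = b := Subsingleton.elim _ _
    have := hP.row_sum a
    rw [Fintype.sum_eq_single a fun b hb => absurd (Subsingleton.elim _ _) hb] at this
    simp [this]
  rw [hPone, one_pow, Matrix.one_apply_eq]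

/-- A flow bounds the mixing time of a lazy symmetric chain. -/
theorem LazySymm.mixingTime_le (hP : LazySymm P) {π : Ω → ℝ}
    (hπ : ∀ x, π x = 1 / (Fintype.card Ω : ℝ)) (F : Flow P π) {p r s : ℝ} (hp : 1 ≤ p)
    (hr1 : 1 ≤ r) (hs1 : 1 ≤ s)
    (hF : ∀ x y, Arc P x y → F.onArc x y ≤ p / (Fintype.card Ω : ℝ))
    (hr : (F.maxLength : ℝ) ≤ r) (hs : ∀ x y, Arc P x y → 1 / P x y ≤ s)
    {ε : ℝ} (hε : 0 < ε) (hε1 : ε < 1) :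
    (mixingTime P π ε : ENNReal) ≤
      ENNReal.ofReal ((2 * (p * r * s) + 2) * Real.log ((Fintype.card Ω : ℝ) / ε)) := by
  classical
  set C := p * r * s with hCdef
  have hC : 1 ≤ C := one_le_mul_of_one_le_of_one_le (one_le_mul_of_one_le_of_one_le hp hr1) hs1
  have hC0 : 0 < C := by linarith
  have htv := hP.tvDist_le hπ hC (F.poincare hπ hP.nonneg (by linarith) hF hr hs)
  set N : ℝ := ((Fintype.card Ω : ℕ) : ℝ) with hNdef
  set T : ℕ := ⌊(2 * C + 2) * Real.log (N / ε)⌋₊ with hT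
  have hle : mixingTime P π ε ≤ (T : ℕ∞) := by
    refine iSup_le fun x => iInf₂_le T fun t ht => ?_
    have hNn : 1 ≤ Fintype.card Ω := Fintype.card_pos_iff.2 ⟨x⟩
    have hN1 : (1 : ℝ) ≤ N := by rw [hNdef]; exact_mod_cast hNn
    have hN0 : 0 < N := by linarith
    rcases hNn.eq_or_lt with h1 | h2
    · -- a single state
      have hsub : Subsingleton Ω := Fintype.card_le_one_iff_subsingleton.1 h1.symm.le
      have : tvDist P π x t = 0 := by
        have hN' : N = 1 := by rw [hNdef, ← h1]; simp
        refine mul_eq_zero_of_right _ (Finset.sum_eq_zero fun y _ => ?_)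
        obtain rfl : x = y := Subsingleton.elim _ _
        refine abs_eq_zero.2 (sub_eq_zero.2 ((LazySymm.pow_apply_self (_) hP x t).trans ?_))
        rw [hπ, hN', div_one]
      rw [this]; exact hε.le
    · have hN2 : (2 : ℝ) ≤ N := by rw [hNdef]; exact_mod_cast h2
      -- With two states or more the logarithm is at least 1/2, so the summand 2 in the coefficient
      -- 2C + 2 pays for rounding down in `T`.
      have hLg : 1 / 2 ≤ Real.log (N / ε) := by
        have h3 : 2 ≤ N / ε := by
          rw [le_div_iff₀ hε]; nlinarith
        have h4 := Real.log_le_log (by norm_num) h3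
        linarith [Real.log_two_gt_d9]
      have ht' : 2 * C * Real.log (N / ε) ≤ t := by
        have h5 : (2 * C + 2) * Real.log (N / ε) < T + 1 := Nat.lt_floor_add_one _
        have h6 : (T : ℝ) ≤ t := by exact_mod_cast ht
        linarith
      have h7 := htv x t
      have h8 : (1 - 1 / C) ^ t ≤ Real.exp (-(2 * Real.log (N / ε))) := by
        have h9 : 1 - 1 / C ≤ Real.exp (-(1 / C)) := by
          have := Real.add_one_le_exp (-(1 / C)); linarith
        have h10 : 0 ≤ 1 - 1 / C := by rw [sub_nonneg, div_le_one hC0]; exact hC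
        refine (pow_le_pow_left₀ h10 h9 t).trans ?_
        rw [← Real.exp_nat_mul]
        refine Real.exp_le_exp.2 ?_
        have : 2 * Real.log (N / ε) ≤ t * (1 / C) := by
          rw [mul_one_div, le_div_iff₀ hC0]; linarith
        linarith
      have h11 : Real.exp (-(2 * Real.log (N / ε))) = (ε / N) ^ 2 := by
        rw [Real.exp_neg, mul_comm, Real.exp_mul, Real.exp_log (by positivity)]
        have : (N / ε) ^ (2 : ℝ) = (N / ε) ^ 2 := by norm_cast
        rw [this, ← inv_pow, inv_div]
      rw [h11] at h8
      have h12 : (2 * tvDist P π x t) ^ 2 ≤ ε ^ 2 := by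
        refine h7.trans ((mul_le_mul_of_nonneg_left h8 hN0.le).trans ?_)
        have : N * (ε / N) ^ 2 = ε ^ 2 / N := by field_simp
        rw [this]
        exact div_le_self (sq_nonneg _) hN1
      have h13 := le_of_abs_le (abs_le_of_sq_le_sq h12 hε.le)
      linarith
  calc (mixingTime P π ε : ENNReal) ≤ ((T : ℕ∞) : ENNReal) := by exact_mod_cast hle
    _ = (T : ENNReal) := by simp
    _ ≤ _ := by
      rw [← ENNReal.ofReal_natCast]
      refine ENNReal.ofReal_le_ofReal ?_
      by_cases h0 : 0 ≤ (2 * C + 2) * Real.log (N / ε)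
      · exact Nat.floor_le h0
      · have hz : T = 0 := Nat.floor_of_nonpos (not_le.1 h0).le
        exfalso
        apply h0
        refine mul_nonneg (by linarith) ?_
        by_cases hΩ : Nonempty Ω
        · refine Real.log_nonneg ?_
          have hNn : 1 ≤ Fintype.card Ω := Fintype.card_pos_iff.2 hΩ
          have hN1 : (1 : ℝ) ≤ N := by rw [hNdef]; exact_mod_cast hNn
          rw [le_div_iff₀ hε]; linarith
        -- Without states the argument of the logarithm is 0, where `Real.log` takes the value 0.
        · rw [not_nonempty_iff] at hΩ
          simp [hNdef]

end Mixing

end MarkovChain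

/-! ## Flows from families of paths -/

namespace MarkovChain

section Paths

variable {Ω : Type*} {P : Matrix Ω Ω ℝ}

/-- Loop erasure: when a vertex prepended to the list already occurs on it, the list is cut back to
that occurrence. -/
lemma exists_nodup_chain {r : Ω → Ω → Prop} {s : Set Ω} {x y : Ω}
    (h : Relation.ReflTransGen (fun u v => r u v ∧ u ∈ s) x y) (hy : y ∈ s) :
    ∃ l : List Ω, l.head? = some x ∧ l.getLast? = some y ∧ l.Nodup ∧ l.IsChain r ∧
      ∀ z ∈ l, z ∈ s := by
  induction h using Relation.ReflTransGen.head_induction_on with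
  | refl => exact ⟨[y], rfl, rfl, List.nodup_singleton _, List.isChain_singleton _, by simpa using hy⟩
  | @head a b h _ ih =>
    obtain ⟨l, h1, h2, h3, h4, h5⟩ := ih
    by_cases ha : a ∈ l
    · obtain ⟨l₁, l₂, rfl⟩ := List.append_of_mem ha
      refine ⟨a :: l₂, rfl, ?_, (List.nodup_append.1 h3).2.1, (List.isChain_append.1 h4).2.1, ?_⟩
      · rw [← h2, List.getLast?_append_of_ne_nil _ (by simp)]
      · intro z hz
        exact h5 z (List.mem_append_right _ hz)
    · cases l with
      | nil => simp at h1
      | cons c l =>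
        simp only [List.head?_cons, Option.some.injEq] at h1
        subst h1
        refine ⟨a :: c :: l, rfl, by rwa [List.getLast?_cons_cons], List.nodup_cons.2 ⟨ha, h3⟩,
          List.isChain_cons_cons.2 ⟨h.1, h4⟩, ?_⟩
        intro z hz
        rcases List.mem_cons.1 hz with rfl | hz
        · exact h.2
        · exact h5 z hz

lemma exists_simplePath {s : Finset Ω} {x y : Ω} (hxy : x ≠ y)
    (h : Relation.ReflTransGen (fun u v => Arc P u v ∧ u ∈ s) x y) (hy : y ∈ s) :
    ∃ p : SimplePath P, p.Joins x y ∧ (∀ z ∈ p.verts, z ∈ s) ∧ p.length ≤ s.card := by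
  classical
  obtain ⟨l, h1, h2, h3, h4, h5⟩ := exists_nodup_chain (s := (s : Set Ω)) h hy
  have hl : 2 ≤ l.length := by
    match l, h1, h2 with
    | [], h1, _ => simp at h1
    | [a], h1, h2 =>
      simp only [List.head?_cons, Option.some.injEq, List.getLast?_singleton] at h1 h2
      exact absurd (h1.symm.trans h2) hxy
    | _ :: _ :: _, _, _ => simp
  refine ⟨⟨l, hl, h3, h4⟩, ⟨h1, h2⟩, h5, ?_⟩
  refine (Nat.sub_le _ _).trans ?_
  change l.length ≤ _
  rw [← List.toFinset_card_of_nodup h3]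
  exact Finset.card_le_card fun z hz => h5 z (List.mem_toFinset.1 hz)

lemma SimplePath.Joins.unique {p : SimplePath P} {x y x' y' : Ω} (h : p.Joins x y)
    (h' : p.Joins x' y') : x = x' ∧ y = y' :=
  ⟨Option.some.inj (h.1.symm.trans h'.1), Option.some.inj (h.2.symm.trans h'.2)⟩

/-- Routing the demand of every pair `x ≠ y` evenly along paths indexed by `A x y`, the path with
index `τ` staying inside `R x y τ`, gives a flow. -/
theorem exists_flow_of_paths [Fintype Ω] {T : Type*} {π : Ω → ℝ} {w : ℝ} (hw : 0 ≤ w)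
    (hπ : ∀ x y, π x * π y = w) (A : Ω → Ω → Finset T) (hA : ∀ x y, (A x y).Nonempty)
    (R : Ω → Ω → T → Finset Ω) (hmem : ∀ x y, ∀ τ ∈ A x y, y ∈ R x y τ)
    (hR : ∀ x y, ∀ τ ∈ A x y, Relation.ReflTransGen (fun u v => Arc P u v ∧ u ∈ R x y τ) x y)
    {M : ℕ} (hM : ∀ x y, ∀ τ ∈ A x y, (R x y τ).card ≤ M) :
    ∃ F : Flow P π, F.maxLength ≤ M ∧ ∀ u v, F.onArc u v ≤ w * (open Classical in
      ∑ x, ∑ y, ∑ τ ∈ A x y, if u ∈ R x y τ then (1 : ℝ) / (A x y).card else 0) := by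
  classical
  have hp : ∀ x y τ, x ≠ y → τ ∈ A x y → ∃ p : SimplePath P, p.Joins x y ∧
      (∀ z ∈ p.verts, z ∈ R x y τ) ∧ p.length ≤ (R x y τ).card := fun x y τ hxy hτ =>
    exists_simplePath hxy (hR x y τ hτ) (hmem x y τ hτ)
  -- Without simple paths there is at most one state and nothing to route; otherwise `choose!` has a
  -- default path available.
  rcases isEmpty_or_nonempty (SimplePath P) with hE | hE
  · have hsub : ∀ x y : Ω, x = y := by
      intro x y
      by_contra hxy
      obtain ⟨τ, hτ⟩ := hA x y
      obtain ⟨p, -⟩ := hp x y τ hxy hτ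
      exact hE.false p
    refine ⟨⟨fun _ => 0, fun _ => le_rfl, fun x y hxy => absurd (hsub x y) hxy⟩, ?_, ?_⟩
    · simp [Flow.maxLength]
    · intro u v
      refine le_trans (le_of_eq (by simp [Flow.onArc])) (mul_nonneg hw (Finset.sum_nonneg fun x _ =>
        Finset.sum_nonneg fun y _ => Finset.sum_nonneg fun τ _ => ?_))
      split_ifs <;> positivity
  choose! path hj hin hlen using hp
  let f : SimplePath P → ℝ := fun p => ∑ x, ∑ y, ∑ τ ∈ A x y,
    if x ≠ y ∧ path x y τ = p then w / (A x y).card else 0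
  have hterm : ∀ x y τ p, 0 ≤ if x ≠ y ∧ path x y τ = p then w / ((A x y).card : ℝ) else 0 := by
    intro x y τ p; split_ifs <;> positivity
  have hf0 : ∀ p, 0 ≤ f p := fun p =>
    Finset.sum_nonneg fun x _ => Finset.sum_nonneg fun y _ => Finset.sum_nonneg fun τ _ =>
      hterm x y τ p
  -- Sums over paths become sums over index triples, so paths that coincide for different indices
  -- need no separate treatment.
  have hswap : ∀ Q : SimplePath P → Prop, ∑ p with Q p, f p = ∑ x, ∑ y, ∑ τ ∈ A x y,
      if x ≠ y ∧ Q (path x y τ) then w / ((A x y).card : ℝ) else 0 := by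
    intro Q
    simp only [f]
    rw [Finset.sum_comm]
    refine Finset.sum_congr rfl fun x _ => ?_
    rw [Finset.sum_comm]
    refine Finset.sum_congr rfl fun y _ => ?_
    rw [Finset.sum_comm]
    refine Finset.sum_congr rfl fun τ _ => ?_
    by_cases hxy : x = y
    · simp [hxy]
    · by_cases hQ : Q (path x y τ)
      · rw [if_pos ⟨hxy, hQ⟩, Finset.sum_eq_single (path x y τ)]
        · rw [if_pos ⟨hxy, rfl⟩]
        · intro p _ hne
          rw [if_neg fun h => hne h.2.symm]
        · intro h
          exact absurd (Finset.mem_filter.2 ⟨Finset.mem_univ _, hQ⟩) h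
      · rw [if_neg fun h => hQ h.2]
        refine Finset.sum_eq_zero fun p hp => if_neg ?_
        rintro ⟨_, rfl⟩
        exact hQ (Finset.mem_filter.1 hp).2
  refine ⟨⟨f, hf0, ?_⟩, ?_, ?_⟩
  · intro x y hxy
    rw [hswap, hπ, Finset.sum_eq_single x, Finset.sum_eq_single y]
    · rw [Finset.sum_congr rfl fun τ hτ => if_pos ⟨hxy, hj x y τ hxy hτ⟩, Finset.sum_const,
        nsmul_eq_mul]
      have : ((A x y).card : ℝ) ≠ 0 := by
        exact_mod_cast (Finset.card_pos.2 (hA x y)).ne'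
      field_simp
    · intro y' _ hy
      refine Finset.sum_eq_zero fun τ hτ => if_neg ?_
      rintro ⟨h1, h2⟩
      exact hy ((hj x y' τ h1 hτ).unique h2).2
    · simp
    · intro x' _ hx
      refine Finset.sum_eq_zero fun y' _ => Finset.sum_eq_zero fun τ hτ => if_neg ?_
      rintro ⟨h1, h2⟩
      exact hx ((hj x' y' τ h1 hτ).unique h2).1
    · simp
  · refine Finset.sup_le fun p hp => ?_
    have h0 : 0 < f p := (Finset.mem_filter.1 hp).2
    obtain ⟨x, _, hx⟩ := Finset.exists_ne_zero_of_sum_ne_zero h0.ne'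
    obtain ⟨y, _, hy⟩ := Finset.exists_ne_zero_of_sum_ne_zero hx
    obtain ⟨τ, hτ, h⟩ := Finset.exists_ne_zero_of_sum_ne_zero hy
    obtain ⟨hxy, rfl⟩ : x ≠ y ∧ path x y τ = p := by
      by_contra hc
      exact h (if_neg hc)
    exact (hlen x y τ hxy hτ).trans (hM x y τ hτ)
  · intro u v
    refine (hswap fun p => p.Uses u v).le.trans ?_
    simp only [Finset.mul_sum]
    refine Finset.sum_le_sum fun x _ => Finset.sum_le_sum fun y _ => Finset.sum_le_sum
      fun τ hτ => ?_
    split_ifs with h1 h2 h2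
    · rw [mul_one_div]
    -- A path using the arc visits its tail `u`, so `u` lies in the region of that path.
    · exact absurd (hin x y τ h1.1 hτ u (h1.2.subset (by simp))) h2
    · positivity
    · simp

end Paths

end MarkovChain

/-! ## Climbing a cyclic mountain range in two directions -/

namespace Mountain

/-- Pairs of positions on the two sides of the summit `M` at the same height. -/
def Level (f : ℤ → ℤ) (M N : ℤ) (p : ℤ × ℤ) : Prop :=
  (0 ≤ p.1 ∧ p.1 ≤ M) ∧ (M ≤ p.2 ∧ p.2 ≤ N) ∧ f p.1 = f p.2

/-- Both climbers take a step and arrive at the same height. -/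
def Climb (f : ℤ → ℤ) (M N : ℤ) (p q : ℤ × ℤ) : Prop :=
  Level f M N q ∧ (q.1 = p.1 + 1 ∨ q.1 = p.1 - 1) ∧ (q.2 = p.2 + 1 ∨ q.2 = p.2 - 1)

/-- The number of ways in which the climbers can go on. -/
noncomputable def degree (f : ℤ → ℤ) (M N : ℤ) (p : ℤ × ℤ) : ℕ :=
  open Classical in
  (if Level f M N (p + (1, 1)) then 1 else 0) + (if Level f M N (p + (-1, -1)) then 1 else 0) +
  ((if Level f M N (p + (1, -1)) then 1 else 0) + (if Level f M N (p + (-1, 1)) then 1 else 0))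

/-- In the interior, two slopes allow 2 continuations, an extremum and a slope 2, two peaks or two
valleys 4, a peak and a valley 0. At 0, `M` or `N` one climber loses a direction, but both are then
at an extreme height and 2 continuations remain, except at the two excluded pairs. -/
lemma even_degree {f : ℤ → ℤ} {M N : ℤ} (hM : 0 < M) (hMN : M < N)
    (hf : ∀ i, f (i + 1) = f i + 1 ∨ f (i + 1) = f i - 1)
    (h0 : ∀ i, f 0 ≤ f i) (hN : f N = f 0) (hmax : ∀ i, f i ≤ f M)
    {p : ℤ × ℤ} (hp : Level f M N p) (h1 : p ≠ (M, M)) (h2 : p ≠ (0, N)) :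
    Even (degree f M N p) := by
  obtain ⟨s, t⟩ := p
  obtain ⟨⟨hs0, hsM⟩, ⟨htM, htN⟩, hst⟩ := hp
  simp only at hs0 hsM htM htN hst
  have a1 := hf s
  have a2 := hf (s - 1)
  have a3 := hf t
  have a4 := hf (t - 1)
  rw [sub_add_cancel] at a2 a4
  have b1 := h0 (s + 1)
  have b2 := h0 (s - 1)
  have b3 := h0 (t + 1)
  have b4 := h0 (t - 1)
  have c1 := hmax (s + 1)
  have c2 := hmax (s - 1)
  have c3 := hmax (t + 1)
  have c4 := hmax (t - 1)
  have d0 := hmax 0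
  have dd : f 0 ≠ f M := by
    intro h
    have := hf 0
    have e1 := h0 (0 + 1)
    have e2 := hmax (0 + 1)
    omega
  simp only [ne_eq, Prod.mk.injEq, not_and] at h1 h2
  have k1 : s = 0 → f (s + 1) = f s + 1 ∧ f (t + 1) = f t + 1 ∧ f (t - 1) = f t + 1 ∧ t ≠ M := by
    rintro rfl; grind
  have k2 : s = M → f (s - 1) = f s - 1 ∧ f (t + 1) = f t - 1 ∧ f (t - 1) = f t - 1 ∧ t ≠ N := by
    rintro rfl; grind
  have k3 : t = M → f (t + 1) = f t - 1 ∧ f (s + 1) = f s - 1 ∧ f (s - 1) = f s - 1 ∧ s ≠ 0 := by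
    rintro rfl; grind
  have k4 : t = N → f (t - 1) = f t + 1 ∧ f (s + 1) = f s + 1 ∧ f (s - 1) = f s + 1 ∧ s ≠ M := by
    rintro rfl; grind
  clear b1 b2 b3 b4 c1 c2 c3 c4 d0 dd hf h0 hmax hN
  by_cases e1 : Level f M N ((s, t) + (1, 1)) <;> by_cases e2 : Level f M N ((s, t) + (-1, -1)) <;>
    by_cases e3 : Level f M N ((s, t) + (1, -1)) <;> by_cases e4 : Level f M N ((s, t) + (-1, 1)) <;>
    simp only [degree, e1, e2, e3, e4, if_true, if_false] <;> first
      | decide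
      | (exfalso; simp only [Level, Prod.mk_add_mk, ← sub_eq_add_neg] at e1 e2 e3 e4; omega)

/-- Both climbers are on the summit and must walk apart. -/
lemma degree_start {f : ℤ → ℤ} {M N : ℤ} (hM : 0 < M) (hMN : M < N)
    (hf : ∀ i, f (i + 1) = f i + 1 ∨ f (i + 1) = f i - 1) (hmax : ∀ i, f i ≤ f M) :
    degree f M N (M, M) = 1 := by
  have a1 := hf M
  have a2 := hf (M - 1)
  rw [sub_add_cancel] at a2
  have b1 := hmax (M + 1)
  have b2 := hmax (M - 1)
  by_cases e1 : Level f M N ((M, M) + (1, 1)) <;> by_cases e2 : Level f M N ((M, M) + (-1, -1)) <;>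
    by_cases e3 : Level f M N ((M, M) + (1, -1)) <;> by_cases e4 : Level f M N ((M, M) + (-1, 1)) <;>
    simp only [degree, e1, e2, e3, e4, if_true, if_false] <;>
    (exfalso; simp only [Level, Prod.mk_add_mk, ← sub_eq_add_neg] at e1 e2 e3 e4; omega)

/-- Handshake lemma: in the component of the start the degree sum is even, while the start has
degree 1, so the component must contain the only other pair that can have odd degree, the goal. -/
theorem climb {f : ℤ → ℤ} {M N : ℤ} (hM : 0 < M) (hMN : M < N)
    (hf : ∀ i, f (i + 1) = f i + 1 ∨ f (i + 1) = f i - 1)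
    (h0 : ∀ i, f 0 ≤ f i) (hN : f N = f 0) (hmax : ∀ i, f i ≤ f M) :
    Relation.ReflTransGen (Climb f M N) (M, M) (0, N) := by
  classical
  by_contra hcon
  let C : Finset (ℤ × ℤ) := (Finset.Icc 0 N ×ˢ Finset.Icc 0 N).filter fun p =>
    Relation.ReflTransGen (Climb f M N) (M, M) p
  have hCL : ∀ p ∈ C, Level f M N p := by
    intro p hp
    rcases Relation.ReflTransGen.cases_tail (Finset.mem_filter.1 hp).2 with h | ⟨q, _, h⟩
    · subst h
      exact ⟨⟨hM.le, le_rfl⟩, ⟨le_rfl, hMN.le⟩, rfl⟩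
    · exact h.1
  have hstart : (M, M) ∈ C := by
    refine Finset.mem_filter.2 ⟨?_, Relation.ReflTransGen.refl⟩
    simp only [Finset.mem_product, Finset.mem_Icc]
    omega
  have hstep : ∀ p ∈ C, ∀ e : ℤ × ℤ, (e.1 = 1 ∨ e.1 = -1) → (e.2 = 1 ∨ e.2 = -1) →
      (Level f M N (p + e) ↔ p + e ∈ C) := by
    intro p hp e h1 h2
    refine ⟨fun h => ?_, hCL _⟩
    refine Finset.mem_filter.2 ⟨?_, (Finset.mem_filter.1 hp).2.tail ⟨h, ?_, ?_⟩⟩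
    · obtain ⟨h3, h4, _⟩ := h
      simp only [Finset.mem_product, Finset.mem_Icc]
      omega
    · simp only [Prod.fst_add]; omega
    · simp only [Prod.snd_add]; omega
  -- Translation by `e` matches the moves in direction `e` with those in direction `-e`, so each
  -- edge is counted twice.
  have hcount : ∀ e : ℤ × ℤ, (∑ p ∈ C, if p + e ∈ C then 1 else 0) =
      ∑ p ∈ C, if p + -e ∈ C then 1 else 0 := by
    intro e
    rw [← Finset.sum_filter, ← Finset.sum_filter]
    refine Finset.sum_nbij' (fun p => p + e) (fun p => p + -e) ?_ ?_ ?_ ?_ ?_ <;>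
      simp +contextual
  have hsum : ∑ p ∈ C, degree f M N p = 2 * ((∑ p ∈ C, if p + (1, 1) ∈ C then 1 else 0) +
      ∑ p ∈ C, if p + (1, -1) ∈ C then 1 else 0) := by
    have h1 := hcount (1, 1)
    have h2 := hcount (1, -1)
    simp only [Prod.neg_mk, neg_neg] at h1 h2
    have : ∀ p ∈ C, degree f M N p =
        ((if p + (1, 1) ∈ C then 1 else 0) + (if p + (-1, -1) ∈ C then 1 else 0)) +
        ((if p + (1, -1) ∈ C then 1 else 0) + (if p + (-1, 1) ∈ C then 1 else 0)) := by
      intro p hp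
      exact congrArg₂ (· + ·)
        (congrArg₂ (· + ·) (if_congr (hstep p hp (1, 1) (by simp) (by simp)) rfl rfl)
          (if_congr (hstep p hp (-1, -1) (by simp) (by simp)) rfl rfl))
        (congrArg₂ (· + ·) (if_congr (hstep p hp (1, -1) (by simp) (by simp)) rfl rfl)
          (if_congr (hstep p hp (-1, 1) (by simp) (by simp)) rfl rfl))
    rw [Finset.sum_congr rfl this]
    simp only [Finset.sum_add_distrib]
    omega
  have heven : Even (∑ p ∈ C.erase (M, M), degree f M N p) := by
    refine Finset.even_sum _ fun p hp => ?_
    have hpC := Finset.mem_of_mem_erase hp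
    refine even_degree hM hMN hf h0 hN hmax (hCL p hpC) (Finset.ne_of_mem_erase hp) ?_
    rintro rfl
    exact hcon (Finset.mem_filter.1 hpC).2
  rw [← Finset.add_sum_erase _ _ hstart, degree_start hM hMN hf hmax] at hsum
  obtain ⟨m, hm⟩ := heven
  omega

/-- One climber takes a step, after which their heights differ by at most one. -/
def Rook (h : ℤ → ℤ) (p q : ℤ × ℤ) : Prop :=
  |h q.1 - h q.2| ≤ 1 ∧
    ((q.2 = p.2 ∧ (q.1 = p.1 + 1 ∨ q.1 = p.1 - 1)) ∨
      (q.1 = p.1 ∧ (q.2 = p.2 + 1 ∨ q.2 = p.2 - 1)))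

lemma rook_fst {h : ℤ → ℤ} {a a' b : ℤ} (hab : |h a' - h b| ≤ 1) (h1 : |a' - a| ≤ 1) :
    Relation.ReflTransGen (Rook h) (a, b) (a', b) := by
  rw [abs_le] at h1
  by_cases haa : a' = a
  · rw [haa]
  · exact Relation.ReflTransGen.single ⟨hab, Or.inl ⟨rfl, by dsimp only; omega⟩⟩

lemma rook_snd {h : ℤ → ℤ} {a b b' : ℤ} (hab : |h a - h b'| ≤ 1) (h1 : |b' - b| ≤ 1) :
    Relation.ReflTransGen (Rook h) (a, b) (a, b') := by
  rw [abs_le] at h1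
  by_cases haa : b' = b
  · rw [haa]
  · exact Relation.ReflTransGen.single ⟨hab, Or.inr ⟨rfl, by dsimp only; omega⟩⟩

lemma exists_min_of_periodic {g : ℤ → ℤ} {K : ℤ} (hK : 0 < K) (hg : ∀ i, g (i + K) = g i) :
    ∃ r, ∀ i, g r ≤ g i := by
  obtain ⟨r, -, hr⟩ := Finset.exists_min_image (Finset.Ico 0 K) g ⟨0, by simpa using hK⟩
  refine ⟨r, fun i => ?_⟩
  have hper : Function.Periodic g K := hg
  have : g (i % K) = g i := by
    rw [Int.emod_def, mul_comm, ← smul_eq_mul, hper.sub_zsmul_eq]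
  rw [← this]
  exact hr _ (Finset.mem_Ico.2 ⟨Int.emod_nonneg _ hK.ne', Int.emod_lt_of_pos _ hK⟩)

/-- Two climbers who start together on a summit of a cyclic mountain range and go in opposite
directions can reach a common lowest point, staying at almost the same height all the time. -/
theorem exists_rook_path {h : ℤ → ℤ} {N : ℤ} (hN : 0 < N) (hper : ∀ i, h (i + N) = h i)
    (hstep : ∀ i, |h (i + 1) - h i| ≤ 1) :
    ∃ M r : ℤ, Relation.ReflTransGen (Rook h) (M, M) (r, r + N) := by
  -- The range at double resolution: `g j` is h(j/2) or h(j/2) + 1, whichever has the parity of `j`.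
  -- Parity turns the steps of `h`, which may be 0, into steps of exactly ±1.
  let g : ℤ → ℤ := fun j => h (j / 2) + (h (j / 2) + j) % 2
  have hgper : ∀ i, g (i + 2 * N) = g i := by
    intro i
    have : (i + 2 * N) / 2 = i / 2 + N := by omega
    simp only [g, this, hper]
    omega
  have hgs : ∀ i, g (i + 1) = g i + 1 ∨ g (i + 1) = g i - 1 := by
    intro i
    have h1 := hstep (i / 2)
    rw [abs_le] at h1
    simp only [g]
    rcases Int.emod_two_eq_zero_or_one i with h2 | h2
    · have : (i + 1) / 2 = i / 2 := by omega
      rw [this]; omega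
    · have : (i + 1) / 2 = i / 2 + 1 := by omega
      rw [this]; omega
  obtain ⟨r, hr⟩ := exists_min_of_periodic (by omega : 0 < 2 * N) hgper
  obtain ⟨m, hm⟩ := exists_min_of_periodic (g := fun i => - g i) (by omega : 0 < 2 * N)
    fun i => by rw [hgper]
  have hgper' : Function.Periodic g (2 * N) := hgper
  -- `M` is the offset of the summit from the lowest point `r`, reduced modulo the period.
  obtain ⟨M, hM, hgM⟩ : ∃ M, (0 ≤ M ∧ M < 2 * N) ∧ g (r + M) = g m := by
    refine ⟨(m - r) % (2 * N), ⟨Int.emod_nonneg _ (by omega), Int.emod_lt_of_pos _ (by omega)⟩, ?_⟩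
    have : r + (m - r) % (2 * N) = m - ((m - r) / (2 * N)) • (2 * N) := by
      rw [Int.emod_def, smul_eq_mul]; ring
    rw [this, hgper'.sub_zsmul_eq]
  have hne : g r ≠ g m := by
    intro he
    have h1 := hgs r
    have h2 := hr (r + 1)
    have h3 := hm (r + 1)
    omega
  have hM0 : 0 < M := by
    rcases hM.1.eq_or_lt with h | h
    · rw [← h, add_zero] at hgM; exact absurd hgM hne
    · exact h
  have key := climb (f := fun i => g (r + i)) hM0 hM.2
    (fun i => by simpa only [add_assoc] using hgs (r + i))
    (fun i => by simpa using hr (r + i)) (by simpa using hgper r)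
    (fun i => by have := hm (r + i); omega)
  refine ⟨(r + M) / 2, r / 2, ?_⟩
  have hend : r / 2 + N = (r + 2 * N) / 2 := by omega
  rw [hend]
  have hlift : ∀ q, Relation.ReflTransGen (Climb (fun i => g (r + i)) M (2 * N)) (M, M) q →
      g (r + q.1) = g (r + q.2) ∧
      Relation.ReflTransGen (Rook h) ((r + M) / 2, (r + M) / 2) ((r + q.1) / 2, (r + q.2) / 2) := by
    intro q hq
    induction hq with
    | refl => exact ⟨rfl, Relation.ReflTransGen.refl⟩
    | tail _ hc ih =>
      rename_i p q _
      obtain ⟨hp, ih⟩ := ih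
      obtain ⟨⟨_, _, hq⟩, h1, h2⟩ := hc
      obtain ⟨s, t⟩ := p
      obtain ⟨s', t'⟩ := q
      simp only at hp ih hq h1 h2 ⊢
      refine ⟨hq, ih.trans ?_⟩
      have d1 : |(r + s') / 2 - (r + s) / 2| ≤ 1 := by rw [abs_le]; omega
      have d2 : |(r + t') / 2 - (r + t) / 2| ≤ 1 := by rw [abs_le]; omega
      have e1 : |h ((r + s') / 2) - h ((r + s) / 2)| ≤ 1 := by
        rcases (by omega : (r + s') / 2 = (r + s) / 2 ∨ (r + s') / 2 = (r + s) / 2 + 1 ∨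
          (r + s) / 2 = (r + s') / 2 + 1) with e | e | e
        · rw [e]; simp
        · rw [e]; exact hstep _
        · rw [e, abs_sub_comm]; exact hstep _
      have e2 : |h ((r + t') / 2) - h ((r + t) / 2)| ≤ 1 := by
        rcases (by omega : (r + t') / 2 = (r + t) / 2 ∨ (r + t') / 2 = (r + t) / 2 + 1 ∨
          (r + t) / 2 = (r + t') / 2 + 1) with e | e | e
        · rw [e]; simp
        · rw [e]; exact hstep _
        · rw [e, abs_sub_comm]; exact hstep _
      simp only [g] at hp hq
      have f0 : |h ((r + s') / 2) - h ((r + t') / 2)| ≤ 1 := by rw [abs_le]; omega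
      -- The simultaneous step is replaced by two single ones; at least one of the two orders has an
      -- admissible intermediate pair.
      have f1 : |h ((r + s') / 2) - h ((r + t) / 2)| ≤ 1 ∨
          |h ((r + s) / 2) - h ((r + t') / 2)| ≤ 1 := by
        simp only [abs_le] at e1 e2 ⊢
        omega
      rcases f1 with f1 | f1
      · exact (rook_fst f1 d1).trans (rook_snd f0 d2)
      · exact (rook_snd f1 d2).trans (rook_fst f0 d1)
  exact (hlift _ key).2 |> fun h => by simpa using h

end Mountain

/-! ## Pairings of the darts of a graph and the circuits they determine -/

namespace Circuit

variable {V : Type*}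

/-- `τ` pairs off, at every vertex, the darts of `S` leaving it so that the two darts of a pair have
different colours; it fixes all other pairs of vertices. -/
structure Alternating (S : SimpleGraph V) (c : V × V → Prop) (τ : Equiv.Perm (V × V)) : Prop where
  off : ∀ y, ¬ S.Adj y.1 y.2 → τ y = y
  fst : ∀ y, (τ y).1 = y.1
  invol : ∀ y, τ (τ y) = y
  adj : ∀ y, S.Adj y.1 y.2 → S.Adj (τ y).1 (τ y).2
  alt : ∀ y, S.Adj y.1 y.2 → (c (τ y) ↔ ¬ c y)

/-- The dart that follows `y` on its circuit. -/
def next (τ : Equiv.Perm (V × V)) : Equiv.Perm (V × V) := (Equiv.prodComm V V).trans τ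

@[simp] lemma next_apply (τ : Equiv.Perm (V × V)) (y : V × V) : next τ y = τ y.swap := rfl

/-- The list `l` runs through all circuits, one after the other: it contains every edge of `S`
exactly once. -/
structure IsTour (S : SimpleGraph V) (τ : Equiv.Perm (V × V)) (l : List (V × V)) : Prop where
  nodup : l.Nodup
  mem_or : ∀ y : V × V, S.Adj y.1 y.2 ↔ y ∈ l ∨ y.swap ∈ l
  swap_notMem : ∀ y ∈ l, y.swap ∉ l
  even : Even l.length
  step : ∀ (i : ℕ) (y : V × V), l[i]? = some y → ∃ j ≤ i + 1, l[j]? = some (τ y.swap)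
  step_even : ∀ (i : ℕ) (y : V × V), Even i → l[i]? = some y → l[i + 1]? = some (τ y.swap)

section Exists

variable {S : SimpleGraph V} {c : V × V → Prop} {τ : Equiv.Perm (V × V)}

lemma Alternating.next_adj (h : Alternating S c τ) (y : V × V) (hy : S.Adj y.1 y.2) :
    S.Adj (next τ y).1 (next τ y).2 := h.adj y.swap hy.symm

lemma Alternating.next_alt (h : Alternating S c τ) (hc : ∀ y, c y.swap ↔ c y) (y : V × V)
    (hy : S.Adj y.1 y.2) : c (next τ y) ↔ ¬ c y := by
  rw [next_apply, h.alt _ hy.symm, hc]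

/-- Conjugation by reversal turns `next` into its inverse: a circuit read backwards is a circuit. -/
lemma Alternating.next_swap_next (h : Alternating S c τ) (y : V × V) :
    next τ (next τ y).swap = y.swap := by
  simp [h.invol]

lemma Alternating.iterate_adj (h : Alternating S c τ) {y : V × V} (hy : S.Adj y.1 y.2) (i : ℕ) :
    S.Adj ((next τ)^[i] y).1 ((next τ)^[i] y).2 := by
  induction i with
  | zero => exact hy
  | succ i ih => rw [Function.iterate_succ_apply']; exact h.next_adj _ ih

lemma Alternating.iterate_alt (h : Alternating S c τ) (hc : ∀ y, c y.swap ↔ c y) {y : V × V}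
    (hy : S.Adj y.1 y.2) (i : ℕ) : (c ((next τ)^[i] y) ↔ c y) ↔ Even i := by
  induction i with
  | zero => simp
  | succ i ih =>
    rw [Function.iterate_succ_apply', h.next_alt hc _ (h.iterate_adj hy i), Nat.even_add_one, ← ih]
    tauto

/-- A circuit does not traverse an edge in both directions. -/
lemma Alternating.iterate_ne_swap (h : Alternating S c τ) {y : V × V} (hy : S.Adj y.1 y.2)
    (a b : ℕ) : (next τ)^[a] y ≠ ((next τ)^[b] y).swap := by
  have hshift : ∀ a b, (next τ)^[a] y = ((next τ)^[b + 1] y).swap ↔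
      (next τ)^[a + 1] y = ((next τ)^[b] y).swap := by
    intro a b
    rw [Function.iterate_succ_apply', Function.iterate_succ_apply', ← h.next_swap_next ((next τ)^[b] y)]
    exact (next τ).injective.eq_iff.symm
  have hall : ∀ b a, (next τ)^[a] y = ((next τ)^[b] y).swap ↔
      (next τ)^[a + b] y = ((next τ)^[0] y).swap := by
    intro b
    induction b with
    | zero => intro a; rfl
    | succ b ih => intro a; rw [hshift, ih, add_right_comm, add_assoc]
  rw [ne_eq, hall]
  -- Only a + b matters, so the two indices can be brought together. If they become equal, a dart is
  -- its own reverse, against looplessness; if they become adjacent, `τ` fixes a dart, against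
  -- alternation.
  rcases Nat.even_or_odd' (a + b) with ⟨e, he | he⟩
  · rw [he, two_mul, ← hall e e]
    intro hs
    have h1 := h.iterate_adj hy e
    rw [Prod.ext_iff] at hs
    exact h1.ne hs.1
  · have : a + b = (e + 1) + e := by omega
    rw [this, ← hall e (e + 1), Function.iterate_succ_apply', next_apply]
    intro hs
    have h1 := h.alt ((next τ)^[e] y).swap (h.iterate_adj hy e).symm
    rw [hs] at h1
    tauto

variable [Finite V]

/-- The block is the `next`-orbit over one minimal period, which is even because colours alternate.
Only the last dart leads back, to index 0, whence `j ≤ i + 1`; its index is odd, so darts at even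
indices are followed by their successors. -/
lemma exists_block (h : Alternating S c τ) (hc : ∀ y, c y.swap ↔ c y) {y : V × V}
    (hy : S.Adj y.1 y.2) :
    ∃ l : List (V × V), l.Nodup ∧ (∀ z, z ∈ l ↔ ∃ i : ℕ, z = (next τ)^[i] y) ∧ Even l.length ∧
      (∀ (i : ℕ) (y : V × V), l[i]? = some y → ∃ j ≤ i + 1, l[j]? = some (τ y.swap)) ∧
      (∀ (i : ℕ) (y : V × V), Even i → l[i]? = some y → l[i + 1]? = some (τ y.swap)) := by
  have hper : y ∈ Function.periodicPts (next τ) :=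
    Function.Injective.mem_periodicPts (next τ).injective y
  set m := Function.minimalPeriod (next τ) y with hm
  have hm0 : 0 < m := Function.minimalPeriod_pos_of_mem_periodicPts hper
  have hit : (next τ)^[m] y = y := Function.iterate_minimalPeriod
  have heven : Even m := by
    rw [← h.iterate_alt hc hy, hit]
  have hget : ∀ i z, ((List.range m).map fun i => (next τ)^[i] y)[i]? = some z ↔
      i < m ∧ z = (next τ)^[i] y := by
    intro i z
    rw [List.getElem?_map]
    by_cases hi : i < m
    · simp [hi, eq_comm]
    · simp [hi]
  refine ⟨(List.range m).map fun i => (next τ)^[i] y, ?_, ?_, ?_, ?_, ?_⟩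
  · refine List.Nodup.map_on ?_ List.nodup_range
    intro i hi j hj hij
    exact Function.iterate_injOn_Iio_minimalPeriod (Set.mem_Iio.2 (List.mem_range.1 hi))
      (Set.mem_Iio.2 (List.mem_range.1 hj)) hij
  · intro z
    simp only [List.mem_map, List.mem_range]
    constructor
    · rintro ⟨i, -, rfl⟩; exact ⟨i, rfl⟩
    · rintro ⟨i, rfl⟩
      exact ⟨i % m, Nat.mod_lt _ hm0, Function.iterate_mod_minimalPeriod_eq⟩
  · simpa using heven
  · intro i z hz
    obtain ⟨hi, rfl⟩ := (hget i z).1 hz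
    by_cases him : i + 1 < m
    · exact ⟨i + 1, le_rfl, (hget _ _).2 ⟨him, by rw [Function.iterate_succ_apply', next_apply]⟩⟩
    · refine ⟨0, Nat.zero_le _, (hget _ _).2 ⟨hm0, ?_⟩⟩
      have : i + 1 = m := by omega
      rw [← next_apply, ← Function.iterate_succ_apply' (next τ), Nat.succ_eq_add_one, this, hit]
      rfl
  · intro i z hi hz
    obtain ⟨him, rfl⟩ := (hget i z).1 hz
    refine (hget _ _).2 ⟨?_, by rw [Function.iterate_succ_apply', next_apply]⟩
    obtain ⟨p, hp⟩ := heven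
    obtain ⟨q, hq⟩ := hi
    omega

/-- Circuits are stripped off one by one and concatenated; the even block lengths keep the hinges
aligned with even positions. -/
theorem exists_tour (h : Alternating S c τ) (hc : ∀ y, c y.swap ↔ c y) :
    ∃ l, IsTour S τ l := by
  classical
  have := Fintype.ofFinite V
  -- Induction over sets of darts closed under reversal and `τ`: one orbit together with its
  -- reversal is removed at a time.
  have key : ∀ (k : ℕ) (A : Finset (V × V)), A.card ≤ k → (∀ y ∈ A, S.Adj y.1 y.2) →
      (∀ y ∈ A, y.swap ∈ A) → (∀ y ∈ A, τ y ∈ A) →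
      ∃ l : List (V × V), l.Nodup ∧ (∀ y, y ∈ A ↔ y ∈ l ∨ y.swap ∈ l) ∧
        (∀ y ∈ l, y.swap ∉ l) ∧ Even l.length ∧
        (∀ (i : ℕ) (y : V × V), l[i]? = some y → ∃ j ≤ i + 1, l[j]? = some (τ y.swap)) ∧
        (∀ (i : ℕ) (y : V × V), Even i → l[i]? = some y → l[i + 1]? = some (τ y.swap)) := by
    intro k
    induction k with
    | zero =>
      intro A hA _ _ _
      have : A = ∅ := by simpa using hA
      subst this
      exact ⟨[], by simp⟩
    | succ k ih =>
      intro A hA hS hsw hτ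
      rcases A.eq_empty_or_nonempty with rfl | ⟨y, hy⟩
      · exact ⟨[], by simp⟩
      obtain ⟨b, b1, b2, b3, b4, b5⟩ := exists_block h hc (hS y hy)
      have hbA : ∀ z ∈ b, z ∈ A := by
        intro z hz
        obtain ⟨i, rfl⟩ := (b2 z).1 hz
        clear hz
        induction i with
        | zero => exact hy
        | succ i ihi =>
          rw [Function.iterate_succ_apply']
          exact hτ _ (hsw _ ihi)
      have hbs : ∀ z ∈ b, z.swap ∉ b := by
        intro z hz hz'
        obtain ⟨i, hi⟩ := (b2 _).1 hz
        obtain ⟨j, hj⟩ := (b2 _).1 hz'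
        refine h.iterate_ne_swap (hS y hy) i j ?_
        rw [← hi, ← hj, Prod.swap_swap]
      have hyb : y ∈ b := (b2 y).2 ⟨0, rfl⟩
      have hmemA' : ∀ z, z ∈ A.filter (fun z => z ∉ b ∧ z.swap ∉ b) ↔ z ∈ A ∧ z ∉ b ∧ z.swap ∉ b :=
        fun z => Finset.mem_filter
      have hnext : ∀ z, next τ z ∈ b ↔ z ∈ b := by
        intro z
        constructor
        · intro hz
          obtain ⟨i, hi⟩ := (b2 _).1 hz
          have hper : y ∈ Function.periodicPts (next τ) :=
            Function.Injective.mem_periodicPts (next τ).injective y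
          have hpos := Function.minimalPeriod_pos_of_mem_periodicPts hper
          refine (b2 _).2 ⟨i + (Function.minimalPeriod (next τ) y - 1), ?_⟩
          apply (next τ).injective
          rw [hi, ← Function.iterate_succ_apply' (next τ), Nat.succ_eq_add_one, add_assoc,
            Nat.sub_add_cancel hpos, Function.iterate_add_apply, Function.iterate_minimalPeriod]
        · intro hz
          obtain ⟨i, rfl⟩ := (b2 _).1 hz
          exact (b2 _).2 ⟨i + 1, by rw [Function.iterate_succ_apply']⟩
      obtain ⟨l, l1, l2, l3, l4, l5, l6⟩ := ih (A.filter (fun z => z ∉ b ∧ z.swap ∉ b)) (by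
          have : (A.filter (fun z => z ∉ b ∧ z.swap ∉ b)).card < A.card :=
            Finset.card_lt_card (Finset.filter_ssubset.2 ⟨y, hy, fun hc => hc.1 hyb⟩)
          omega)
        (fun z hz => hS z ((hmemA' z).1 hz).1)
        (fun z hz => by
          have := (hmemA' z).1 hz
          exact (hmemA' _).2 ⟨hsw z this.1, this.2.2, by simpa using this.2.1⟩)
        (fun z hz => by
          have := (hmemA' z).1 hz
          refine (hmemA' _).2 ⟨hτ z this.1, ?_, ?_⟩
          · intro hb
            exact this.2.2 ((hnext _).1 (by simpa using hb))
          · intro hb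
            have := (hnext _).2 hb
            rw [next_apply, Prod.swap_swap, h.invol] at this
            tauto)
      have hlA : ∀ z ∈ l, z ∉ b ∧ z.swap ∉ b := fun z hz =>
        ((hmemA' z).1 ((l2 z).2 (Or.inl hz))).2
      refine ⟨b ++ l, ?_, ?_, ?_, ?_, ?_, ?_⟩
      · refine List.nodup_append'.2 ⟨b1, l1, ?_⟩
        intro z hz hz'
        exact (hlA z hz').1 hz
      · intro z
        have h1 := l2 z
        rw [hmemA'] at h1
        simp only [List.mem_append]
        constructor
        · intro hz
          by_cases hzb : z ∈ b
          · tauto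
          by_cases hzb' : z.swap ∈ b
          · tauto
          tauto
        · have h2 := hbA z
          have h3 := fun hz => hsw _ (hbA z.swap hz)
          rw [Prod.swap_swap] at h3
          tauto
      · intro z hz hz'
        rcases List.mem_append.1 hz with hz | hz <;> rcases List.mem_append.1 hz' with hz' | hz'
        · exact hbs z hz hz'
        · exact (hlA _ hz').2 (by simpa using hz)
        · exact (hlA _ hz).2 hz'
        · exact l3 z hz hz'
      · rw [List.length_append]; exact b3.add l4
      · intro i z hz
        rcases lt_or_ge i b.length with hi | hi
        · rw [List.getElem?_append_left hi] at hz
          obtain ⟨j, hj, hj'⟩ := b4 i z hz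
          refine ⟨j, hj, ?_⟩
          rw [List.getElem?_append_left (List.getElem?_eq_some_iff.1 hj').1, hj']
        · rw [List.getElem?_append_right hi] at hz
          obtain ⟨j, hj, hj'⟩ := l5 _ z hz
          refine ⟨b.length + j, by omega, ?_⟩
          rw [List.getElem?_append_right (by omega), Nat.add_sub_cancel_left, hj']
      · intro i z hie hz
        rcases lt_or_ge i b.length with hi | hi
        · rw [List.getElem?_append_left hi] at hz
          have hj' := b5 i z hie hz
          rw [List.getElem?_append_left (List.getElem?_eq_some_iff.1 hj').1, hj']
        · rw [List.getElem?_append_right hi] at hz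
          have hj' := l6 _ z ((Nat.even_sub hi).2 (by simp [hie, b3])) hz
          rw [List.getElem?_append_right (by omega), Nat.sub_add_comm hi, hj']
  obtain ⟨l, l1, l2, l3, l4, l5, l6⟩ := key _ (Finset.univ.filter fun y : V × V => S.Adj y.1 y.2)
    le_rfl (by simp) (by simpa using fun a b h => h.symm)
    (fun y hy => by
      simp only [Finset.mem_filter, Finset.mem_univ, true_and] at hy ⊢
      exact h.adj y hy)
  exact ⟨l, l1, fun y => by rw [← l2]; simp, l3, l4, l5, l6⟩

end Exists

end Circuit

/-! ### Initial segments of a tour and their hinges -/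

open scoped symmDiff

namespace Circuit

section Graph

variable {V : Type*}

lemma symmDiff_adj (G H : SimpleGraph V) (u v : V) :
    (G ∆ H).Adj u v ↔ (G.Adj u v ↔ ¬ H.Adj u v) := by
  simp only [symmDiff_def, SimpleGraph.sup_adj, SimpleGraph.sdiff_adj]
  tauto

/-- The graph formed by the first `2 * a` edges of the tour `l`. -/
def pre (l : List (V × V)) (a : ℕ) : SimpleGraph V :=
  SimpleGraph.fromRel fun u v => (u, v) ∈ l.take (2 * a)

open Classical in
/-- The symmetric difference of two initial segments of a tour of `S`, or the rest of `S`. -/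
noncomputable def seg (S : SimpleGraph V) (l : List (V × V)) (a b : ℕ) (β : Prop) :
    SimpleGraph V :=
  pre l a ∆ pre l b ∆ (if β then S else ⊥)

lemma seg_adj (S : SimpleGraph V) (l : List (V × V)) (a b : ℕ) (β : Prop) (u v : V) :
    (seg S l a b β).Adj u v ↔
      (((pre l a).Adj u v ↔ ¬ (pre l b).Adj u v) ↔ ¬ (β ∧ S.Adj u v)) := by
  rw [seg, symmDiff_adj, symmDiff_adj]
  split_ifs with h <;> simp [h]

variable {S : SimpleGraph V} {τ : Equiv.Perm (V × V)} {l : List (V × V)}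

lemma IsTour.pre_adj (hl : IsTour S τ l) (a : ℕ) (y : V × V) :
    (pre l a).Adj y.1 y.2 ↔ y ∈ l.take (2 * a) ∨ y.swap ∈ l.take (2 * a) := by
  rw [pre, SimpleGraph.fromRel_adj]
  refine ⟨fun h => h.2, fun h => ⟨?_, h⟩⟩
  have : S.Adj y.1 y.2 :=
    (hl.mem_or y).2 (h.imp (fun h => List.mem_of_mem_take h) fun h => List.mem_of_mem_take h)
  exact this.ne

lemma pre_zero (l : List (V × V)) : pre l 0 = ⊥ := by
  ext u v
  simp [pre]

lemma IsTour.pre_top (hl : IsTour S τ l) {N : ℕ} (hN : l.length ≤ 2 * N) : pre l N = S := by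
  ext u v
  have h := hl.pre_adj N (u, v)
  rw [List.take_of_length_le hN] at h
  exact h.trans (hl.mem_or (u, v)).symm

lemma IsTour.pre_le (hl : IsTour S τ l) (a : ℕ) : pre l a ≤ S := by
  intro u v h
  exact (hl.mem_or (u, v)).2 (((hl.pre_adj a (u, v)).1 h).imp
    (fun h => List.mem_of_mem_take h) fun h => List.mem_of_mem_take h)

lemma IsTour.pre_mono (hl : IsTour S τ l) {a b : ℕ} (hab : a ≤ b) : pre l a ≤ pre l b := by
  intro u v h
  have hs : ∀ y, y ∈ l.take (2 * a) → y ∈ l.take (2 * b) := fun y hy =>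
    (List.take_prefix_take_left (by omega)).subset hy
  exact (hl.pre_adj b (u, v)).2 (((hl.pre_adj a (u, v)).1 h).imp (hs _) (hs _))

lemma IsTour.seg_le (hl : IsTour S τ l) (a b : ℕ) (β : Prop) : seg S l a b β ≤ S := by
  intro u v h
  rw [seg_adj] at h
  have h1 : (pre l a).Adj u v → S.Adj u v := fun h => hl.pre_le a h
  have h2 : (pre l b).Adj u v → S.Adj u v := fun h => hl.pre_le b h
  tauto

/-- The two edges of a hinge. -/
structure IsHinge (S : SimpleGraph V) (l : List (V × V)) (a : ℕ) (x x' : V × V) : Prop where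
  mem : x ∈ l
  mem' : x' ∈ l
  pre_succ : ∀ y : V × V, (pre l (a + 1)).Adj y.1 y.2 ↔ (pre l a).Adj y.1 y.2 ∨
    (y = x ∨ y = x.swap ∨ y = x' ∨ y = x'.swap)
  notMem : ∀ y, (y = x ∨ y = x.swap ∨ y = x' ∨ y = x'.swap) → ¬ (pre l a).Adj y.1 y.2
  nodup : [x, x.swap, x', x'.swap].Nodup

/-- At an even position `step_even` guarantees that the next entry is the successor on the same
circuit, so each hinge has a common vertex even where the tour passes from one circuit to another.
-/
lemma IsTour.exists_hinge (hl : IsTour S τ l) {a : ℕ} (ha : 2 * a < l.length) :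
    ∃ x, IsHinge S l a x (τ x.swap) := by
  obtain ⟨x, hx⟩ : ∃ x, l[2 * a]? = some x := ⟨_, List.getElem?_eq_getElem ha⟩
  have hx' := hl.step_even _ x (even_two_mul a) hx
  set x' := τ x.swap with hxdef
  have htake : l.take (2 * (a + 1)) = l.take (2 * a) ++ [x, x'] := by
    rw [show 2 * (a + 1) = (2 * a + 1) + 1 by ring, List.take_add_one, List.take_add_one, hx, hx']
    simp
  have hxl : x ∈ l := List.mem_of_getElem? hx
  have hxl' : x' ∈ l := List.mem_of_getElem? hx'
  have hnd : (l.take (2 * a) ++ [x, x']).Nodup := by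
    rw [← htake]; exact hl.nodup.sublist (List.take_sublist _ _)
  rw [List.nodup_append'] at hnd
  obtain ⟨-, hnd2, hdis⟩ := hnd
  have hne : x ≠ x' := by simpa using hnd2
  have hs : ∀ y ∈ l, ∀ z ∈ l, y ≠ z.swap := by
    rintro y hy z hz rfl
    exact hl.swap_notMem z hz hy
  refine ⟨x, hxl, hxl', ?_, ?_, ?_⟩
  · intro y
    rw [hl.pre_adj, hl.pre_adj, htake]
    have e1 : ∀ z : V × V, y.swap = z ↔ y = z.swap := fun z => Prod.swap_eq_iff_eq_swap
    simp only [List.mem_append, List.mem_cons, List.not_mem_nil, or_false, e1]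
    tauto
  · intro y hy hp
    rw [hl.pre_adj] at hp
    have d1 : x ∉ l.take (2 * a) := fun h => hdis h (by simp)
    have d2 : x' ∉ l.take (2 * a) := fun h => hdis h (by simp)
    have d3 : x.swap ∉ l.take (2 * a) := fun h => hl.swap_notMem x hxl (List.mem_of_mem_take h)
    have d4 : x'.swap ∉ l.take (2 * a) := fun h => hl.swap_notMem x' hxl' (List.mem_of_mem_take h)
    rcases hy with rfl | rfl | rfl | rfl <;> simp_all
  · have h1 := hs x hxl x hxl
    have h2 := hs x hxl x' hxl'
    have h3 := hs x' hxl' x hxl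
    have h4 := hs x' hxl' x' hxl'
    have h5 : x.swap ≠ x'.swap := fun h => hne (Prod.swap_injective h)
    simp only [List.nodup_cons, List.mem_cons, List.not_mem_nil, or_false, not_or,
      not_false_eq_true, List.nodup_nil, and_true]
    exact ⟨⟨h1, hne, h2⟩, ⟨h3.symm, h5⟩, h4⟩

/-- The two edges of a hinge belong to the same segments. -/
lemma IsTour.seg_hinge (hl : IsTour S τ l) {a : ℕ} {x x' : V × V} (hx : IsHinge S l a x x')
    (b₁ b₂ : ℕ) (β : Prop) :
    (seg S l b₁ b₂ β).Adj x.1 x.2 ↔ (seg S l b₁ b₂ β).Adj x'.1 x'.2 := by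
  have hp : ∀ b, (pre l b).Adj x.1 x.2 ↔ (pre l b).Adj x'.1 x'.2 := by
    intro b
    rcases Nat.lt_or_ge a b with h | h
    · have h1 := fun y => (hx.pre_succ y).2
      have hm := hl.pre_mono (Nat.succ_le_of_lt h)
      exact iff_of_true (hm (h1 x (by simp))) (hm (h1 x' (by simp)))
    · have hm := hl.pre_mono h
      exact iff_of_false (fun h => hx.notMem x (by simp) (hm h))
        fun h => hx.notMem x' (by simp) (hm h)
  have h1 := (hl.mem_or x).2 (Or.inl hx.mem)
  have h2 := (hl.mem_or x').2 (Or.inl hx.mem')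
  rw [seg_adj, seg_adj, hp, hp]
  tauto

lemma Alternating.next_adj_iff {c : V × V → Prop} (h : Alternating S c τ) (y : V × V) :
    S.Adj (next τ y).1 (next τ y).2 ↔ S.Adj y.1 y.2 := by
  refine ⟨fun hy => ?_, h.next_adj y⟩
  have := h.adj _ hy
  rw [next_apply, h.invol] at this
  exact this.symm

end Graph

/-! ### How often the circuits cross the boundary of a segment -/

section Crossings

/-- The set and its preimage under a permutation have equal size, hence so do their two differences.
-/
lemma card_exit_eq_card_enter {α : Type*} [Fintype α] (e : Equiv.Perm α) (p : α → Prop)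
    [DecidablePred p] :
    (Finset.univ.filter fun y => p y ∧ ¬ p (e y)).card =
      (Finset.univ.filter fun y => ¬ p y ∧ p (e y)).card := by
  classical
  have h1 : (Finset.univ.filter p).card = (Finset.univ.filter fun y => p (e y)).card :=
    (Finset.card_bijective e.symm e.symm.bijective (by simp))
  have h2 : Finset.univ.filter (fun y => p y ∧ ¬ p (e y)) =
      Finset.univ.filter p \ Finset.univ.filter fun y => p (e y) := by
    ext; simp
  have h3 : Finset.univ.filter (fun y => ¬ p y ∧ p (e y)) =
      (Finset.univ.filter fun y => p (e y)) \ Finset.univ.filter p := by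
    ext; simp [and_comm]
  rw [h2, h3]
  exact Finset.card_sdiff_comm h1

variable {V : Type*} [Fintype V]

/-- The number of places at which the circuits leave the graph `X`. -/
noncomputable def cross (τ : Equiv.Perm (V × V)) (X : SimpleGraph V) : ℕ :=
  open Classical in
  (Finset.univ.filter fun y : V × V => X.Adj y.1 y.2 ∧ ¬ X.Adj (next τ y).1 (next τ y).2).card

/-- The number of places at which the circuits enter or leave the graph `X`. -/
noncomputable def sep (τ : Equiv.Perm (V × V)) (X : SimpleGraph V) : ℕ :=
  open Classical in
  (Finset.univ.filter fun y : V × V =>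
    X.Adj y.1 y.2 ↔ ¬ X.Adj (next τ y).1 (next τ y).2).card

lemma sep_eq (τ : Equiv.Perm (V × V)) (X : SimpleGraph V) : sep τ X = 2 * cross τ X := by
  classical
  have h := card_exit_eq_card_enter (next τ) fun y => X.Adj y.1 y.2
  have hd : Disjoint
      (Finset.univ.filter fun y : V × V => X.Adj y.1 y.2 ∧ ¬ X.Adj (next τ y).1 (next τ y).2)
      (Finset.univ.filter fun y : V × V => ¬ X.Adj y.1 y.2 ∧ X.Adj (next τ y).1 (next τ y).2) := by
    rw [Finset.disjoint_filter]; tauto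
  have hu := Finset.card_union_of_disjoint hd
  rw [← h, ← Finset.filter_or] at hu
  rw [sep, cross, two_mul]
  refine Eq.trans ?_ (hu.trans ?_)
  · congr 1
    ext y
    simp only [Finset.mem_filter]
    tauto
  · congr!

/-- Subadditivity is the purpose of `sep`: a boundary of a symmetric difference is a boundary of one
of the two graphs. -/
lemma sep_symmDiff_le (τ : Equiv.Perm (V × V)) (X Y : SimpleGraph V) :
    sep τ (X ∆ Y) ≤ sep τ X + sep τ Y := by
  classical
  rw [sep, sep, sep]
  refine le_trans (Finset.card_le_card ?_) (Finset.card_union_le _ _)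
  intro y
  simp only [Finset.mem_union, Finset.mem_filter, Finset.mem_univ, true_and, symmDiff_adj]
  tauto

variable {S : SimpleGraph V} {c : V × V → Prop} {τ : Equiv.Perm (V × V)} {l : List (V × V)}

lemma Alternating.sep_self (h : Alternating S c τ) : sep τ S = 0 := by
  classical
  rw [sep, Finset.card_eq_zero, Finset.filter_eq_empty_iff]
  intro y _
  have := h.next_adj_iff y
  tauto

/-- Successors lie at most one place further on, so the directed list is left only at its last dart.
An edge carries two darts; the reversed ones contribute one more exit, corresponding to an entry
into the list. -/
lemma IsTour.cross_pre_le (hl : IsTour S τ l) (h : Alternating S c τ) (a : ℕ) :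
    cross τ (pre l a) ≤ 2 := by
  classical
  set T := l.take (2 * a) with hT
  have hT1 : (Finset.univ.filter fun y => y ∈ T ∧ ¬ next τ y ∈ T).card ≤ 1 := by
    have hval : ∀ y, y ∈ T → next τ y ∉ T → l[2 * a - 1]? = some y := by
      intro y hy hy'
      obtain ⟨i, hi⟩ := List.mem_iff_getElem?.1 hy
      have hi2 : i < 2 * a := by
        have := (List.getElem?_eq_some_iff.1 hi).1
        rw [hT, List.length_take] at this
        omega
      rw [hT, List.getElem?_take_of_lt hi2] at hi
      obtain ⟨j, hj, hj'⟩ := hl.step i y hi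
      have hj2 : 2 * a ≤ j := by
        by_contra hc
        refine hy' (List.mem_iff_getElem?.2 ⟨j, ?_⟩)
        rw [hT, List.getElem?_take_of_lt (by omega), hj', next_apply]
      rw [show 2 * a - 1 = i by omega, hi]
    rw [Finset.card_le_one]
    intro y hy z hz
    simp only [Finset.mem_filter, Finset.mem_univ, true_and] at hy hz
    exact Option.some.inj ((hval y hy.1 hy.2).symm.trans (hval z hz.1 hz.2))
  have hT2 : (Finset.univ.filter fun y => ¬ y ∈ T ∧ next τ y ∈ T).card ≤ 1 := by
    rwa [← card_exit_eq_card_enter (next τ) fun y => y ∈ T]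
  have hsub : (Finset.univ.filter fun y : V × V => (pre l a).Adj y.1 y.2 ∧
      ¬ (pre l a).Adj (next τ y).1 (next τ y).2) ⊆
      (Finset.univ.filter fun y => y ∈ T ∧ ¬ next τ y ∈ T) ∪
      (Finset.univ.filter fun y => ¬ y ∈ T ∧ next τ y ∈ T).image fun w => (next τ w).swap := by
    intro y hy
    simp only [Finset.mem_filter, Finset.mem_univ, true_and, hl.pre_adj, not_or] at hy
    rw [Finset.mem_union, Finset.mem_filter]
    rcases hy.1 with h1 | h1
    · exact Or.inl ⟨Finset.mem_univ _, h1, hy.2.1⟩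
    · refine Or.inr (Finset.mem_image.2 ⟨(next τ y).swap, ?_, ?_⟩)
      · refine Finset.mem_filter.2 ⟨Finset.mem_univ _, hy.2.2, ?_⟩
        rwa [h.next_swap_next]
      · rw [h.next_swap_next, Prod.swap_swap]
  rw [cross]
  refine le_trans (le_of_eq ?_) ((Finset.card_le_card hsub).trans ((Finset.card_union_le _ _).trans
    (add_le_add hT1 (Finset.card_image_le.trans hT2))))
  congr!

/-- Two crossings from each of the initial segments; taking the complement in `S` adds none, since
`S` is closed under `next`. -/
lemma IsTour.cross_seg_le (hl : IsTour S τ l) (h : Alternating S c τ) (a b : ℕ) (β : Prop) :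
    cross τ (seg S l a b β) ≤ 4 := by
  classical
  have h1 := hl.cross_pre_le h a
  have h2 := hl.cross_pre_le h b
  have h5 := sep_symmDiff_le τ (pre l a) (pre l b)
  have h6 : sep τ (seg S l a b β) ≤ sep τ (pre l a) + sep τ (pre l b) := by
    by_cases hβ : β
    · rw [seg, if_pos hβ]
      have := sep_symmDiff_le τ (pre l a ∆ pre l b) S
      rw [h.sep_self] at this
      omega
    · rw [seg, if_neg hβ]
      rwa [symmDiff_bot]
  simp only [sep_eq] at h6
  omega

end Crossings

end Circuit

/-! ### Changes of degrees and of the cut when a segment is flipped -/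

namespace Circuit

section Weights

/-- A hinge consists of an edge of `G` and a non-edge of `G`. -/
lemma Alternating.adj_next {V : Type*} {S G : SimpleGraph V} {τ : Equiv.Perm (V × V)}
    (h : Alternating S (fun y => G.Adj y.1 y.2) τ)
    {x : V × V} (hx : S.Adj x.1 x.2) : G.Adj (τ x.swap).1 (τ x.swap).2 ↔ ¬ G.Adj x.1 x.2 := by
  rw [h.alt x.swap hx.symm, Prod.fst_swap, Prod.snd_swap, G.adj_comm]

variable {V : Type*} [Fintype V]

/-- The change of the total `ω`-weight of the darts of `G` when the edges in `X` are flipped. -/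
noncomputable def change (G : SimpleGraph V) (ω : V × V → ℤ) (X : SimpleGraph V) : ℤ :=
  open Classical in ∑ y : V × V with X.Adj y.1 y.2, ω y * if G.Adj y.1 y.2 then -1 else 1

lemma sum_symmDiff (G : SimpleGraph V) (ω : V × V → ℤ) (X : SimpleGraph V) :
    (open Classical in ∑ y : V × V with (G ∆ X).Adj y.1 y.2, ω y) =
      (open Classical in ∑ y : V × V with G.Adj y.1 y.2, ω y) + change G ω X := by
  classical
  rw [change, Finset.sum_filter, Finset.sum_filter, Finset.sum_filter, ← Finset.sum_add_distrib]
  refine Finset.sum_congr rfl fun y _ => ?_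
  have h := symmDiff_adj G X y.1 y.2
  by_cases h1 : G.Adj y.1 y.2 <;> by_cases h2 : X.Adj y.1 y.2 <;> simp [h1, h2, h]

variable {S : SimpleGraph V} {τ : Equiv.Perm (V × V)} {l : List (V × V)} {G : SimpleGraph V}

/-- Initial segments are nested, so changes subtract; the complementary arc has the opposite change
because the total over `S` vanishes. -/
lemma IsTour.abs_change_seg (hl : IsTour S τ l) {ω : V × V → ℤ} (hS : change G ω S = 0)
    (a b : ℕ) (β : Prop) :
    |change G ω (seg S l a b β)| = |change G ω (pre l a) - change G ω (pre l b)| := by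
  classical
  wlog hab : a ≤ b generalizing a b
  · rw [abs_sub_comm, ← this b a (by omega), seg, seg, symmDiff_comm (pre l a)]
  have key : change G ω (seg S l a b β) =
      if β then change G ω S - (change G ω (pre l b) - change G ω (pre l a))
      else change G ω (pre l b) - change G ω (pre l a) := by
    simp only [change, Finset.sum_filter]
    split_ifs with hβ
    · rw [← Finset.sum_sub_distrib, ← Finset.sum_sub_distrib]
      refine Finset.sum_congr rfl fun y _ => ?_
      have h1 : (pre l a).Adj y.1 y.2 → (pre l b).Adj y.1 y.2 := fun h => hl.pre_mono hab h
      have h2 : (pre l b).Adj y.1 y.2 → S.Adj y.1 y.2 := fun h => hl.pre_le b h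
      have h := seg_adj S l a b β y.1 y.2
      by_cases e1 : (pre l a).Adj y.1 y.2 <;> by_cases e2 : (pre l b).Adj y.1 y.2 <;>
        by_cases e3 : S.Adj y.1 y.2 <;> simp_all
    · rw [← Finset.sum_sub_distrib]
      refine Finset.sum_congr rfl fun y _ => ?_
      have h1 : (pre l a).Adj y.1 y.2 → (pre l b).Adj y.1 y.2 := fun h => hl.pre_mono hab h
      have h := seg_adj S l a b β y.1 y.2
      by_cases e1 : (pre l a).Adj y.1 y.2 <;> by_cases e2 : (pre l b).Adj y.1 y.2 <;> simp_all
  rw [key, hS]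
  split_ifs
  · rw [zero_sub, abs_neg, abs_sub_comm]
  · rw [abs_sub_comm]

lemma change_pre_succ {a : ℕ} {x x' : V × V} (hx : IsHinge S l a x x') (ω : V × V → ℤ) :
    change G ω (pre l (a + 1)) = change G ω (pre l a) +
      (open Classical in (ω x + ω x.swap) * (if G.Adj x.1 x.2 then -1 else 1) +
        (ω x' + ω x'.swap) * if G.Adj x'.1 x'.2 then -1 else 1) := by
  classical
  have hset : (Finset.univ.filter fun y : V × V => (pre l (a + 1)).Adj y.1 y.2) =
      (Finset.univ.filter fun y : V × V => (pre l a).Adj y.1 y.2) ∪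
        [x, x.swap, x', x'.swap].toFinset := by
    ext y
    simp only [hx.pre_succ, Finset.mem_union, Finset.mem_filter, Finset.mem_univ, true_and,
      List.mem_toFinset, List.mem_cons, List.not_mem_nil, or_false]
  have hdis : Disjoint (Finset.univ.filter fun y : V × V => (pre l a).Adj y.1 y.2)
      [x, x.swap, x', x'.swap].toFinset := by
    rw [Finset.disjoint_right]
    intro y hy
    have := hx.notMem y (by simpa using hy)
    simpa using this
  rw [change, change]
  refine (Finset.sum_congr (Eq.trans (by congr!) hset) fun _ _ => rfl).trans ?_
  rw [Finset.sum_union hdis, List.sum_toFinset _ hx.nodup]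
  congr 1
  simp only [List.map_cons, List.map_nil, List.sum_cons, List.sum_nil, Prod.fst_swap,
    Prod.snd_swap, G.adj_comm x.2 x.1, G.adj_comm x'.2 x'.1]
  ring

/-- Each hinge trades an edge for a non-edge, which preserves the number of edges. -/
lemma IsTour.change_one_pre (hl : IsTour S τ l) (h : Alternating S (fun y => G.Adj y.1 y.2) τ)
    {a : ℕ} (ha : 2 * a ≤ l.length) : change G 1 (pre l a) = 0 := by
  induction a with
  | zero => simp [pre_zero, change]
  | succ a ih =>
    obtain ⟨x, hx⟩ := hl.exists_hinge (a := a) (by omega)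
    rw [change_pre_succ hx, ih (by omega)]
    have := h.adj_next ((hl.mem_or x).2 (Or.inl hx.mem))
    by_cases hG : G.Adj x.1 x.2 <;> simp [this, hG]

/-- A hinge removes one edge and adds another, each of total weight 0 or 1. -/
lemma IsTour.abs_change_pre_succ (hl : IsTour S τ l)
    (h : Alternating S (fun y => G.Adj y.1 y.2) τ) {ω : V × V → ℤ}
    (hω : ∀ y, ω y + ω y.swap = 0 ∨ ω y + ω y.swap = 1) {a : ℕ} (ha : 2 * a < l.length) :
    |change G ω (pre l (a + 1)) - change G ω (pre l a)| ≤ 1 := by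
  obtain ⟨x, hx⟩ := hl.exists_hinge ha
  rw [change_pre_succ hx, add_sub_cancel_left]
  have h1 := h.adj_next ((hl.mem_or x).2 (Or.inl hx.mem))
  have h2 := hω x
  have h3 := hω (τ x.swap)
  rw [abs_le]
  by_cases hG : G.Adj x.1 x.2 <;> simp only [h1, hG, not_true, not_false_eq_true, if_true,
    if_false] <;> omega

/-- Flipping the edges in `X` changes the degrees only where the circuits leave `X`. -/
lemma Alternating.sum_abs_change_le (h : Alternating S (fun y => G.Adj y.1 y.2) τ)
    {X : SimpleGraph V} (hX : X ≤ S) :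
    (open Classical in ∑ v, |change G (fun y => if y.1 = v then 1 else 0) X|) ≤ cross τ X := by
  classical
  have hv : ∀ v, |change G (fun y => if y.1 = v then 1 else 0) X| ≤
      ((Finset.univ.filter fun y : V × V =>
        (X.Adj y.1 y.2 ∧ ¬ X.Adj (τ y).1 (τ y).2) ∧ y.1 = v).card : ℤ) := by
    intro v
    let f : V × V → ℤ := fun y => (if y.1 = v then 1 else 0) * if G.Adj y.1 y.2 then -1 else 1
    -- Darts of `X` whose `τ`-partner is also in `X` cancel in pairs, as the partner leaves the same
    -- vertex with the other colour.
    have hz : ∑ y ∈ (Finset.univ.filter fun y : V × V => X.Adj y.1 y.2).filter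
        (fun y => X.Adj (τ y).1 (τ y).2), f y = 0 := by
      refine Finset.sum_involution (fun y _ => τ y) ?_ ?_ ?_ ?_
      · intro y hy
        have hy1 : X.Adj y.1 y.2 := by simp at hy; exact hy.1
        have halt := h.alt y (hX hy1)
        simp only [f, h.fst y]
        rw [h.fst y] at halt
        by_cases hG : G.Adj y.1 y.2 <;> simp [halt, hG]
      · intro y hy _ he
        have hy1 : X.Adj y.1 y.2 := by simp at hy; exact hy.1
        have halt := h.alt y (hX hy1)
        rw [he] at halt
        tauto
      · intro y hy
        simp only [Finset.mem_filter, Finset.mem_univ, true_and] at hy ⊢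
        rw [h.invol]
        exact hy.symm
      · intro y _
        exact h.invol y
    have hsplit := Finset.sum_filter_add_sum_filter_not
      (Finset.univ.filter fun y : V × V => X.Adj y.1 y.2) (fun y => X.Adj (τ y).1 (τ y).2) f
    rw [hz, zero_add] at hsplit
    have : change G (fun y => if y.1 = v then 1 else 0) X = ∑ y : V × V with X.Adj y.1 y.2, f y := by
      simp only [change, f]
    rw [this, ← hsplit]
    refine (Finset.abs_sum_le_sum_abs _ _).trans ?_
    have habs : ∀ y, |f y| = if y.1 = v then 1 else 0 := by
      intro y
      simp only [f]
      split_ifs <;> simp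
    simp only [habs]
    rw [Finset.sum_boole]
    refine le_of_eq ?_
    congr 2
    ext y
    simp
  -- Reversing the dart turns a pair separated by `τ` into an exit along `next`.
  have hsum : ∑ v, ((Finset.univ.filter fun y : V × V =>
        (X.Adj y.1 y.2 ∧ ¬ X.Adj (τ y).1 (τ y).2) ∧ y.1 = v).card) = cross τ X := by
    have hfib := Finset.card_eq_sum_card_fiberwise (f := Prod.fst) (t := Finset.univ)
      (s := Finset.univ.filter fun y : V × V => X.Adj y.1 y.2 ∧ ¬ X.Adj (τ y).1 (τ y).2)
      (fun _ _ => Finset.mem_coe.2 (Finset.mem_univ _))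
    simp only [Finset.filter_filter] at hfib
    rw [← hfib, cross]
    refine Finset.card_bijective Prod.swap Prod.swap_bijective ?_
    intro y
    rw [Finset.mem_filter, Finset.mem_filter]
    simp only [Finset.mem_univ, true_and, next_apply, Prod.swap_swap, Prod.fst_swap, Prod.snd_swap,
      X.adj_comm y.2 y.1]
  rw [← hsum]
  push_cast
  refine le_trans (le_of_eq ?_) (Finset.sum_le_sum fun v _ => hv v)
  congr!

end Weights

end Circuit

/-! ## The hinge flip chain -/

namespace TwoClassPAM

open MarkovChain

variable (I : TwoClassPAM)

lemma n_pos : 0 < I.n := by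
  have h : 0 < I.V₁.card * I.V₁ᶜ.card := lt_of_le_of_lt (Nat.zero_le _) I.γ_lt
  obtain ⟨v, -⟩ := Finset.card_pos.1 (Nat.pos_of_mul_pos_right h)
  exact lt_of_le_of_lt (Nat.zero_le _) v.2

variable {I}

lemma flip_adj (G : SimpleGraph (Fin I.n)) (i j k u v : Fin I.n) :
    (I.flip G i j k).Adj u v ↔
      (G.Adj u v ∧ s(u, v) ≠ s(i, j)) ∨ (s(u, v) = s(j, k) ∧ u ≠ v) := by
  rw [flip, SimpleGraph.sup_adj, SimpleGraph.deleteEdges_adj, SimpleGraph.edge_adj,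
    Set.mem_singleton_iff, Sym2.eq_iff (x := u) (y := v) (z := j) (w := k)]

lemma flip_flip {G : SimpleGraph (Fin I.n)} {i j k : Fin I.n} (h1 : G.Adj i j) (h2 : ¬ G.Adj j k) :
    I.flip (I.flip G i j k) k j i = G := by
  ext u v
  rw [flip_adj, flip_adj]
  have e1 : s(u, v) = s(i, j) → G.Adj u v := fun h => by
    rw [← SimpleGraph.mem_edgeSet, h]; exact h1
  have e2 : s(u, v) = s(j, k) → ¬ G.Adj u v := fun h => by
    rw [← SimpleGraph.mem_edgeSet, h]; exact h2
  have e3 := fun h : G.Adj u v => h.ne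
  rw [Sym2.eq_swap (a := k), Sym2.eq_swap (a := j) (b := i)]
  tauto

lemma CanFlip.reverse {G H : I.State} {i j k : Fin I.n} (h : I.CanFlip G i j k)
    (hH : I.flip G.1 i j k = H.1) : I.CanFlip H k j i ∧ I.flip H.1 k j i = G.1 := by
  obtain ⟨h1, h2, h3, h4⟩ := h
  have hik : i ≠ k := by
    rintro rfl; exact h3 h1.symm
  have hff := flip_flip h1 h3
  rw [hH] at hff
  refine ⟨⟨?_, h1.ne.symm, ?_, ?_⟩, hff⟩
  · rw [← hH, flip_adj]
    exact Or.inr ⟨Sym2.eq_swap, h2.symm⟩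
  · rw [← hH, flip_adj, Sym2.eq_swap]
    rintro (⟨-, h⟩ | ⟨h, -⟩)
    · exact h rfl
    · rw [Sym2.eq_iff] at h
      rcases h with ⟨h, -⟩ | ⟨h, -⟩
      · exact h1.ne h
      · exact hik h
  · rw [hff]; exact G.2

lemma move_eq_iff {G H : I.State} (hGH : G ≠ H) (t : Fin I.n × Fin I.n × Fin I.n) :
    I.move G t = H ↔ I.CanFlip G t.1 t.2.1 t.2.2 ∧ I.flip G.1 t.1 t.2.1 t.2.2 = H.1 := by
  classical
  rw [move]
  split_ifs with h
  · simp only [h, true_and]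
    exact Subtype.ext_iff
  · simp [h, hGH]

lemma card_move_comm {G H : I.State} (hGH : G ≠ H) :
    (open Classical in (Finset.univ.filter fun t => I.move G t = H).card) =
      (open Classical in (Finset.univ.filter fun t => I.move H t = G).card) := by
  classical
  refine Finset.card_bij' (fun t _ => (t.2.2, t.2.1, t.1)) (fun t _ => (t.2.2, t.2.1, t.1))
    ?_ ?_ (fun _ _ => rfl) (fun _ _ => rfl)
  · intro t ht
    rw [Finset.mem_filter, move_eq_iff hGH] at ht
    rw [Finset.mem_filter, move_eq_iff hGH.symm]
    exact ⟨Finset.mem_univ _, ht.2.1.reverse ht.2.2⟩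
  · intro t ht
    rw [Finset.mem_filter, move_eq_iff hGH.symm] at ht
    rw [Finset.mem_filter, move_eq_iff hGH]
    exact ⟨Finset.mem_univ _, ht.2.1.reverse ht.2.2⟩

lemma lazySymm : LazySymm I.hingeFlipChain where
  symm G H := by
    classical
    by_cases h : G = H
    · rw [h]
    · rw [hingeFlipChain, hingeFlipChain, if_neg h, if_neg (Ne.symm h)]
      congr 4
      exact card_move_comm h
  nonneg G H := by
    rw [hingeFlipChain]
    split_ifs <;> positivity
  row_sum G := by
    classical
    have hn : (0 : ℝ) < I.n := by exact_mod_cast I.n_pos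
    have h := Finset.card_eq_sum_card_fiberwise (f := fun t => I.move G t) (t := Finset.univ)
      (s := Finset.univ) (fun _ _ => Finset.mem_coe.2 (Finset.mem_univ _))
    have hc : (Finset.univ : Finset (Fin I.n × Fin I.n × Fin I.n)).card = I.n ^ 3 := by
      simp only [Finset.card_univ, Fintype.card_prod, Fintype.card_fin]; ring
    rw [hc] at h
    simp only [hingeFlipChain, Finset.sum_add_distrib, ← Finset.mul_sum, ← Finset.sum_div]
    have h' : (∑ H, ((Finset.univ.filter fun t => I.move G t = H).card : ℝ)) = (I.n : ℝ) ^ 3 := by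
      exact_mod_cast h.symm
    have h'' : ∑ H : I.State, (if G = H then (1 : ℝ) else 0) = 1 := by simp
    have h3 : (∑ H, ((open Classical in
        (Finset.univ.filter fun t => I.move G t = H).card : ℕ) : ℝ)) = (I.n : ℝ) ^ 3 := by
      rw [← h']
    rw [h3, div_self (by positivity)]
    refine Eq.trans ?_ (show (1 / 2 : ℝ) * 1 + 1 / 2 * 1 = 1 by norm_num)
    congr 1
    congr 1
  half_le G := by
    rw [hingeFlipChain, if_pos rfl]
    have : 0 ≤ (1 / 2 : ℝ) * (((open Classical in
      Finset.univ.filter fun t => I.move G t = G).card : ℝ) / (I.n : ℝ) ^ 3) := by positivity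
    linarith

lemma arc_iff {G H : I.State} : Arc I.hingeFlipChain G H ↔ G ≠ H ∧ ∃ t, I.move G t = H := by
  classical
  refine and_congr_right fun hGH => ?_
  have hn : (0 : ℝ) < I.n := by exact_mod_cast I.n_pos
  rw [hingeFlipChain, if_neg hGH]
  constructor
  · intro h
    by_contra hc
    push Not at hc
    rw [Finset.filter_false_of_mem fun t _ => hc t] at h
    simp at h
  · rintro ⟨t, ht⟩
    have : 0 < (Finset.univ.filter fun t => I.move G t = H).card :=
      Finset.card_pos.2 ⟨t, Finset.mem_filter.2 ⟨Finset.mem_univ _, ht⟩⟩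
    have : (0 : ℝ) < (Finset.univ.filter fun t => I.move G t = H).card := by exact_mod_cast this
    rw [mul_zero, zero_add]
    refine mul_pos (by norm_num) (div_pos ?_ (by positivity))
    convert this

lemma one_div_le_of_arc {G H : I.State} (h : Arc I.hingeFlipChain G H) :
    1 / I.hingeFlipChain G H ≤ 2 * (I.n : ℝ) ^ 3 := by
  classical
  have hn : (0 : ℝ) < I.n := by exact_mod_cast I.n_pos
  obtain ⟨hGH, t, ht⟩ := arc_iff.1 h
  have h1 : 1 ≤ (Finset.univ.filter fun t => I.move G t = H).card :=
    Finset.card_pos.2 ⟨t, Finset.mem_filter.2 ⟨Finset.mem_univ _, ht⟩⟩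
  have h2 : (1 : ℝ) ≤ (Finset.univ.filter fun t => I.move G t = H).card := by exact_mod_cast h1
  rw [div_le_iff₀ h.2, hingeFlipChain, if_neg hGH, mul_zero, zero_add]
  have h3 : 2 * (I.n : ℝ) ^ 3 * (1 / 2 * (((open Classical in
      Finset.univ.filter fun t => I.move G t = H).card : ℝ) / (I.n : ℝ) ^ 3)) =
      ((open Classical in Finset.univ.filter fun t => I.move G t = H).card : ℝ) := by
    field_simp
  rw [h3]
  convert h2

lemma arc_symm {G H : I.State} (h : Arc I.hingeFlipChain G H) : Arc I.hingeFlipChain H G :=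
  ⟨h.1.symm, by rw [lazySymm.symm]; exact h.2⟩

lemma arc_of_flip {G H : I.State} {i j k : Fin I.n} (h1 : G.1.Adj i j) (h2 : j ≠ k)
    (h3 : ¬ G.1.Adj j k) (h : I.flip G.1 i j k = H.1) : Arc I.hingeFlipChain G H := by
  have hik : i ≠ k := by
    rintro rfl; exact h3 h1.symm
  have hGH : G ≠ H := by
    rintro rfl
    apply h3
    rw [← h, flip_adj]
    exact Or.inr ⟨rfl, h2⟩
  refine arc_iff.2 ⟨hGH, (i, j, k), (move_eq_iff hGH _).2 ⟨⟨h1, h2, h3, ?_⟩, h⟩⟩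
  rw [h]; exact H.2

/-- The states within a given distance of a state. -/
lemma card_withinDist_le (r : ℕ) (G : I.State) :
    (open Classical in Finset.univ.filter fun H => WithinDist I.hingeFlipChain r G H).card ≤
      (I.n ^ 3 + 1) ^ r := by
  classical
  induction r generalizing G with
  | zero =>
    rw [pow_zero, Finset.card_le_one]
    have : ∀ H ∈ (Finset.univ.filter fun H => WithinDist I.hingeFlipChain 0 G H), H = G := by
      intro H hH
      obtain ⟨l, h1, h2, -, h4⟩ := (Finset.mem_filter.1 hH).2
      match l, h1, h2, h4 with
      | [a], h1, h2, _ =>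
        simp only [List.head?_cons, List.getLast?_singleton, Option.some.injEq] at h1 h2
        exact h2.symm.trans h1
    intro A hA B hB
    rw [this A hA, this B hB]
  | succ r ih =>
    let f : Option (Fin I.n × Fin I.n × Fin I.n) → I.State := fun t => t.elim G (I.move G)
    have hsub : (Finset.univ.filter fun H => WithinDist I.hingeFlipChain (r + 1) G H) ⊆
        Finset.univ.biUnion fun t => Finset.univ.filter fun H =>
          WithinDist I.hingeFlipChain r (f t) H := by
      intro H hH
      obtain ⟨l, h1, h2, h3, h4⟩ := (Finset.mem_filter.1 hH).2
      simp only [Finset.mem_biUnion, Finset.mem_univ, true_and, Finset.mem_filter]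
      match l, h1, h2, h3, h4 with
      | [a], h1, h2, _, _ =>
        simp only [List.head?_cons, Option.some.injEq] at h1
        subst h1
        exact ⟨none, [a], rfl, h2, List.isChain_singleton _, by simp⟩
      | a :: b :: l, h1, h2, h3, h4 =>
        simp only [List.head?_cons, Option.some.injEq] at h1
        subst h1
        rw [List.isChain_cons_cons] at h3
        obtain ⟨-, t, ht⟩ := arc_iff.1 h3.1
        refine ⟨some t, b :: l, ?_, ?_, h3.2, ?_⟩
        · simp [f, ht]
        · rwa [List.getLast?_cons_cons] at h2
        · simp only [List.length_cons] at h4 ⊢; omega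
    refine (Finset.card_le_card hsub).trans (Finset.card_biUnion_le.trans ?_)
    refine (Finset.sum_le_sum fun t _ => ih (f t)).trans ?_
    rw [Finset.sum_const, smul_eq_mul, Finset.card_univ, Fintype.card_option]
    simp only [Fintype.card_prod, Fintype.card_fin]
    exact le_of_eq (by ring)

lemma WithinDist.symm {r : ℕ} {G H : I.State} (h : WithinDist I.hingeFlipChain r G H) :
    WithinDist I.hingeFlipChain r H G := by
  obtain ⟨l, h1, h2, h3, h4⟩ := h
  refine ⟨l.reverse, by rwa [List.head?_reverse], by rwa [List.getLast?_reverse], ?_, by simpa⟩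
  rw [List.isChain_reverse]
  exact h3.imp fun _ _ h => arc_symm h

end TwoClassPAM

/-! ### Canonical paths between two realizations -/

namespace TwoClassPAM

open MarkovChain Circuit

variable {I : TwoClassPAM}

/-- Darts from the first class to the second. -/
def cutWeight (I : TwoClassPAM) (y : Fin I.n × Fin I.n) : ℤ :=
  if y.1 ∈ I.V₁ ∧ y.2 ∈ I.V₁ᶜ then 1 else 0

lemma cutWeight_add_swap (y : Fin I.n × Fin I.n) :
    I.cutWeight y + I.cutWeight y.swap = 0 ∨ I.cutWeight y + I.cutWeight y.swap = 1 := by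
  by_cases h1 : y.1 ∈ I.V₁ <;> by_cases h2 : y.2 ∈ I.V₁ <;> simp [cutWeight, h1, h2]

lemma deg_eq_sum (G : SimpleGraph (Fin I.n)) (v : Fin I.n) :
    (I.deg G v : ℤ) = (open Classical in
      ∑ y : Fin I.n × Fin I.n with G.Adj y.1 y.2, if y.1 = v then 1 else 0) := by
  classical
  rw [deg, Finset.sum_filter, Fintype.sum_prod_type, Finset.sum_eq_single v]
  · simp only [if_true, Finset.sum_boole]
    rw [SimpleGraph.degree, SimpleGraph.neighborFinset_eq_filter]
  · intro u _ hu
    simp [hu]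
  · simp

lemma cut_eq_sum (G : SimpleGraph (Fin I.n)) :
    (I.cut G : ℤ) = (open Classical in
      ∑ y : Fin I.n × Fin I.n with G.Adj y.1 y.2, I.cutWeight y) := by
  classical
  rw [cut, SimpleGraph.interedges_def]
  simp only [cutWeight]
  rw [Finset.sum_boole, Finset.filter_filter]
  congr 2
  ext y
  simp only [Finset.mem_filter, Finset.mem_product, Finset.mem_univ, true_and]
  tauto

lemma isState_symmDiff {G X : SimpleGraph (Fin I.n)} (hG : I.IsRealization G)
    (h1 : change G 1 X = 0)
    (h2 : ∑ v, |change G (fun y => if y.1 = v then 1 else 0) X| ≤ 4)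
    (h3 : |change G I.cutWeight X| ≤ 1) : I.IsState (G ∆ X) := by
  classical
  have hdeg : ∀ v, (I.d v : ℤ) - I.deg (G ∆ X) v =
      - change G (fun y => if y.1 = v then 1 else 0) X := by
    intro v
    rw [deg_eq_sum, sum_symmDiff, ← deg_eq_sum, hG.1 v]
    ring
  have hcut : (I.cut (G ∆ X) : ℤ) = I.γ + change G I.cutWeight X := by
    rw [cut_eq_sum, sum_symmDiff, ← cut_eq_sum, hG.2]
  have hsum : ∑ v, change G (fun y => if y.1 = v then 1 else 0) X = 0 := by
    refine Eq.trans ?_ h1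
    simp only [change]
    rw [Finset.sum_comm]
    refine Finset.sum_congr rfl fun y _ => ?_
    rw [← Finset.sum_mul]
    simp
  refine ⟨?_, ?_, ?_⟩
  · simp only [hdeg, Finset.sum_neg_distrib, hsum, neg_zero]
  · simp only [hdeg, abs_neg]
    have h0 : 0 ≤ ∑ v, |change G (fun y => if y.1 = v then 1 else 0) X| :=
      Finset.sum_nonneg fun _ _ => abs_nonneg _
    -- The signed deviations sum to zero, and |x| + x is always even; so the total, being at most 4,
    -- is 0, 2 or 4.
    have heven : Even (∑ v, |change G (fun y => if y.1 = v then 1 else 0) X|) := by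
      have : ∑ v, |change G (fun y => if y.1 = v then 1 else 0) X| =
          ∑ v, (|change G (fun y => if y.1 = v then 1 else 0) X| +
            change G (fun y => if y.1 = v then 1 else 0) X) := by
        rw [Finset.sum_add_distrib, hsum, add_zero]
      rw [this]
      refine Finset.even_sum _ fun v _ => ?_
      rcases abs_choice (change G (fun y => if y.1 = v then 1 else 0) X) with h | h
      · rw [h]; exact ⟨_, rfl⟩
      · rw [h]; simp
    obtain ⟨m, hm⟩ := heven
    simp only [Set.mem_insert_iff, Set.mem_singleton_iff]
    omega
  · rw [hcut]
    rw [abs_le] at h3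
    simp only [Set.mem_insert_iff, Set.mem_singleton_iff]
    omega

/-- A tour of the circuits in `S` determined by `τ`. -/
noncomputable def tour {V : Type*} (S : SimpleGraph V) (τ : Equiv.Perm (V × V)) : List (V × V) :=
  open Classical in if h : ∃ l, IsTour S τ l then h.choose else []

lemma isTour_tour {V : Type*} [Finite V] {S G : SimpleGraph V} {τ : Equiv.Perm (V × V)}
    (h : Alternating S (fun y => G.Adj y.1 y.2) τ) : IsTour S τ (tour S τ) := by
  have hex := exists_tour h fun y => G.adj_comm _ _
  rw [tour, dif_pos hex]
  exact hex.choose_spec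

/-- The states visited on the way from `G` to `H`. -/
noncomputable def visited (G H : I.State) (τ : Equiv.Perm (Fin I.n × Fin I.n)) :
    Finset I.State :=
  open Classical in Finset.univ.filter fun Z => ∃ a b : Fin (I.n ^ 2 + 1), ∃ β : Bool,
    Z.1 = G.1 ∆ seg (G.1 ∆ H.1) (tour (G.1 ∆ H.1) τ) a b β

section Path

variable {G H : I.State} {τ : Equiv.Perm (Fin I.n × Fin I.n)}

/-- The degree conditions hold for any two positions, by the crossing bound; only the cut needs
nearly equal heights. -/
lemma abs_change_seg_le (hG : I.IsRealization G.1) (hH : I.IsRealization H.1)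
    (h : Alternating (G.1 ∆ H.1) (fun y => G.1.Adj y.1 y.2) τ) {a b : ℕ} {β : Prop}
    (ha : 2 * a ≤ (tour (G.1 ∆ H.1) τ).length) (hb : 2 * b ≤ (tour (G.1 ∆ H.1) τ).length)
    (hab : |change G.1 I.cutWeight (pre (tour (G.1 ∆ H.1) τ) a) -
      change G.1 I.cutWeight (pre (tour (G.1 ∆ H.1) τ) b)| ≤ 1) :
    I.IsState (G.1 ∆ seg (G.1 ∆ H.1) (tour (G.1 ∆ H.1) τ) a b β) := by
  classical
  have hl := isTour_tour h
  have hGS : G.1 ∆ (G.1 ∆ H.1) = H.1 := symmDiff_symmDiff_cancel_left _ _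
  have hcutS : change G.1 I.cutWeight (G.1 ∆ H.1) = 0 := by
    have h1 := sum_symmDiff G.1 I.cutWeight (G.1 ∆ H.1)
    rw [hGS, ← cut_eq_sum, ← cut_eq_sum, hG.2, hH.2] at h1
    linarith
  obtain ⟨N, hN⟩ := hl.even
  have honeS : change G.1 1 (G.1 ∆ H.1) = 0 := by
    have h1 := hl.change_one_pre h (a := N) (by omega)
    rwa [hl.pre_top (by omega)] at h1
  refine isState_symmDiff hG ?_ ?_ ?_
  · rw [← abs_eq_zero, hl.abs_change_seg honeS, hl.change_one_pre h ha,
      hl.change_one_pre h hb]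
    simp
  · refine le_trans ?_ ((h.sum_abs_change_le (hl.seg_le a b β)).trans
      (by exact_mod_cast hl.cross_seg_le h a b β))
    refine le_of_eq (Finset.sum_congr rfl fun v _ => ?_)
    congr!
  · rw [hl.abs_change_seg hcutS]
    exact hab

lemma flip_iff {Z A B C : Prop} (e1 : A → Z) (e2 : B → ¬ Z ∧ C) :
    (Z ∧ ¬ A) ∨ (B ∧ C) ↔ (Z ↔ ¬ (A ∨ B)) := by
  by_cases A <;> by_cases B <;> by_cases Z <;> simp_all

lemma advance_iff {g a a' b s β k : Prop} (h1 : a' ↔ a ∨ k) (h2 : k → ¬ a) :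
    (g ↔ ¬ ((a' ↔ ¬ b) ↔ ¬ (β ∧ s))) ↔ ((g ↔ ¬ ((a ↔ ¬ b) ↔ ¬ (β ∧ s))) ↔ ¬ k) := by
  by_cases a <;> by_cases k <;> by_cases b <;> by_cases β <;> by_cases s <;> by_cases g <;> simp_all

/-- Propositional core of passing the end of the tour: the full segment `S` is replaced by the empty
one, and negating `β` compensates, so again only the hinge `k` is toggled. -/
lemma wrap_iff {g a b s β k : Prop} (h1 : s ↔ a ∨ k) (h2 : k → ¬ a) :
    (g ↔ ¬ ((False ↔ ¬ b) ↔ ¬ (¬ β ∧ s))) ↔ ((g ↔ ¬ ((a ↔ ¬ b) ↔ ¬ (β ∧ s))) ↔ ¬ k) := by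
  by_cases a <;> by_cases k <;> by_cases b <;> by_cases β <;> by_cases s <;> by_cases g <;> simp_all

/-- A segment contains both edges of the hinge or neither, so exactly one of them is present in `Z`,
as in `G`. They meet in a vertex, and toggling both is a hinge flip whose direction depends on which
one is present. -/
lemma arc_of_hinge (h : Alternating (G.1 ∆ H.1) (fun y => G.1.Adj y.1 y.2) τ)
    {Z Z' : I.State} {a b₁ b₂ : ℕ} {β : Prop} {x : Fin I.n × Fin I.n}
    (hx : IsHinge (G.1 ∆ H.1) (tour (G.1 ∆ H.1) τ) a x (τ x.swap))
    (hZ : Z.1 = G.1 ∆ seg (G.1 ∆ H.1) (tour (G.1 ∆ H.1) τ) b₁ b₂ β)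
    (hZ' : ∀ y : Fin I.n × Fin I.n, Z'.1.Adj y.1 y.2 ↔ (Z.1.Adj y.1 y.2 ↔
      ¬ (y = x ∨ y = x.swap ∨ y = τ x.swap ∨ y = (τ x.swap).swap))) :
    Arc I.hingeFlipChain Z Z' := by
  have hl := isTour_tour h
  have hseg := hl.seg_hinge hx b₁ b₂ β
  have hxS := (hl.mem_or x).2 (Or.inl hx.mem)
  have hnext := h.adj_next hxS
  have hxS' := h.adj x.swap hxS.symm
  have hfst := h.fst x.swap
  have hZx : Z.1.Adj (τ x.swap).1 (τ x.swap).2 ↔ ¬ Z.1.Adj x.1 x.2 := by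
    rw [hZ, symmDiff_adj, symmDiff_adj]
    tauto
  obtain ⟨u, v⟩ := x
  set x' := τ (Prod.swap (u, v)) with hx'
  obtain ⟨v', w⟩ := x'
  simp only [Prod.swap_prod_mk] at hfst
  subst hfst
  simp only [Prod.swap_prod_mk] at hZ' hZx hxS hxS'
  have key : ∀ p q, Z'.1.Adj p q ↔ (Z.1.Adj p q ↔ ¬ (s(p, q) = s(u, v') ∨ s(p, q) = s(v', w))) := by
    intro p q
    refine (hZ' (p, q)).trans ?_
    simp only [Prod.mk.injEq, Sym2.eq_iff, or_assoc]
  by_cases hZu : Z.1.Adj u v'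
  · have hw : ¬ Z.1.Adj v' w := by tauto
    refine arc_of_flip hZu hxS'.ne hw ?_
    ext p q
    rw [flip_adj, key]
    have e1 : s(p, q) = s(u, v') → Z.1.Adj p q := fun h => by
      rw [← SimpleGraph.mem_edgeSet, h]; exact hZu
    have e2 : s(p, q) = s(v', w) → ¬ Z.1.Adj p q ∧ p ≠ q := fun h => by
      refine ⟨by rw [← SimpleGraph.mem_edgeSet, h]; exact hw, ?_⟩
      have : (G.1 ∆ H.1).Adj p q := by
        rw [← SimpleGraph.mem_edgeSet, h]; exact hxS'
      exact this.ne
    exact flip_iff e1 e2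
  · have hw : Z.1.Adj v' w := by tauto
    refine arc_of_flip hw.symm hxS.ne.symm (fun h => hZu h.symm) ?_
    ext p q
    rw [flip_adj, key, Sym2.eq_swap (a := w), Sym2.eq_swap (a := v') (b := u)]
    have e1 : s(p, q) = s(v', w) → Z.1.Adj p q := fun h => by
      rw [← SimpleGraph.mem_edgeSet, h]; exact hw
    have e2 : s(p, q) = s(u, v') → ¬ Z.1.Adj p q ∧ p ≠ q := fun h => by
      refine ⟨by rw [← SimpleGraph.mem_edgeSet, h]; exact hZu, ?_⟩
      have : (G.1 ∆ H.1).Adj p q := by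
        rw [← SimpleGraph.mem_edgeSet, h]; exact hxS
      exact this.ne
    rw [or_comm (a := s(p, q) = s(u, v'))]
    exact flip_iff e1 e2

lemma seg_comm {V : Type*} (S : SimpleGraph V) (l : List (V × V)) (a b : ℕ) (β : Prop) :
    seg S l a b β = seg S l b a β := by
  rw [seg, seg, symmDiff_comm (pre l a)]

/-- The graph on the canonical path at which the two climbers are at positions `s` and `t` of the
cyclic tour `l`, which consists of `N` hinges. -/
noncomputable def pathGraph {V : Type*} (G S : SimpleGraph V) (l : List (V × V)) (N s t : ℤ) :
    SimpleGraph V :=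
  G ∆ seg S l (s % N).toNat (t % N).toNat (Odd (s / N + t / N))

lemma pathGraph_comm {V : Type*} (G S : SimpleGraph V) (l : List (V × V)) (N s t : ℤ) :
    pathGraph G S l N s t = pathGraph G S l N t s := by
  rw [pathGraph, pathGraph, seg_comm, add_comm]

/-- The hinge depends only on `s`. Inside the tour the initial segment grows by it; at the end the
remainder returns to 0 and the parity of the quotients changes. -/
lemma pathGraph_succ {V : Type*} {G S : SimpleGraph V} {τ : Equiv.Perm (V × V)}
    {l : List (V × V)} (hl : IsTour S τ l) {N : ℕ} (hN : 0 < N) (hlN : l.length = N + N) (s : ℤ) :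
    ∃ a x, IsHinge S l a x (τ x.swap) ∧ ∀ (t : ℤ) (y : V × V),
      (pathGraph G S l N (s + 1) t).Adj y.1 y.2 ↔ ((pathGraph G S l N s t).Adj y.1 y.2 ↔
        ¬ (y = x ∨ y = x.swap ∨ y = τ x.swap ∨ y = (τ x.swap).swap)) := by
  have hN' : (0 : ℤ) < N := by exact_mod_cast hN
  have hlt := Int.emod_lt_of_pos s hN'
  have hnn := Int.emod_nonneg s hN'.ne'
  obtain ⟨x, hx⟩ := hl.exists_hinge (a := (s % N).toNat) (by omega)
  refine ⟨_, x, hx, fun t y => ?_⟩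
  have h1 := hx.pre_succ y
  have h2 := hx.notMem y
  have hdm := Int.emod_add_mul_ediv s N
  simp only [pathGraph, symmDiff_adj, seg_adj]
  rcases (by omega : s % N + 1 < N ∨ s % N + 1 = N) with hc | hc
  · have e1 : (s + 1) % N = s % N + 1 := by
      rw [← Int.emod_add_emod, Int.emod_eq_of_lt (by omega) hc]
    have e2 : (s + 1) / N = s / N := by
      have : s + 1 = (s % N + 1) + N * (s / N) := by linarith
      rw [this, Int.add_mul_ediv_left _ _ hN'.ne', Int.ediv_eq_zero_of_lt (by omega) hc]
      simp
    have e3 : (s % N + 1).toNat = (s % N).toNat + 1 := by omega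
    rw [e1, e2, e3]
    exact advance_iff h1 h2
  · have e1 : (s + 1) % N = 0 := by
      rw [← Int.emod_add_emod, hc, Int.emod_self]
    have e2 : (s + 1) / N = s / N + 1 := by
      have : s + 1 = 0 + N * (s / N + 1) := by linarith
      rw [this, Int.add_mul_ediv_left _ _ hN'.ne']
      simp
    have e3 : (s % N).toNat + 1 = N := by omega
    rw [e3, hl.pre_top (by omega)] at h1
    have e4 : Odd (s / N + 1 + t / N) ↔ ¬ Odd (s / N + t / N) := by
      rw [add_right_comm, Int.odd_add]; simp
    rw [e1, e2, e4, Int.toNat_zero, pre_zero, SimpleGraph.bot_adj]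
    exact wrap_iff h1 h2

lemma pathGraph_self {V : Type*} (G S : SimpleGraph V) (l : List (V × V)) (N s : ℤ) :
    pathGraph G S l N s s = G := by
  ext u v
  have : ¬ Odd (s / N + s / N) := by rw [Int.not_odd_iff_even]; exact ⟨_, rfl⟩
  rw [pathGraph, symmDiff_adj, seg_adj]
  tauto

/-- The initial segments coincide and cancel, while the quotients have odd sum, so all of `S` is
flipped. -/
lemma pathGraph_add_self {V : Type*} (G S : SimpleGraph V) (l : List (V × V)) {N : ℤ} (hN : 0 < N)
    (s : ℤ) : pathGraph G S l N s (s + N) = G ∆ S := by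
  ext u v
  have h1 : (s + N) / N = s / N + 1 := Int.add_ediv_of_dvd_right (dvd_refl N) |>.trans
    (by rw [Int.ediv_self hN.ne'])
  have : Odd (s / N + (s / N + 1)) := ⟨s / N, by ring⟩
  rw [pathGraph, Int.add_emod_right, h1, symmDiff_adj, symmDiff_adj, seg_adj]
  tauto

theorem reflTransGen_visited (hG : I.IsRealization G.1) (hH : I.IsRealization H.1)
    (h : Alternating (G.1 ∆ H.1) (fun y => G.1.Adj y.1 y.2) τ) :
    Relation.ReflTransGen (fun u v => Arc I.hingeFlipChain u v ∧ u ∈ visited G H τ) G H ∧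
      G ∈ visited G H τ ∧ H ∈ visited G H τ := by
  classical
  set S := G.1 ∆ H.1 with hS
  set l := tour S τ with hldef
  have hl : IsTour S τ l := isTour_tour h
  have hGS : G.1 ∆ S = H.1 := symmDiff_symmDiff_cancel_left _ _
  obtain ⟨N, hN⟩ := hl.even
  have hlen : l.length ≤ I.n ^ 2 := by
    have := hl.nodup.length_le_card
    simpa [sq] using this
  have hvis : ∀ (Z : I.State) (a b : ℕ) (β : Prop), 2 * a ≤ l.length → 2 * b ≤ l.length →
      Z.1 = G.1 ∆ seg S l a b β → Z ∈ visited G H τ := by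
    intro Z a b β ha hb hZ
    refine Finset.mem_filter.2 ⟨Finset.mem_univ _, ⟨a, by omega⟩, ⟨b, by omega⟩, decide β, ?_⟩
    simpa using hZ
  have hGv : G ∈ visited G H τ := by
    refine hvis G 0 0 False (by omega) (by omega) ?_
    ext u v
    rw [symmDiff_adj, seg_adj]
    tauto
  have hHv : H ∈ visited G H τ := by
    refine hvis H 0 0 True (by omega) (by omega) ?_
    ext u v
    rw [← hGS]
    refine (symmDiff_adj _ _ _ _).trans (Iff.trans ?_ (symmDiff_adj _ _ _ _).symm)
    rw [seg_adj]
    tauto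
  refine ⟨?_, hGv, hHv⟩
  -- An empty tour means G = H, and the mountain range would have period 0.
  rcases Nat.eq_zero_or_pos N with h0 | hNpos
  · have hlt := hl.pre_top (N := 0) (by omega)
    rw [pre_zero] at hlt
    rw [← hlt, symmDiff_bot] at hGS
    rw [Subtype.ext hGS]
  have hN' : (0 : ℤ) < N := by exact_mod_cast hNpos
  have hpos : ∀ s : ℤ, 2 * (s % N).toNat ≤ l.length := by
    intro s
    have := Int.emod_lt_of_pos s hN'
    omega
  -- The height is the drift of the cut. It closes up over one period because G and H have the same
  -- cut.
  let ht : ℤ → ℤ := fun s => change G.1 I.cutWeight (pre l (s % N).toNat)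
  have hbot : change G.1 I.cutWeight (pre l 0) = 0 := by simp [pre_zero, change]
  have htop : change G.1 I.cutWeight (pre l N) = 0 := by
    rw [hl.pre_top (by omega)]
    have h1 := sum_symmDiff G.1 I.cutWeight S
    rw [hGS, ← cut_eq_sum, ← cut_eq_sum, hG.2, hH.2] at h1
    linarith
  have hstate : ∀ s t : ℤ, |ht s - ht t| ≤ 1 → I.IsState (pathGraph G.1 S l N s t) :=
    fun s t hst => abs_change_seg_le hG hH h (hpos s) (hpos t) hst
  have hmem : ∀ (s t : ℤ) (Z : I.State), Z.1 = pathGraph G.1 S l N s t → Z ∈ visited G H τ :=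
    fun s t Z hZ => hvis Z _ _ _ (hpos s) (hpos t) hZ
  obtain ⟨M, r, hpath⟩ := Mountain.exists_rook_path (h := ht) hN'
    (fun i => by simp only [ht, Int.add_emod_right]) (by
      intro i
      have hlt := Int.emod_lt_of_pos i hN'
      have hnn := Int.emod_nonneg i hN'.ne'
      have hstep := hl.abs_change_pre_succ h cutWeight_add_swap (a := (i % N).toNat) (by omega)
      rcases (by omega : i % N + 1 < N ∨ i % N + 1 = N) with hc | hc
      · have e1 : (i + 1) % N = i % N + 1 := by
          rw [← Int.emod_add_emod, Int.emod_eq_of_lt (by omega) hc]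
        have e3 : (i % N + 1).toNat = (i % N).toNat + 1 := by omega
        simp only [ht]
        rw [e1, e3]
        exact hstep
      · have e1 : (i + 1) % N = 0 := by
          rw [← Int.emod_add_emod, hc, Int.emod_self]
        have e3 : (i % N).toNat + 1 = N := by omega
        simp only [ht]
        rw [e1, Int.toNat_zero, hbot]
        rwa [e3, htop] at hstep)
  -- one climber takes a step
  have hsucc : ∀ (s t : ℤ) (Z Z' : I.State), Z.1 = pathGraph G.1 S l N s t →
      Z'.1 = pathGraph G.1 S l N (s + 1) t → Arc I.hingeFlipChain Z Z' := by
    intro s t Z Z' hZ hZ'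
    obtain ⟨a, x, hx, hy⟩ := pathGraph_succ (G := G.1) hl hNpos hN s
    refine arc_of_hinge h hx hZ fun y => ?_
    rw [hZ, hZ']
    exact hy t y
  have hmove : ∀ (p q : ℤ × ℤ) (Z Z' : I.State), Mountain.Rook ht p q →
      Z.1 = pathGraph G.1 S l N p.1 p.2 → Z'.1 = pathGraph G.1 S l N q.1 q.2 →
      Arc I.hingeFlipChain Z Z' := by
    rintro ⟨p1, p2⟩ ⟨q1, q2⟩ Z Z' ⟨-, hpq⟩ hZ hZ'
    simp only at hpq hZ hZ'
    rcases hpq with ⟨rfl, rfl | rfl⟩ | ⟨rfl, rfl | rfl⟩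
    · exact hsucc _ _ Z Z' hZ hZ'
    · exact arc_symm (hsucc _ _ Z' Z hZ' (by rw [sub_add_cancel]; exact hZ))
    · rw [pathGraph_comm] at hZ hZ'
      exact hsucc _ _ Z Z' hZ hZ'
    · rw [pathGraph_comm] at hZ hZ'
      exact arc_symm (hsucc _ _ Z' Z hZ' (by rw [sub_add_cancel]; exact hZ))
  have hfin : ∀ q, Relation.ReflTransGen (Mountain.Rook ht) (M, M) q →
      ∃ Z : I.State, Z.1 = pathGraph G.1 S l N q.1 q.2 ∧
        Relation.ReflTransGen (fun u v => Arc I.hingeFlipChain u v ∧ u ∈ visited G H τ) G Z := by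
    intro q hq
    induction hq with
    | refl => exact ⟨G, (pathGraph_self _ _ _ _ _).symm, Relation.ReflTransGen.refl⟩
    | @tail p q _ hpq ih =>
      obtain ⟨Z, hZ, hr⟩ := ih
      exact ⟨⟨_, hstate _ _ hpq.1⟩, rfl, hr.tail ⟨hmove p q Z _ hpq hZ rfl, hmem _ _ Z hZ⟩⟩
  obtain ⟨Z, hZ, hr⟩ := hfin _ hpath
  have : Z = H := Subtype.ext (by rw [hZ, pathGraph_add_self _ _ _ hN', hGS])
  rw [this] at hr
  exact hr

lemma card_visited_le (G H : I.State) (τ : Equiv.Perm (Fin I.n × Fin I.n)) :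
    (visited G H τ).card ≤ (I.n ^ 2 + 1) * (I.n ^ 2 + 1) * 2 := by
  classical
  let f : Fin (I.n ^ 2 + 1) × Fin (I.n ^ 2 + 1) × Bool → SimpleGraph (Fin I.n) := fun t =>
    G.1 ∆ seg (G.1 ∆ H.1) (tour (G.1 ∆ H.1) τ) t.1 t.2.1 t.2.2
  have h1 : (visited G H τ).image Subtype.val ⊆ Finset.univ.image f := by
    intro Z hZ
    obtain ⟨W, hW, rfl⟩ := Finset.mem_image.1 hZ
    obtain ⟨a, b, β, h⟩ := (Finset.mem_filter.1 hW).2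
    exact Finset.mem_image.2 ⟨(a, b, β), Finset.mem_univ _, h.symm⟩
  rw [← Finset.card_image_of_injective _ Subtype.val_injective]
  refine (Finset.card_le_card h1).trans (Finset.card_image_le.trans (le_of_eq ?_))
  simp only [Finset.card_univ, Fintype.card_prod, Fintype.card_fin, Fintype.card_bool]
  ring

end Path

end TwoClassPAM

/-! ## Counting alternating pairings -/

namespace Circuit

section Counting

variable {V : Type*} [Fintype V]

/-- The set of all alternating pairings. -/
noncomputable def altSet (S : SimpleGraph V) (c : V × V → Prop) : Finset (Equiv.Perm (V × V)) :=
  (Set.toFinite {τ | Alternating S c τ}).toFinset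

lemma mem_altSet {S : SimpleGraph V} {c : V × V → Prop} {τ : Equiv.Perm (V × V)} :
    τ ∈ altSet S c ↔ Alternating S c τ := by
  simp [altSet]

/-- The number of darts of colour `c` leaving `v`. -/
noncomputable def dartCount (S : SimpleGraph V) (c : V × V → Prop) (v : V) : ℕ :=
  open Classical in
  (Finset.univ.filter fun y : V × V => (S.Adj y.1 y.2 ∧ y.1 = v) ∧ c y).card

lemma dartCount_add_not (S : SimpleGraph V) (c : V × V → Prop) (v : V) :
    dartCount S c v + dartCount S (fun y => ¬ c y) v = dartCount S (fun _ => True) v := by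
  classical
  have h := Finset.card_filter_add_card_filter_not
    (s := Finset.univ.filter fun y : V × V => S.Adj y.1 y.2 ∧ y.1 = v) (p := c)
  rw [Finset.filter_filter, Finset.filter_filter] at h
  simp only [dartCount, and_true]
  convert h

/-- Two colourings with the same numbers of darts of each colour differ by a permutation of the
darts leaving the individual vertices. -/
lemma exists_perm_of_dartCount_eq {S : SimpleGraph V} {c c' : V × V → Prop}
    (h : ∀ v, dartCount S c v = dartCount S c' v) :
    ∃ e : Equiv.Perm (V × V), (∀ y, S.Adj (e y).1 (e y).2 ↔ S.Adj y.1 y.2) ∧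
      (∀ y, ¬ S.Adj y.1 y.2 → e y = y) ∧ (∀ y, (e y).1 = y.1) ∧
      ∀ y, S.Adj y.1 y.2 → (c' (e y) ↔ c y) := by
  classical
  -- A dart of `S` is labelled by its vertex and colour, any other pair by itself. Fibres over equal
  -- labels have equal size for both colourings, and gluing bijections between them gives the
  -- permutation.
  let F : (V × V → Prop) → V × V → (V × Prop) ⊕ (V × V) := fun d y =>
    if S.Adj y.1 y.2 then Sum.inl (y.1, d y) else Sum.inr y
  have hF1 : ∀ (d : V × V → Prop) y, S.Adj y.1 y.2 → F d y = Sum.inl (y.1, d y) :=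
    fun d y hy => if_pos hy
  have hF2 : ∀ (d : V × V → Prop) y, ¬ S.Adj y.1 y.2 → F d y = Sum.inr y :=
    fun d y hy => if_neg hy
  have hnot : ∀ v, dartCount S (fun y => ¬ c y) v = dartCount S (fun y => ¬ c' y) v := by
    intro v
    have h1 := dartCount_add_not S c v
    have h2 := dartCount_add_not S c' v
    have h3 := h v
    omega
  have hfib : ∀ z, Nonempty ({y // F c y = z} ≃ {y // F c' y = z}) := by
    intro z
    refine ⟨Fintype.equivOfCardEq ?_⟩
    rw [Fintype.card_subtype, Fintype.card_subtype]
    rcases z with ⟨v, b⟩ | z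
    · have hset : ∀ d : V × V → Prop, (Finset.univ.filter fun y => F d y = Sum.inl (v, b)) =
          Finset.univ.filter fun y : V × V => (S.Adj y.1 y.2 ∧ y.1 = v) ∧ (d y ↔ b) := by
        intro d
        ext y
        simp only [Finset.mem_filter, Finset.mem_univ, true_and]
        by_cases hy : S.Adj y.1 y.2
        · rw [hF1 d y hy]; simp [hy]
        · rw [hF2 d y hy]; simp [hy]
      rw [hset, hset]
      by_cases hb : b
      · have := h v
        simp only [dartCount] at this
        simp only [hb, iff_true]
        convert this
      · have := hnot v
        simp only [dartCount] at this
        simp only [hb, iff_false]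
        convert this
    · congr 1
      ext y
      simp only [Finset.mem_filter, Finset.mem_univ, true_and]
      by_cases hy : S.Adj y.1 y.2
      · rw [hF1 c y hy, hF1 c' y hy]; simp
      · rw [hF2 c y hy, hF2 c' y hy]
  let φ := fun z => (hfib z).some
  have hmap : ∀ y, F c' (Equiv.ofFiberEquiv φ y) = F c y := fun y => Equiv.ofFiberEquiv_map _ _
  set e : Equiv.Perm (V × V) := Equiv.ofFiberEquiv φ with he
  have hadj : ∀ y, S.Adj (e y).1 (e y).2 ↔ S.Adj y.1 y.2 := by
    intro y
    have h1 := hmap y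
    by_cases hy : S.Adj y.1 y.2 <;> by_cases hy' : S.Adj (e y).1 (e y).2
    · exact iff_of_true hy' hy
    · rw [hF1 c y hy, hF2 c' _ hy'] at h1; cases h1
    · rw [hF2 c y hy, hF1 c' _ hy'] at h1; cases h1
    · exact iff_of_false hy' hy
  have hoff : ∀ y, ¬ S.Adj y.1 y.2 → e y = y := by
    intro y hy
    have h1 := hmap y
    rw [hF2 c y hy, hF2 c' _ (by rwa [hadj])] at h1
    exact Sum.inr.inj h1
  have hon : ∀ y, S.Adj y.1 y.2 → (e y).1 = y.1 ∧ (c' (e y) ↔ c y) := by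
    intro y hy
    have h1 := hmap y
    rw [hF1 c y hy, hF1 c' _ (by rwa [hadj])] at h1
    have h2 := Prod.mk.inj (Sum.inl.inj h1)
    exact ⟨h2.1, iff_of_eq h2.2⟩
  refine ⟨e, hadj, hoff, fun y => ?_, fun y hy => (hon y hy).2⟩
  by_cases hy : S.Adj y.1 y.2
  · exact (hon y hy).1
  · rw [hoff y hy]

lemma Alternating.dartCount_not {S : SimpleGraph V} {c : V × V → Prop} {τ : Equiv.Perm (V × V)}
    (h : Alternating S c τ) (v : V) : dartCount S (fun y => ¬ c y) v = dartCount S c v := by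
  classical
  suffices hs : (Finset.univ.filter fun y : V × V => (S.Adj y.1 y.2 ∧ y.1 = v) ∧ ¬ c y).card =
      (Finset.univ.filter fun y : V × V => (S.Adj y.1 y.2 ∧ y.1 = v) ∧ c y).card by
    simp only [dartCount]
    convert hs
  refine Finset.card_bijective τ τ.bijective fun y => ?_
  rw [Finset.mem_filter, Finset.mem_filter, h.fst]
  have h1 := h.adj y
  have h2 := h.alt y
  have h3 := h.adj (τ y)
  rw [h.invol] at h3
  rw [h.fst] at h1 h3
  simp only [Finset.mem_univ, true_and]
  tauto

/-- All colourings which admit alternating pairings admit the same number of them. -/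
lemma card_altSet_le {S : SimpleGraph V} {c c' : V × V → Prop} (hc : (altSet S c).Nonempty) :
    (altSet S c').card ≤ (altSet S c).card := by
  classical
  rcases (altSet S c').eq_empty_or_nonempty with h0 | ⟨τ', hτ'⟩
  · rw [h0]; simp
  obtain ⟨τ, hτ⟩ := hc
  have hcount : ∀ v, dartCount S c' v = dartCount S c v := by
    intro v
    have h1 := dartCount_add_not S c v
    have h2 := dartCount_add_not S c' v
    have h3 := (mem_altSet.1 hτ).dartCount_not v
    have h4 := (mem_altSet.1 hτ').dartCount_not v
    omega
  obtain ⟨e, e1, e2, e3, e4⟩ := exists_perm_of_dartCount_eq hcount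
  have e2' : ∀ y, ¬ S.Adj y.1 y.2 → e.symm y = y := fun y hy => by
    rw [Equiv.symm_apply_eq, e2 y hy]
  -- Conjugation by `e` carries alternating pairings of one colouring to those of the other.
  refine Finset.card_le_card_of_injOn (fun σ => (e.symm.trans σ).trans e) ?_ ?_
  · intro σ hσ
    have hσ := mem_altSet.1 (Finset.mem_coe.1 hσ)
    refine Finset.mem_coe.2 (mem_altSet.2 ⟨?_, ?_, ?_, ?_, ?_⟩)
    · intro y hy
      simp only [Equiv.trans_apply]
      rw [e2' y hy, hσ.off y hy, e2 y hy]
    · intro y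
      simp only [Equiv.trans_apply]
      rw [e3, hσ.fst, ← e3, Equiv.apply_symm_apply]
    · intro y
      simp [hσ.invol]
    · intro y hy
      simp only [Equiv.trans_apply]
      rw [e1]
      exact hσ.adj _ (by rwa [← e1, Equiv.apply_symm_apply])
    · intro y hy
      simp only [Equiv.trans_apply]
      have hy' : S.Adj (e.symm y).1 (e.symm y).2 := by rwa [← e1, Equiv.apply_symm_apply]
      rw [e4 _ (hσ.adj _ hy'), hσ.alt _ hy', ← e4 _ hy', Equiv.apply_symm_apply]
  · intro σ _ σ' _ h
    ext1 y
    have h1 := congrArg (fun f : Equiv.Perm (V × V) => e.symm (f (e y))) h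
    simpa using h1

/-- Equal counts give a permutation exchanging the colours at each vertex; using it on one colour
and its inverse on the other makes an involution. -/
lemma altSet_nonempty {S : SimpleGraph V} {c : V × V → Prop}
    (h : ∀ v, dartCount S c v = dartCount S (fun y => ¬ c y) v) : (altSet S c).Nonempty := by
  classical
  obtain ⟨e, e1, e2, e3, e4⟩ := exists_perm_of_dartCount_eq h
  have s1 : ∀ y, S.Adj (e.symm y).1 (e.symm y).2 ↔ S.Adj y.1 y.2 := fun y => by
    rw [← e1, Equiv.apply_symm_apply]
  have s2 : ∀ y, ¬ S.Adj y.1 y.2 → e.symm y = y := fun y hy => by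
    rw [Equiv.symm_apply_eq, e2 y hy]
  have s3 : ∀ y, (e.symm y).1 = y.1 := fun y => by rw [← e3, Equiv.apply_symm_apply]
  have s4 : ∀ y, S.Adj y.1 y.2 → (c (e.symm y) ↔ ¬ c y) := fun y hy => by
    rw [← e4 _ ((s1 y).2 hy), Equiv.apply_symm_apply]
  let f : V × V → V × V := fun y => if c y then e y else e.symm y
  have f1 : ∀ y, c y → f y = e y := fun y hy => if_pos hy
  have f2 : ∀ y, ¬ c y → f y = e.symm y := fun y hy => if_neg hy
  have hinv : Function.Involutive f := by
    intro y
    by_cases hS : S.Adj y.1 y.2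
    · by_cases hy : c y
      · rw [f1 y hy, f2 _ ((e4 y hS).2 hy), Equiv.symm_apply_apply]
      · rw [f2 y hy, f1 _ ((s4 y hS).2 hy), Equiv.apply_symm_apply]
    · have : f y = y := by
        by_cases hy : c y
        · rw [f1 y hy, e2 y hS]
        · rw [f2 y hy, s2 y hS]
      rw [this, this]
  refine ⟨hinv.toPerm, mem_altSet.2 ⟨?_, ?_, hinv, ?_, ?_⟩⟩
  · intro y hS
    change f y = y
    by_cases hy : c y
    · rw [f1 y hy, e2 y hS]
    · rw [f2 y hy, s2 y hS]
  · intro y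
    change (f y).1 = y.1
    by_cases hy : c y
    · rw [f1 y hy, e3]
    · rw [f2 y hy, s3]
  · intro y hS
    change S.Adj (f y).1 (f y).2
    by_cases hy : c y
    · rw [f1 y hy]; exact (e1 y).2 hS
    · rw [f2 y hy]; exact (s1 y).2 hS
  · intro y hS
    change c (f y) ↔ ¬ c y
    by_cases hy : c y
    · rw [f1 y hy]
      have := e4 y hS
      tauto
    · rw [f2 y hy, s4 y hS]

/-- The colouring obtained from the graph `Z` by changing the colours of the darts listed in `B`. -/
def recolour (Z : SimpleGraph V) (B : Fin 4 → Option (V × V)) (y : V × V) : Prop :=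
  Z.Adj y.1 y.2 ↔ ¬ ∃ i, B i = some y

lemma exists_enum {α : Type*} (B : Finset α) (hB : B.card ≤ 4) :
    ∃ f : Fin 4 → Option α, ∀ y, (∃ i, f i = some y) ↔ y ∈ B := by
  refine ⟨fun i => B.toList[(i : ℕ)]?, fun y => ?_⟩
  rw [← Finset.mem_toList, List.mem_iff_getElem?]
  constructor
  · rintro ⟨i, hi⟩; exact ⟨i, hi⟩
  · rintro ⟨i, hi⟩
    have := (List.getElem?_eq_some_iff.1 hi).1
    rw [Finset.length_toList] at this
    exact ⟨⟨i, by omega⟩, hi⟩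

/-- A pairing that alternates for `G` alternates for a recolouring of any graph on the canonical
path. -/
lemma Alternating.exists_recolour {S G X : SimpleGraph V} {τ : Equiv.Perm (V × V)}
    (h : Alternating S (fun y => G.Adj y.1 y.2) τ) (hX : cross τ X ≤ 4) :
    ∃ B, Alternating S (recolour (G ∆ X) B) τ := by
  classical
  -- Pairs that `X` does not separate keep opposite colours in `G ∆ X`; in a separated pair the
  -- colours agree, and recolouring the dart inside `X` repairs this.
  let B : Finset (V × V) := Finset.univ.filter fun y => X.Adj y.1 y.2 ∧ ¬ X.Adj (τ y).1 (τ y).2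
  have hmem : ∀ y, y ∈ B ↔ X.Adj y.1 y.2 ∧ ¬ X.Adj (τ y).1 (τ y).2 := fun y => by simp [B]
  have hB : B.card ≤ 4 := by
    refine le_trans (le_of_eq ?_) hX
    refine Finset.card_bijective Prod.swap Prod.swap_bijective fun y => ?_
    rw [hmem, Finset.mem_filter]
    simp only [Finset.mem_univ, true_and, next_apply, Prod.swap_swap, Prod.fst_swap, Prod.snd_swap,
      X.adj_comm y.2 y.1]
  obtain ⟨f, hf⟩ := exists_enum B hB
  refine ⟨f, h.off, h.fst, h.invol, h.adj, fun y hy => ?_⟩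
  have halt := h.alt y hy
  rw [recolour, recolour, hf, hf, hmem, hmem, h.invol, symmDiff_adj, symmDiff_adj]
  tauto

end Counting

end Circuit

/-! ## The congestion of the canonical paths -/

namespace TwoClassPAM

open MarkovChain Circuit

variable {I : TwoClassPAM}

lemma deg_eq_card (G : SimpleGraph (Fin I.n)) (v : Fin I.n) :
    I.deg G v = (open Classical in
      (Finset.univ.filter fun y : Fin I.n × Fin I.n => G.Adj y.1 y.2 ∧ y.1 = v).card) := by
  classical
  have h := deg_eq_sum G v
  rw [Finset.sum_boole, Finset.filter_filter] at h
  exact_mod_cast h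

/-- The pairings used to route from the realization `G` to the realization `H`. -/
noncomputable def pairings (G H : I.State) : Finset (Equiv.Perm (Fin I.n × Fin I.n)) :=
  altSet (G.1 ∆ H.1) fun y => G.1.Adj y.1 y.2

/-- Equal degrees in G and H leave equally many edges of G \ H and H \ G at each vertex. -/
lemma pairings_nonempty {G H : I.State} (hG : I.IsRealization G.1) (hH : I.IsRealization H.1) :
    (pairings G H).Nonempty := by
  classical
  refine altSet_nonempty fun v => ?_
  have h : I.deg G.1 v = I.deg H.1 v := by rw [hG.1, hH.1]
  rw [deg_eq_card, deg_eq_card] at h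
  have h2 := Finset.card_sdiff_comm h
  simp only [dartCount]
  refine Eq.trans ?_ (h2.trans ?_)
  · congr 1
    ext y
    simp only [Finset.mem_filter, Finset.mem_univ, true_and, Finset.mem_sdiff, symmDiff_adj]
    tauto
  · congr 1
    ext y
    simp only [Finset.mem_filter, Finset.mem_univ, true_and, Finset.mem_sdiff, symmDiff_adj]
    tauto

/-- If `Z` lies between `G` and `H` then so does the complementary graph `Z ∆ (G ∆ H)`, and it
deviates from the degrees and the cut in the opposite way. -/
lemma isState_complement {G H Z X : SimpleGraph (Fin I.n)} (hG : I.IsRealization G)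
    (hH : I.IsRealization H) (hX : X ≤ G ∆ H) (hZX : Z = G ∆ X) (hZ : I.IsState Z) :
    I.IsState (Z ∆ (G ∆ H)) := by
  classical
  have hsum : ∀ ω : Fin I.n × Fin I.n → ℤ,
      (∑ y : Fin I.n × Fin I.n with (Z ∆ (G ∆ H)).Adj y.1 y.2, ω y) +
        (∑ y : Fin I.n × Fin I.n with Z.Adj y.1 y.2, ω y) =
      (∑ y : Fin I.n × Fin I.n with G.Adj y.1 y.2, ω y) +
        ∑ y : Fin I.n × Fin I.n with H.Adj y.1 y.2, ω y := by
    intro ω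
    simp only [Finset.sum_filter, ← Finset.sum_add_distrib]
    refine Finset.sum_congr rfl fun y _ => ?_
    have h0 : X.Adj y.1 y.2 → (G ∆ H).Adj y.1 y.2 := fun h => hX h
    rw [symmDiff_adj] at h0
    have h1 : Z.Adj y.1 y.2 ↔ (G.Adj y.1 y.2 ↔ ¬ X.Adj y.1 y.2) := by rw [hZX, symmDiff_adj]
    have h2 : (Z ∆ (G ∆ H)).Adj y.1 y.2 ↔
        (Z.Adj y.1 y.2 ↔ ¬ (G.Adj y.1 y.2 ↔ ¬ H.Adj y.1 y.2)) := by
      rw [symmDiff_adj, symmDiff_adj]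
    by_cases a1 : G.Adj y.1 y.2 <;> by_cases a2 : H.Adj y.1 y.2 <;>
      by_cases a3 : X.Adj y.1 y.2 <;> simp_all
  have hdeg : ∀ v, (I.d v : ℤ) - I.deg (Z ∆ (G ∆ H)) v = -((I.d v : ℤ) - I.deg Z v) := by
    intro v
    have h := hsum fun y => if y.1 = v then 1 else 0
    have e1 := deg_eq_sum (Z ∆ (G ∆ H)) v
    have e2 := deg_eq_sum Z v
    have e3 := deg_eq_sum G v
    have e4 := deg_eq_sum H v
    rw [hG.1] at e3
    rw [hH.1] at e4
    have h' : (I.deg (Z ∆ (G ∆ H)) v : ℤ) + I.deg Z v = I.d v + I.d v := by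
      rw [e1, e2]
      nth_rewrite 1 [e3]
      rw [e4]
      convert h
    linarith
  have hcut : (I.cut (Z ∆ (G ∆ H)) : ℤ) = 2 * I.γ - I.cut Z := by
    have h := hsum I.cutWeight
    have e1 := cut_eq_sum (Z ∆ (G ∆ H))
    have e2 := cut_eq_sum Z
    have e3 := cut_eq_sum G
    have e4 := cut_eq_sum H
    rw [hG.2] at e3
    rw [hH.2] at e4
    have h' : (I.cut (Z ∆ (G ∆ H)) : ℤ) + I.cut Z = I.γ + I.γ := by
      rw [e1, e2]
      nth_rewrite 1 [e3]
      rw [e4]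
      convert h
    linarith
  obtain ⟨h1, h2, h3⟩ := hZ
  refine ⟨?_, ?_, ?_⟩
  · simp only [hdeg, Finset.sum_neg_distrib, h1, neg_zero]
  · simpa only [hdeg, abs_neg] using h2
  · rw [hcut]
    simp only [Set.mem_insert_iff, Set.mem_singleton_iff] at h3 ⊢
    omega

/-- The information which, together with a state on a canonical path and the pairing, determines
the end points of the path. -/
abbrev Code (I : TwoClassPAM) : Type :=
  I.State × (Fin (I.n ^ 2 + 1) × Fin (I.n ^ 2 + 1) × Bool) ×
    (Fin 4 → Option (Fin I.n × Fin I.n))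

/-- The initial point of the canonical path. -/
noncomputable def decode (Z : I.State) (D : Code I) (τ : Equiv.Perm (Fin I.n × Fin I.n)) :
    SimpleGraph (Fin I.n) :=
  Z.1 ∆ seg (Z.1 ∆ D.1.1) (tour (Z.1 ∆ D.1.1) τ) D.2.1.1 D.2.1.2.1 D.2.1.2.2

/-- The pairings compatible with a code. -/
noncomputable def codeSet (Z : I.State) (D : Code I) : Finset (Equiv.Perm (Fin I.n × Fin I.n)) :=
  altSet (Z.1 ∆ D.1.1) (recolour Z.1 D.2.2)

/-- The code stores the complementary state Z ∆ (G ∆ H), so that Z returns G ∆ H, together with the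
segment parameters and the recoloured darts. `codeSet` concerns the same graph in another colouring,
so it is no larger than the set of pairings. -/
lemma exists_code {G H Z : I.State} (hG : I.IsRealization G.1) (hH : I.IsRealization H.1)
    {τ : Equiv.Perm (Fin I.n × Fin I.n)} (hτ : τ ∈ pairings G H) (hZ : Z ∈ visited G H τ) :
    ∃ D : Code I, τ ∈ codeSet Z D ∧ G.1 = decode Z D τ ∧
      H.1 = decode Z D τ ∆ (Z.1 ∆ D.1.1) ∧ (codeSet Z D).card ≤ (pairings G H).card := by
  classical
  have h := mem_altSet.1 hτ
  have hl := isTour_tour h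
  obtain ⟨a, b, β, hab⟩ := (Finset.mem_filter.1 hZ).2
  have hL := isState_complement hG hH (hl.seg_le a b β) hab Z.2
  obtain ⟨B, hB⟩ := h.exists_recolour (hl.cross_seg_le h a b β)
  rw [← hab] at hB
  have hZL : Z.1 ∆ (Z.1 ∆ (G.1 ∆ H.1)) = G.1 ∆ H.1 := symmDiff_symmDiff_cancel_left _ _
  have hG' : G.1 = Z.1 ∆ seg (G.1 ∆ H.1) (tour (G.1 ∆ H.1) τ) a b β := by
    rw [hab, symmDiff_symmDiff_cancel_right]
  have hdec : G.1 = decode Z (⟨_, hL⟩, (a, b, β), B) τ := by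
    rw [decode, hZL]
    exact hG'
  refine ⟨(⟨_, hL⟩, (a, b, β), B), ?_, hdec, ?_, ?_⟩
  · rw [codeSet, hZL]; exact mem_altSet.2 hB
  · rw [← hdec, hZL, symmDiff_symmDiff_cancel_left]
  · rw [codeSet, hZL]; exact card_altSet_le ⟨τ, hτ⟩

open Classical in
/-- The flow from `G` to `H` through `Z`, as a fraction. -/
noncomputable def load (Z G H : I.State) : ℝ :=
  if I.IsRealization G.1 ∧ I.IsRealization H.1 then
    ∑ τ ∈ pairings G H, if Z ∈ visited G H τ then (1 : ℝ) / (pairings G H).card else 0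
  else 0

lemma load_nonneg (Z G H : I.State) : 0 ≤ load Z G H := by
  rw [load]
  split_ifs
  · refine Finset.sum_nonneg fun τ _ => ?_
    split_ifs <;> positivity
  · exact le_rfl

/-- A code and a pairing determine the end points, so after exchanging sums each code contributes at
most |codeSet| terms of weight 1/|codeSet|, that is, at most 1. -/
theorem sum_load_le (Z : I.State) :
    ∑ G, ∑ H, load Z G H ≤ (Fintype.card (Code I) : ℝ) := by
  classical
  let u : Code I → Equiv.Perm (Fin I.n × Fin I.n) → I.State × I.State → ℝ := fun D τ p =>
    if τ ∈ codeSet Z D ∧ p.1.1 = decode Z D τ ∧ p.2.1 = decode Z D τ ∆ (Z.1 ∆ D.1.1) then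
      (1 : ℝ) / (codeSet Z D).card else 0
  have hu : ∀ D τ p, 0 ≤ u D τ p := by
    intro D τ p
    simp only [u]
    split_ifs <;> positivity
  have h1 : ∀ p : I.State × I.State, load Z p.1 p.2 ≤ ∑ τ, ∑ D, u D τ p := by
    intro p
    have hnn : 0 ≤ ∑ τ, ∑ D, u D τ p :=
      Finset.sum_nonneg fun τ _ => Finset.sum_nonneg fun D _ => hu D τ p
    rw [load]
    split_ifs with hp
    · refine le_trans (Finset.sum_le_sum fun τ hτ => ?_)
        (Finset.sum_le_univ_sum_of_nonneg fun τ => Finset.sum_nonneg fun D _ => hu D τ p)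
      split_ifs with hZ
      · obtain ⟨D, hD1, hD2, hD3, hD4⟩ := exists_code hp.1 hp.2 hτ hZ
        refine le_trans ?_ (Finset.single_le_sum (fun D _ => hu D τ p) (Finset.mem_univ D))
        simp only [u]
        rw [if_pos ⟨hD1, hD2, hD3⟩]
        have : 0 < (codeSet Z D).card := Finset.card_pos.2 ⟨τ, hD1⟩
        exact one_div_le_one_div_of_le (by exact_mod_cast this) (by exact_mod_cast hD4)
      · exact Finset.sum_nonneg fun D _ => hu D τ p
    · exact hnn
  have h2 : ∀ D τ, ∑ p, u D τ p ≤ if τ ∈ codeSet Z D then (1 : ℝ) / (codeSet Z D).card else 0 := by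
    intro D τ
    by_cases hτ : τ ∈ codeSet Z D
    · rw [if_pos hτ]
      simp only [u, hτ, true_and]
      rw [← Finset.sum_filter, Finset.sum_const, nsmul_eq_mul]
      refine mul_le_of_le_one_left (by positivity) ?_
      have : (Finset.univ.filter fun p : I.State × I.State =>
          p.1.1 = decode Z D τ ∧ p.2.1 = decode Z D τ ∆ (Z.1 ∆ D.1.1)).card ≤ 1 := by
        rw [Finset.card_le_one]
        intro p hp q hq
        simp only [Finset.mem_filter, Finset.mem_univ, true_and] at hp hq
        exact Prod.ext (Subtype.ext (hp.1.trans hq.1.symm)) (Subtype.ext (hp.2.trans hq.2.symm))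
      exact_mod_cast this
    · rw [if_neg hτ]
      exact (Finset.sum_eq_zero fun p _ => if_neg fun h => hτ h.1).le
  calc ∑ G, ∑ H, load Z G H = ∑ p : I.State × I.State, load Z p.1 p.2 :=
        (Fintype.sum_prod_type' (f := fun G H => load Z G H)).symm
    _ ≤ ∑ p, ∑ τ, ∑ D, u D τ p := Finset.sum_le_sum fun p _ => h1 p
    _ = ∑ D, ∑ τ, ∑ p, u D τ p := by
        rw [Finset.sum_comm]
        rw [Finset.sum_congr rfl fun τ _ => Finset.sum_comm, Finset.sum_comm]
    _ ≤ ∑ D, ∑ τ, if τ ∈ codeSet Z D then (1 : ℝ) / (codeSet Z D).card else 0 :=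
        Finset.sum_le_sum fun D _ => Finset.sum_le_sum fun τ _ => h2 D τ
    _ ≤ ∑ _D : Code I, (1 : ℝ) := by
        refine Finset.sum_le_sum fun D _ => ?_
        rw [← Finset.sum_filter, Finset.sum_const, nsmul_eq_mul]
        have : (Finset.univ.filter fun τ => τ ∈ codeSet Z D) = codeSet Z D := by ext; simp
        rw [this, mul_one_div]
        exact div_self_le_one _
    _ = _ := by simp

lemma card_code : Fintype.card (Code I) = Fintype.card I.State *
    ((I.n ^ 2 + 1) * (I.n ^ 2 + 1) * 2 * (I.n ^ 2 + 1) ^ 4) := by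
  simp only [Code, Fintype.card_prod, Fintype.card_fin, Fintype.card_bool, Fintype.card_pi,
    Fintype.card_option, Finset.prod_const, Finset.card_univ]
  ring

/-! ## Paths between arbitrary states -/

open Classical in
/-- The states within distance `k` of `X`. -/
noncomputable def ball (k : ℕ) (X : I.State) : Finset I.State :=
  Finset.univ.filter fun Y => WithinDist I.hingeFlipChain k X Y

lemma mem_ball {k : ℕ} {X Y : I.State} : Y ∈ ball k X ↔ WithinDist I.hingeFlipChain k X Y := by
  simp [ball]

lemma mem_ball_comm {k : ℕ} {X Y : I.State} : Y ∈ ball k X ↔ X ∈ ball k Y := by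
  rw [mem_ball, mem_ball]
  exact ⟨WithinDist.symm, WithinDist.symm⟩

lemma reflTransGen_of_isChain {α : Type*} {r : α → α → Prop} {s : Set α} :
    ∀ (l : List α) (x y : α), l.head? = some x → l.getLast? = some y → l.IsChain r →
      (∀ z ∈ l, z ∈ s) → Relation.ReflTransGen (fun u v => r u v ∧ u ∈ s) x y
  | [], x, y, h, _, _, _ => by simp at h
  | [a], x, y, h1, h2, _, _ => by
    simp only [List.head?_cons, List.getLast?_singleton, Option.some.injEq] at h1 h2
    rw [← h1, ← h2]
  | a :: b :: l, x, y, h1, h2, h3, h4 => by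
    simp only [List.head?_cons, Option.some.injEq] at h1
    subst h1
    rw [List.getLast?_cons_cons] at h2
    rw [List.isChain_cons_cons] at h3
    exact Relation.ReflTransGen.head ⟨h3.1, h4 _ (by simp)⟩
      (reflTransGen_of_isChain (b :: l) b y rfl h2 h3.2 fun z hz => h4 z (List.mem_cons_of_mem _ hz))

lemma exists_list_in_ball {k : ℕ} {X Y : I.State} (h : WithinDist I.hingeFlipChain k X Y) :
    ∃ l : List I.State, l.head? = some X ∧ l.getLast? = some Y ∧
      l.IsChain (Arc I.hingeFlipChain) ∧ ∀ Z ∈ l, Z ∈ ball k X := by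
  obtain ⟨l, h1, h2, h3, h4⟩ := h
  refine ⟨l, h1, h2, h3, fun Z hZ => mem_ball.2 ?_⟩
  obtain ⟨l₁, l₂, rfl⟩ := List.append_of_mem hZ
  refine ⟨l₁ ++ [Z], ?_, by simp, ?_, ?_⟩
  · cases l₁ <;> simpa using h1
  · exact h3.prefix ⟨l₂, by simp⟩
  · simp only [List.length_append, List.length_cons, List.length_nil] at h4 ⊢
    omega

/-- The states visited on the way from `X` to `Y`, which leads through the realizations `G` and
`H`. -/
noncomputable def route (k : ℕ) (X G H Y : I.State) (τ : Equiv.Perm (Fin I.n × Fin I.n)) :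
    Finset I.State :=
  open Classical in ball k X ∪ visited G H τ ∪ ball k Y

lemma card_route_le (k : ℕ) (X G H Y : I.State) (τ : Equiv.Perm (Fin I.n × Fin I.n)) :
    (route k X G H Y τ).card ≤
      2 * (I.n ^ 3 + 1) ^ k + (I.n ^ 2 + 1) * (I.n ^ 2 + 1) * 2 := by
  classical
  have h1 : (ball k X).card ≤ (I.n ^ 3 + 1) ^ k := card_withinDist_le k X
  have h2 : (ball k Y).card ≤ (I.n ^ 3 + 1) ^ k := card_withinDist_le k Y
  have h3 := card_visited_le G H τ
  have h4 := Finset.card_union_le (ball k X ∪ visited G H τ) (ball k Y)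
  have h5 := Finset.card_union_le (ball k X) (visited G H τ)
  have h6 : (route k X G H Y τ).card = (ball k X ∪ visited G H τ ∪ ball k Y).card := by
    rw [route]
  omega

lemma mem_route {k : ℕ} {X G H Y Z : I.State} {τ : Equiv.Perm (Fin I.n × Fin I.n)} :
    Z ∈ route k X G H Y τ ↔ Z ∈ ball k X ∨ Z ∈ visited G H τ ∨ Z ∈ ball k Y := by
  classical
  rw [route, Finset.mem_union, Finset.mem_union, or_assoc]

lemma reflTransGen_route {k : ℕ} {X G H Y : I.State} {τ : Equiv.Perm (Fin I.n × Fin I.n)}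
    (hXG : WithinDist I.hingeFlipChain k X G) (hYH : WithinDist I.hingeFlipChain k Y H)
    (hG : I.IsRealization G.1) (hH : I.IsRealization H.1) (hτ : τ ∈ pairings G H) :
    Relation.ReflTransGen (fun u v => Arc I.hingeFlipChain u v ∧ u ∈ route k X G H Y τ) X Y ∧
      Y ∈ route k X G H Y τ := by
  obtain ⟨l, h1, h2, h3, h4⟩ := exists_list_in_ball hXG
  obtain ⟨l', h1', h2', h3', h4'⟩ := exists_list_in_ball hYH
  obtain ⟨hv, -, -⟩ := reflTransGen_visited hG hH (mem_altSet.1 hτ)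
  have p1 := reflTransGen_of_isChain (s := {u | u ∈ route k X G H Y τ}) l X G h1 h2 h3
    fun z hz => mem_route.2 (Or.inl (h4 z hz))
  have p3 := reflTransGen_of_isChain (s := {u | u ∈ route k X G H Y τ}) l'.reverse H Y
    (by rwa [List.head?_reverse]) (by rwa [List.getLast?_reverse])
    (by rw [List.isChain_reverse]; exact h3'.imp fun _ _ h => arc_symm h)
    fun z hz => mem_route.2 (Or.inr (Or.inr (h4' z (List.mem_reverse.1 hz))))
  refine ⟨(p1.trans (Relation.ReflTransGen.mono (fun _ _ h => ⟨h.1, mem_route.2 (Or.inr (Or.inl h.2))⟩) _ _ hv)).trans p3,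
    mem_route.2 (Or.inr (Or.inr (h4' Y (List.mem_of_mem_head? h1'))))⟩

/-- If no realization were within `k`, every admissible radius, and so their infimum, would be at
least k + 1. -/
lemma exists_realization_of_kParam_le {k : ℕ} (h : I.kParam ≤ k) (X : I.State) :
    ∃ G : I.State, I.IsRealization G.1 ∧ WithinDist I.hingeFlipChain k X G := by
  have h1 : I.distToRealization X ≤ k := (le_iSup _ X).trans h
  by_contra hc
  have h2 : ((k + 1 : ℕ) : ℕ∞) ≤ I.distToRealization X := by
    refine le_iInf₂ fun r hr => ?_
    obtain ⟨H, hH, l, l1, l2, l3, l4⟩ := hr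
    by_contra hlt
    have hrk : r ≤ k := by
      have : r < k + 1 := by exact_mod_cast not_le.1 hlt
      omega
    exact hc ⟨H, hH, l, l1, l2, l3, by omega⟩
  have h3 := h2.trans h1
  have h4 : k + 1 ≤ k := by exact_mod_cast h3
  omega

/-- The efficient flow. -/
theorem exists_flow {k : ℕ} (h : I.kParam ≤ k) :
    ∃ F : Flow I.hingeFlipChain I.uniform,
      F.maxLength ≤ 2 * (I.n ^ 3 + 1) ^ k + (I.n ^ 2 + 1) * (I.n ^ 2 + 1) * 2 ∧
      ∀ u v, F.onArc u v ≤
        (2 * ((I.n : ℝ) ^ 3 + 1) ^ k + (((I.n : ℝ) ^ 3 + 1) ^ k) ^ 2 *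
          (((I.n : ℝ) ^ 2 + 1) * ((I.n : ℝ) ^ 2 + 1) * 2 * ((I.n : ℝ) ^ 2 + 1) ^ 4)) /
          (Fintype.card I.State : ℝ) := by
  classical
  -- Each state X is given a realization φ X within distance k; the route from X to Y is X, φ X, φ
  -- Y, Y.
  choose φ hφ hφd using exists_realization_of_kParam_le h
  have hA : ∀ X Y, (pairings (φ X) (φ Y)).Nonempty := fun X Y => pairings_nonempty (hφ X) (hφ Y)
  obtain ⟨F, hF1, hF2⟩ := exists_flow_of_paths (P := I.hingeFlipChain) (π := I.uniform)
    (w := 1 / (Fintype.card I.State : ℝ) ^ 2) (by positivity)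
    (fun X Y => by rw [uniform, uniform]; ring)
    (fun X Y => pairings (φ X) (φ Y)) hA
    (fun X Y τ => route k X (φ X) (φ Y) Y τ)
    (fun X Y τ hτ => (reflTransGen_route (hφd X) (hφd Y) (hφ X) (hφ Y) hτ).2)
    (fun X Y τ hτ => (reflTransGen_route (hφd X) (hφd Y) (hφ X) (hφ Y) hτ).1)
    (fun X Y τ _ => card_route_le k X (φ X) (φ Y) Y τ)
  refine ⟨F, hF1, fun u v => (hF2 u v).trans ?_⟩
  set N : ℝ := ((Fintype.card I.State : ℕ) : ℝ) with hN
  have hNpos : 0 < N := by rw [hN]; exact_mod_cast Fintype.card_pos_iff.2 ⟨u⟩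
  set b : ℝ := ((I.n : ℝ) ^ 3 + 1) ^ k with hb
  have hball : ∀ X : I.State, ((ball k X).card : ℝ) ≤ b := by
    intro X
    have : (ball k X).card ≤ (I.n ^ 3 + 1) ^ k := card_withinDist_le k X
    rw [hb]
    exact_mod_cast this
  -- splitting the paths into three parts
  have hsplit : ∀ X Y : I.State, (∑ τ ∈ pairings (φ X) (φ Y),
      if u ∈ route k X (φ X) (φ Y) Y τ then (1 : ℝ) / (pairings (φ X) (φ Y)).card else 0) ≤
      (if u ∈ ball k X then 1 else 0) + load u (φ X) (φ Y) + (if u ∈ ball k Y then 1 else 0) := by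
    intro X Y
    have hc : 0 < ((pairings (φ X) (φ Y)).card : ℝ) := by exact_mod_cast Finset.card_pos.2 (hA X Y)
    have hone : ∀ (q : Prop) [Decidable q], (if q then (1 : ℝ) else 0) = ∑ _τ ∈ pairings (φ X) (φ Y),
        if q then (1 : ℝ) / (pairings (φ X) (φ Y)).card else 0 := by
      intro q _
      rw [Finset.sum_const, nsmul_eq_mul]
      split_ifs
      · field_simp
      · simp
    rw [hone (u ∈ ball k X), hone (u ∈ ball k Y), load,
      if_pos (show I.IsRealization (φ X).1 ∧ I.IsRealization (φ Y).1 from ⟨hφ X, hφ Y⟩), ← Finset.sum_add_distrib, ← Finset.sum_add_distrib]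
    refine Finset.sum_le_sum fun τ _ => ?_
    have hw : 0 ≤ (1 : ℝ) / (pairings (φ X) (φ Y)).card := by positivity
    have hmr := mem_route (k := k) (X := X) (G := φ X) (H := φ Y) (Y := Y) (Z := u) (τ := τ)
    by_cases h1 : u ∈ ball k X <;> by_cases h2 : u ∈ visited (φ X) (φ Y) τ <;>
      by_cases h3 : u ∈ ball k Y <;> simp only [hmr, h1, h2, h3, if_true, if_false, or_true,
        true_or, or_false, false_or] <;> linarith
  have hcount : ∑ X : I.State, (if u ∈ ball k X then (1 : ℝ) else 0) ≤ b := by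
    rw [Finset.sum_boole]
    refine le_trans (le_of_eq ?_) (hball u)
    congr 2
    ext X
    simp [mem_ball_comm (X := X)]
  -- every realization is assigned to few states
  have hfib : ∀ f : I.State → ℝ, (∀ G, 0 ≤ f G) → ∑ X, f (φ X) ≤ b * ∑ G, f G := by
    intro f hf
    rw [← Finset.sum_fiberwise_of_maps_to (t := Finset.univ) (g := φ) (fun X _ => Finset.mem_univ _),
      Finset.mul_sum]
    refine Finset.sum_le_sum fun G _ => ?_
    rw [Finset.sum_congr rfl fun X hX => by rw [(Finset.mem_filter.1 hX).2], Finset.sum_const,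
      nsmul_eq_mul]
    refine mul_le_mul_of_nonneg_right (le_trans ?_ (hball G)) (hf G)
    have hsub : (Finset.univ.filter fun X => φ X = G) ⊆ ball k G := by
      intro X hX
      rw [← (Finset.mem_filter.1 hX).2, mem_ball_comm, mem_ball]
      exact hφd X
    exact_mod_cast Finset.card_le_card hsub
  have hload : ∑ X, ∑ Y, load u (φ X) (φ Y) ≤ b * (b * (N *
      (((I.n : ℝ) ^ 2 + 1) * ((I.n : ℝ) ^ 2 + 1) * 2 * ((I.n : ℝ) ^ 2 + 1) ^ 4))) := by
    have hb0 : 0 ≤ b := by positivity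
    have hs := sum_load_le u
    rw [card_code] at hs
    push_cast at hs
    calc ∑ X, ∑ Y, load u (φ X) (φ Y) ≤ ∑ X, b * ∑ H, load u (φ X) H :=
          Finset.sum_le_sum fun X _ => hfib (fun H => load u (φ X) H) fun H => load_nonneg _ _ _
      _ = b * ∑ X, ∑ H, load u (φ X) H := by rw [Finset.mul_sum]
      _ ≤ b * (b * ∑ G, ∑ H, load u G H) := mul_le_mul_of_nonneg_left
          (hfib (fun G => ∑ H, load u G H) fun G => Finset.sum_nonneg fun H _ => load_nonneg _ _ _)
          hb0
      _ ≤ _ := mul_le_mul_of_nonneg_left (mul_le_mul_of_nonneg_left hs hb0) hb0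
  set K : ℝ := ((I.n : ℝ) ^ 2 + 1) * ((I.n : ℝ) ^ 2 + 1) * 2 * ((I.n : ℝ) ^ 2 + 1) ^ 4
  -- The two balls contribute N b each and the canonical paths b² N K; the factor 1/N² from the
  -- demands leaves a single 1/N.
  have htotal : (∑ X, ∑ Y, ∑ τ ∈ pairings (φ X) (φ Y),
      if u ∈ route k X (φ X) (φ Y) Y τ then (1 : ℝ) / (pairings (φ X) (φ Y)).card else 0) ≤
      N * b + b * (b * (N * K)) + N * b := by
    refine (Finset.sum_le_sum fun X _ => Finset.sum_le_sum fun Y _ => hsplit X Y).trans ?_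
    simp only [Finset.sum_add_distrib]
    refine add_le_add (add_le_add ?_ hload) ?_
    · rw [Finset.sum_comm]
      refine (Finset.sum_le_sum fun Y _ => hcount).trans (le_of_eq ?_)
      simp [hN]
    · refine (Finset.sum_le_sum fun X _ => hcount).trans (le_of_eq ?_)
      simp [hN]
  refine (mul_le_mul_of_nonneg_left (le_trans (le_of_eq ?_) htotal) (by positivity)).trans
    (le_of_eq ?_)
  · congr!
  · field_simp
    ring

end TwoClassPAM

/-! ### Polynomial bounds and conclusion -/

/-- The polynomial bound on the congestion. -/
noncomputable def congestionPoly (k : ℕ) : Polynomial ℝ :=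
  2 * (Polynomial.X ^ 3 + 1) ^ k + ((Polynomial.X ^ 3 + 1) ^ k) ^ 2 *
    ((Polynomial.X ^ 2 + 1) * (Polynomial.X ^ 2 + 1) * 2 * (Polynomial.X ^ 2 + 1) ^ 4)

/-- The polynomial bound on the length of the paths. -/
noncomputable def lengthPoly (k : ℕ) : Polynomial ℝ :=
  2 * (Polynomial.X ^ 3 + 1) ^ k + (Polynomial.X ^ 2 + 1) * (Polynomial.X ^ 2 + 1) * 2

lemma eval_congestionPoly (k : ℕ) (x : ℝ) : (congestionPoly k).eval x =
    2 * (x ^ 3 + 1) ^ k + ((x ^ 3 + 1) ^ k) ^ 2 *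
      ((x ^ 2 + 1) * (x ^ 2 + 1) * 2 * (x ^ 2 + 1) ^ 4) := by
  simp [congestionPoly]

lemma eval_lengthPoly (k : ℕ) (x : ℝ) : (lengthPoly k).eval x =
    2 * (x ^ 3 + 1) ^ k + (x ^ 2 + 1) * (x ^ 2 + 1) * 2 := by
  simp [lengthPoly]

/-- `LazySymm.mixingTime_le` requires its parameters to be at least 1; both polynomials have this
shape. -/
lemma one_le_two_mul_pow_add {x y : ℝ} (hx : 0 ≤ x) (hy : 0 ≤ y) (k : ℕ) :
    1 ≤ 2 * (x ^ 3 + 1) ^ k + y := by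
  have h : 1 ≤ (x ^ 3 + 1) ^ k := one_le_pow₀ (le_add_of_nonneg_left (by positivity))
  linarith

theorem theoremE2 (𝒟 : Set TwoClassPAM) (k : ℕ) (h𝒟 : TwoClassPAM.StronglyStable 𝒟 k) :
    -- an efficient multicommodity flow for every member of the family
    (∃ p r s : Polynomial ℝ, ∀ I ∈ 𝒟,
      (∃ f : MarkovChain.Flow I.hingeFlipChain I.uniform,
        (∀ G H : I.State, MarkovChain.Arc I.hingeFlipChain G H →
          f.onArc G H ≤ p.eval (I.n : ℝ) / (Fintype.card I.State : ℝ)) ∧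
        (f.maxLength : ℝ) ≤ r.eval (I.n : ℝ)) ∧
      (∀ G H : I.State, MarkovChain.Arc I.hingeFlipChain G H →
        1 / I.hingeFlipChain G H ≤ s.eval (I.n : ℝ))) ∧
    -- rapid mixing
    (∃ q : Polynomial ℝ, ∀ I ∈ 𝒟, ∀ ε : ℝ, 0 < ε → ε < 1 →
      (MarkovChain.mixingTime I.hingeFlipChain I.uniform ε : ENNReal) ≤
        ENNReal.ofReal
          (q.eval (I.n : ℝ) * Real.log ((Fintype.card I.State : ℝ) / ε))) := by
  have hflow : ∀ I ∈ 𝒟, ∃ f : MarkovChain.Flow I.hingeFlipChain I.uniform,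
      (∀ G H : I.State, f.onArc G H ≤
        (congestionPoly k).eval (I.n : ℝ) / (Fintype.card I.State : ℝ)) ∧
      (f.maxLength : ℝ) ≤ (lengthPoly k).eval (I.n : ℝ) := by
    intro I hI
    obtain ⟨f, hf1, hf2⟩ := TwoClassPAM.exists_flow (h𝒟 I hI).2
    refine ⟨f, fun G H => ?_, ?_⟩
    · rw [eval_congestionPoly]
      exact hf2 G H
    · rw [eval_lengthPoly]
      exact_mod_cast hf1
  have hs : ∀ I : TwoClassPAM, (2 * Polynomial.X ^ 3 : Polynomial ℝ).eval (I.n : ℝ) =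
      2 * (I.n : ℝ) ^ 3 := fun I => by simp
  refine ⟨⟨congestionPoly k, lengthPoly k, 2 * Polynomial.X ^ 3, fun I hI => ⟨?_, ?_⟩⟩,
    2 * (congestionPoly k * lengthPoly k * (2 * Polynomial.X ^ 3)) + 2, fun I hI ε hε hε1 => ?_⟩
  · obtain ⟨f, hf1, hf2⟩ := hflow I hI
    exact ⟨f, fun G H _ => hf1 G H, hf2⟩
  · intro G H h
    rw [hs]
    exact TwoClassPAM.one_div_le_of_arc h
  · obtain ⟨f, hf1, hf2⟩ := hflow I hI
    have hn : (1 : ℝ) ≤ I.n := by exact_mod_cast I.n_pos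
    have h := TwoClassPAM.lazySymm.mixingTime_le (fun _ => rfl) f
      (p := (congestionPoly k).eval (I.n : ℝ)) (r := (lengthPoly k).eval (I.n : ℝ))
      (s := 2 * (I.n : ℝ) ^ 3)
      (by rw [eval_congestionPoly]; exact one_le_two_mul_pow_add (by positivity) (by positivity) k)
      (by rw [eval_lengthPoly]; exact one_le_two_mul_pow_add (by positivity) (by positivity) k)
      (by linarith [one_le_pow₀ hn (n := 3)])
      (fun G H _ => hf1 G H) hf2 (fun G H h => TwoClassPAM.one_div_le_of_arc h) hε hε1
    refine h.trans_eq ?_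
    rw [Polynomial.eval_add, Polynomial.eval_mul, Polynomial.eval_mul, Polynomial.eval_mul, hs,
      Polynomial.eval_ofNat]
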